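/- Let $n\ge 3$ and let $\mathcal C$ be a marked hyperbolic crown with $n-2$ boundary cusps, that is, an annulus with a hyperbolic metric, one of whose boundary components is a closed geodesic $\gamma$ (the crown boundary) while the other is a chain of $n-2$ bi-infinite geodesics (the geodesic sides), adjacent ones enclosing a boundary cusp. The marking consists of a labelling $1,\dots,n-2$ of the cusps in cyclic order and of a basepoint $p\in\gamma$ with a homotopy class of arcs from $p$ to a boundary cusp. A measured lamination on $\mathcal C$ is a finite collection of pairwise disjoint simple geodesic arcs with positive weights, each of which either joins two boundary cusps (possibly equal) and is not a geodesic side, or runs from a boundary cusp to a point of $\gamma\setminus\{p\}$, or is the closed geodesic $\gamma$; the geodesic sides are also included, with weight $\infty$. Arcs from a boundary cusp to $\gamma$ that are properly homotopic (same cusp and same integer number of twists around $\gamma$, i.e. homotopic by sliding endpoints along $\gamma\setminus\{p\}$) are regarded as one arc, with the sum of their weights. The space $\mathcal{ML}(\mathcal C)$ of measured laminations carries the topology induced by the transverse measures of homotopy classes of arcs between geodesic sides and of arcs from a geodesic side to $p$ (the weight of the geodesic sides not being counted). Let $l\in\mathbb R$ be the transverse measure of $\gamma$: the total weight of the arcs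 that end on $\gamma$, or $-w$ if $\gamma$ is a leaf of weight $w$. If $l>0$, let $\tau\in\mathbb R$ be the boundary twist parameter: the signed transverse measure from the canonical basepoint $p_0$ to $p$, where $p_0$ is the foot of the perpendicular to $\gamma$ from the geodesic side between the cusps labelled $n-2$ and $1$. That is, the algebraic intersection number of the lamination with the path that follows this perpendicular from that side to $p_0$ and then $\gamma$ from $p_0$ to $p$, in the homotopy class given by the marking. Let $Q$ be the closed upper half-plane $\{(x,y)\in\mathbb R^2 : y\ge 0\}$ with $(x,0)$ identified with $(-x,0)$ for all $x$, and assign to a measured lamination the point $[(\tau,l)]\in Q$ if $l>0$ and $[(l,0)]=[(-l,0)]\in Q$ if $l\le 0$. Then $Q$ is homeomorphic to $\mathbb R^2$ and $\mathcal{ML}(\mathcal C)$ is homeomorphic to $\mathbb R^{n-1}$. More precisely, there are homeomorphisms $\Phi:\mathcal{ML}(\mathcal C)\to\mathbb R^{n-1}$ and $\psi:Q\to\mathbb R^2$ such that the first two coordinates of $\Phi(\lambda)$ are $\psi$ of the point of $Q$ assigned to $\lambda$, for every $\lambda$; so $l$ and $\tau$ together account for a copy of $\mathbb R^2$ among the parameters.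 -/

import Mathlib

open scoped ENNReal UpperHalfPlane

/-- The complete geodesic of the hyperbolic plane with (distinct) ideal endpoints `a` and `b`. -/
def hypLine (a b : ℝ) : Set ℍ :=
  {z | dist (z : ℂ) (((a + b) / 2 : ℝ) : ℂ) = |b - a| / 2}

/-- A hyperbolic crown with `m` labelled boundary cusps, given by its developed universal cover in
the upper half-plane, normalized so that the lift of the crown boundary is the imaginary axis and
the deck group is generated by `z ↦ mult * z` (so `Real.log mult` is the length of the crown
boundary). The lifts of the boundary cusps form an increasing bi-infinite sequence of positive
ideal points; `cusp i` is a lift of the cusp whose label is congruent to `i` modulo `m`, and the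
geodesic sides lift to the geodesics joining consecutive lifts of cusps. -/
structure HyperbolicCrown (m : ℕ) where
  mult : ℝ
  one_lt_mult : 1 < mult
  cusp : ℤ → ℝ
  cusp_pos : ∀ i, 0 < cusp i
  cusp_strictMono : StrictMono cusp
  cusp_add : ∀ i, cusp (i + m) = mult * cusp i

/-- A marked hyperbolic crown: besides the labelling of the cusps there is a basepoint `p` on the
crown boundary together with a homotopy class of arcs from `p` to a boundary cusp. This is the same
as a choice of a lift `base * I` of `p` to the imaginary axis: the class is that of the arcs whose
lift joins `base * I` to `cusp 0`. -/
structure MarkedCrown (m : ℕ) extends HyperbolicCrown m where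
  base : ℝ
  base_pos : 0 < base

/-- Labels for the lifts of geodesic arcs on a crown: `line i j` joins the lifted cusps `cusp i` and
`cusp j`, `ray i y` joins the lifted cusp `cusp i` to the point `y * I` of the lift of the crown
boundary, and `boundary` is the lift of the crown boundary. -/
inductive CrownArc : Type
  | line (i j : ℤ)
  | ray (i : ℤ) (y : ℝ)
  | boundary

namespace CrownArc

/-- Each arc is labelled once. -/
def IsValid : CrownArc → Prop
  | line i j => i < j
  | ray _ y => 0 < y
  | boundary => True

/-- The geodesic sides of the crown. -/
def IsSide (a : CrownArc) : Prop := ∃ i : ℤ, a = line i (i + 1)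

/-- The arc as a set of points of the hyperbolic plane. The geodesic through `y * I` with ideal
endpoint `c` has `-(y ^ 2 / c)` as its other ideal endpoint. -/
def carrier {m : ℕ} (C : HyperbolicCrown m) : CrownArc → Set ℍ
  | line i j => hypLine (C.cusp i) (C.cusp j)
  | ray i y => {z | z ∈ hypLine (-(y ^ 2 / C.cusp i)) (C.cusp i) ∧ 0 ≤ z.re}
  | boundary => {z | z.re = 0}

/-- The image of an arc under the deck transformation `z ↦ mult ^ k * z`. -/
noncomputable def translate {m : ℕ} (C : HyperbolicCrown m) (k : ℤ) : CrownArc → CrownArc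
  | line i j => line (i + k * m) (j + k * m)
  | ray i y => ray (i + k * m) (C.mult ^ k * y)
  | boundary => boundary

/-- Two arcs from the crown boundary to a boundary cusp are properly homotopic if they end at the
same (lifted) cusp and make the same number of integer twists around the crown boundary, that is,
if one can be carried to the other by sliding its endpoint along the crown boundary without
crossing the basepoint. Other arcs are properly homotopic only to themselves. -/
def ProperlyHomotopic {m : ℕ} (C : MarkedCrown m) : CrownArc → CrownArc → Prop
  | ray i y, ray i' y' =>
      i = i' ∧ ∀ k : ℤ, (C.mult ^ k * C.base < y ↔ C.mult ^ k * C.base < y')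
  | a, b => a = b

end CrownArc

namespace HyperbolicCrown

/-- The `i`-th lifted geodesic side, between the lifted cusps `i` and `i + 1`. -/
def side {m : ℕ} (C : HyperbolicCrown m) (i : ℤ) : Set ℍ :=
  hypLine (C.cusp i) (C.cusp (i + 1))

/-- The universal cover of the crown, as a subset of the hyperbolic plane: the region bounded by
the imaginary axis and the lifted geodesic sides. -/
def cover {m : ℕ} (C : HyperbolicCrown m) : Set ℍ :=
  {z | 0 ≤ z.re ∧ ∀ i : ℤ, (C.cusp (i + 1) - C.cusp i) / 2 ≤
    dist (z : ℂ) (((C.cusp i + C.cusp (i + 1)) / 2 : ℝ) : ℂ)}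

/-- The arc `a` separates `A` from `B`: every path in the universal cover of the crown
from a point of `A` to a point of `B` meets `a`. -/
def Separates {m : ℕ} (C : HyperbolicCrown m) (a : CrownArc) (A B : Set ℍ) : Prop :=
  ∀ z ∈ A, ∀ w ∈ B, ¬ JoinedIn (C.cover \ a.carrier C) z w

end HyperbolicCrown

/-- The chosen lift of the basepoint of the crown boundary. -/
def MarkedCrown.basePoint {m : ℕ} (C : MarkedCrown m) : ℍ :=
  UpperHalfPlane.mk ⟨0, C.base⟩ C.base_pos

/-- A measured lamination on a crown, described by its lift to the universal cover: a collection of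
pairwise disjoint weighted geodesic arcs, invariant under the deck group and finite modulo it. Each
arc runs between two boundary cusps, or from a boundary cusp to the crown boundary, or is the crown
boundary itself. A weight `0` means that the arc does not belong to the lamination. The
geodesic sides belong to it with infinite weight, and all other weights are finite. Arcs do not end
at the basepoint of the crown boundary. -/
structure MeasuredLamination {m : ℕ} (C : MarkedCrown m) where
  weight : CrownArc → ℝ≥0∞
  valid : ∀ a, weight a ≠ 0 → a.IsValid
  weight_side : ∀ a : CrownArc, a.IsSide → weight a = ⊤
  weight_ne_top : ∀ a : CrownArc, ¬ a.IsSide → weight a ≠ ⊤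
  weight_translate : ∀ (k : ℤ) (a : CrownArc),
    weight (a.translate C.toHyperbolicCrown k) = weight a
  disjoint : ∀ a b : CrownArc, weight a ≠ 0 → weight b ≠ 0 → a ≠ b →
    Disjoint (a.carrier C.toHyperbolicCrown) (b.carrier C.toHyperbolicCrown)
  finite_mod_deck : ∃ F : Set CrownArc, F.Finite ∧
    ∀ a, weight a ≠ 0 → ∃ b ∈ F, ∃ k : ℤ, a = b.translate C.toHyperbolicCrown k
  ray_end_ne : ∀ (i : ℤ) (y : ℝ), weight (.ray i y) ≠ 0 →
    ∀ k : ℤ, y ≠ C.mult ^ k * C.base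

namespace MeasuredLamination

variable {m : ℕ} {C : MarkedCrown m}

/-- The transverse measure of the homotopy class of arcs in the crown whose lifts run from `A` to
`B`: the total weight of the leaves that all these arcs have to meet. The geodesic sides, which
have infinite weight, are not counted. -/
noncomputable def transverseMeasure (μ : MeasuredLamination C) (A B : Set ℍ) : ℝ≥0∞ :=
  ∑' a : {a : CrownArc // ¬ a.IsSide ∧ C.toHyperbolicCrown.Separates a A B}, μ.weight a

/-- The topology induced by the transverse measures of the homotopy classes of arcs between
geodesic sides and of arcs from a geodesic side to the basepoint of the crown boundary. -/
noncomputable instance : TopologicalSpace (MeasuredLamination C) :=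
  TopologicalSpace.induced
    (fun μ =>
      ((fun q : ℤ × ℤ => μ.transverseMeasure (C.side q.1) (C.side q.2)),
       (fun i : ℤ => μ.transverseMeasure (C.side i) {C.basePoint})))
    inferInstance

/-- The total weight of the leaves that are properly homotopic to `a`. -/
noncomputable def classWeight (μ : MeasuredLamination C) (a : CrownArc) : ℝ≥0∞ :=
  ∑' b : {b : CrownArc // CrownArc.ProperlyHomotopic C a b}, μ.weight b

/-- Properly homotopic arcs count as one arc, with the sum of the weights. -/
noncomputable def properHomotopySetoid (C : MarkedCrown m) : Setoid (MeasuredLamination C) :=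
  Setoid.ker classWeight

/-- The transverse measure of the crown boundary: the total weight of the leaves that end on it,
or, if it is itself a leaf of weight `w`, the number `-w`. -/
noncomputable def boundaryMeasure (μ : MeasuredLamination C) : ℝ :=
  (∑' q : {q : ℤ × ℝ // C.base ≤ q.2 ∧ q.2 < C.mult * C.base},
      μ.weight (.ray q.1.1 q.1.2)).toReal
    - (μ.weight .boundary).toReal

/-- The boundary twist parameter: the signed transverse measure from the canonical
basepoint of the crown boundary to the marked basepoint `p`. The canonical basepoint is the foot of
the perpendicular to the crown boundary from the geodesic side between the cusps labelled `m` and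
`1`. In the lift, a leaf that ends on the crown boundary counts positively if it starts at a cusp
before that side and ends beyond the lift of `p`, and negatively if it starts at a
cusp after that side and ends before the lift of `p`. -/
noncomputable def twist (μ : MeasuredLamination C) : ℝ :=
  (∑' q : {q : ℤ × ℝ // q.1 ≤ 0 ∧ C.base < q.2}, μ.weight (.ray q.1.1 q.1.2)).toReal
    - (∑' q : {q : ℤ × ℝ // 1 ≤ q.1 ∧ q.2 < C.base}, μ.weight (.ray q.1.1 q.1.2)).toReal

end MeasuredLamination

/-- The space of measured laminations on a marked crown. -/
def LaminationSpace {m : ℕ} (C : MarkedCrown m) : Type :=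
  Quotient (MeasuredLamination.properHomotopySetoid C)

/-- The class of a measured lamination. -/
noncomputable def LaminationSpace.mk {m : ℕ} {C : MarkedCrown m} (μ : MeasuredLamination C) :
    LaminationSpace C :=
  Quotient.mk (MeasuredLamination.properHomotopySetoid C) μ

noncomputable instance {m : ℕ} (C : MarkedCrown m) : TopologicalSpace (LaminationSpace C) :=
  inferInstanceAs (TopologicalSpace (Quotient (MeasuredLamination.properHomotopySetoid C)))

/-- The identification of `(x, 0)` with `(-x, 0)` in the closed upper half-plane. -/
def halfPlaneSetoid : Setoid {q : ℝ × ℝ // 0 ≤ q.2} where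
  r a b := a = b ∨ (a.1.2 = 0 ∧ b.1.2 = 0 ∧ a.1.1 = -b.1.1)
  iseqv :=
    { refl := fun _ => Or.inl rfl
      symm := by
        rintro a b (h | ⟨h1, h2, h3⟩)
        · exact Or.inl h.symm
        · exact Or.inr ⟨h2, h1, by rw [h3, neg_neg]⟩
      trans := by
        rintro a b c (rfl | ⟨h1, h2, h3⟩) (rfl | ⟨h4, h5, h6⟩)
        · exact Or.inl rfl
        · exact Or.inr ⟨h4, h5, h6⟩
        · exact Or.inr ⟨h1, h2, h3⟩
        · refine Or.inl (Subtype.ext (Prod.ext ?_ ?_))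
          · rw [h3, h6, neg_neg]
          · rw [h1, h5] }

/-- The parameter space of the pairs (transverse measure, twist parameter): the closed upper
half-plane with the two boundary half-lines identified. -/
abbrev BoundaryParameterSpace : Type := Quotient halfPlaneSetoid

open Classical in
/-- The boundary parameters of a lamination: the twist `τ` and the transverse measure `l` are the
horizontal and the vertical coordinate if `0 < l`. If `l ≤ 0` there is no twist, and `l` gives the
point `(l, 0)`, which is identified with `(-l, 0)`. -/
noncomputable def MeasuredLamination.boundaryParameters {m : ℕ} {C : MarkedCrown m}
    (μ : MeasuredLamination C) : BoundaryParameterSpace :=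
  if h : 0 < μ.boundaryMeasure then
    Quotient.mk halfPlaneSetoid ⟨(μ.twist, μ.boundaryMeasure), h.le⟩
  else
    Quotient.mk halfPlaneSetoid ⟨(μ.boundaryMeasure, 0), le_rfl⟩

/-!
A measured lamination on a crown with `m` cusps is determined, up to proper homotopy, by a few
numerical invariants of its lift to the universal cover.

* For every cusp `i` there are the total weight `depth i` of the leaves that pass above `i` and the
  total weight `rayWeight i` of the leaves from `i` to the crown boundary. Leaves of the two kinds
  would cross, so both numbers are encoded in their difference `excess i`, which is periodic.
  A leaf between two cusps is no longer than one period, so some cusp has no leaf above it; hence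
  the minimum of `excess` is at most `0`. The weight of the leaf from `a` to `b` is the length of
  the set of heights `x` for which `a` and `b` are consecutive among the cusps of depth at
  most `x`. Therefore the depths may be prescribed arbitrarily, subject to these conditions
  (`CrownInvariants.lamination`), and they determine the weights of these leaves
  (`MeasuredLamination.weight_line_eq_of_depth_eq`).
* Let `l = rayTotal` be the sum of `rayWeight` over one period. The leaves that end on the crown
  boundary are parametrized by the real line, on which the deck group translates by `l`. The twist
  is the position of the side `0` relative to the basepoint, and cutting the line at the lifts of
  the basepoint gives the weights of the proper homotopy classes. If `l = 0`, then instead of the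
  twist there is the weight of the crown boundary as a leaf.

So the laminations with given boundary parameters correspond to the periodic vectors `E` with
minimum at most `0` and `∑ max (-E i) 0 = l`. Each class of vectors modulo the diagonal contains
exactly one such vector, because `∑ max (-E i) 0` increases strictly from `0` to infinity when `E`
moves down the diagonal from the vector with minimum `0` (`negPartSum`). Thus the differences
`E i - E 0` are `m - 1` coordinates on each fibre, while `z ↦ z ^ 2` identifies the space of
boundary parameters with the plane. Together these are the `m + 1` coordinates of the theorem.

It remains to compare the topologies. The lamination is dual to a tree with an action of the deck
group, the transverse measures are the distances in this tree between the points dual to the sides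
and to the basepoint, and they are computed from the invariants by
`MeasuredLamination.toReal_transverseMeasure_side_side` and
`MeasuredLamination.toReal_transverseMeasure_side_basePoint`. The main point is that the weight of
the leaves passing above several consecutive cusps is the minimum of their depths
(`MeasuredLamination.exists_depth_eq_commonDepth`). Both directions of the correspondence are then
explicit continuous functions. The twist itself does not stay continuous where `l` tends to `0`, but
the sum of its absolute value and the weight of the crown boundary does, and so do the products of
the twist with `l` and with the increments of the parameter along the boundary, which are dominated
by `l`.

The geometric input, that is, which arcs cross and which arcs separate two given sides or a side
from the basepoint, is obtained in the projective model of the hyperbolic plane with coordinates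
`(re z, |z| ^ 2)`, in which the universal cover of the crown is convex.
-/

/-! ### Half-planes bounded by geodesics -/

/-- The function on the hyperbolic plane that vanishes on the geodesic with ideal endpoints `a` and
`b`, is negative inside the semicircle and positive outside. It is an affine function of the pair
`(re z, |z| ^ 2)`, which are the coordinates of a projective model of the hyperbolic plane in which
geodesics are straight. -/
noncomputable def lineForm (a b : ℝ) (z : ℍ) : ℝ :=
  z.re ^ 2 + z.im ^ 2 - (a + b) * z.re + a * b

theorem dist_eq_sqrt_lineForm (a b : ℝ) (z : ℍ) :
    dist (z : ℂ) (((a + b) / 2 : ℝ) : ℂ) = √(lineForm a b z + ((b - a) / 2) ^ 2) := by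
  rw [Complex.dist_eq_re_im]
  congr 1
  simp only [Complex.ofReal_re, Complex.ofReal_im, UpperHalfPlane.coe_re, UpperHalfPlane.coe_im,
    lineForm]
  ring

theorem mem_hypLine_iff (a b : ℝ) (z : ℍ) : z ∈ hypLine a b ↔ lineForm a b z = 0 := by
  have h : |b - a| / 2 = √(((b - a) / 2) ^ 2) := by
    rw [Real.sqrt_sq_eq_abs, abs_div]; norm_num
  have h0 : 0 ≤ lineForm a b z + ((b - a) / 2) ^ 2 := by
    have : lineForm a b z + ((b - a) / 2) ^ 2 = (z.re - (a + b) / 2) ^ 2 + z.im ^ 2 := by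
      unfold lineForm; ring
    rw [this]; positivity
  rw [hypLine, Set.mem_ofPred_eq, dist_eq_sqrt_lineForm, h, Real.sqrt_inj h0 (sq_nonneg _)]
  constructor <;> intro h <;> linarith

theorem lineForm_nonneg_iff {a b : ℝ} (hab : a < b) (z : ℍ) :
    (b - a) / 2 ≤ dist (z : ℂ) (((a + b) / 2 : ℝ) : ℂ) ↔ 0 ≤ lineForm a b z := by
  rw [dist_eq_sqrt_lineForm, Real.le_sqrt' (by linarith)]
  constructor <;> intro h <;> linarith

theorem continuous_lineForm (a b : ℝ) : Continuous (lineForm a b) := by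
  have h1 := UpperHalfPlane.continuous_re
  have h2 := UpperHalfPlane.continuous_im
  unfold lineForm
  fun_prop

theorem re_mem_of_mem_hypLine {s t : ℝ} (hst : s < t) {z : ℍ} (hz : z ∈ hypLine s t) :
    s < z.re ∧ z.re < t := by
  rw [mem_hypLine_iff] at hz
  have h : 0 < z.im ^ 2 := pow_pos z.im_pos 2
  have h2 : (z.re - s) * (t - z.re) > 0 := by unfold lineForm at hz; nlinarith
  constructor <;> by_contra! hc <;> nlinarith

theorem lineForm_of_mem_hypLine {s t p q : ℝ} {z : ℍ} (hz : z ∈ hypLine s t) :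
    lineForm p q z = (s + t - p - q) * z.re + p * q - s * t := by
  rw [mem_hypLine_iff] at hz
  unfold lineForm at *
  linarith

/-- On a geodesic, `lineForm p q` interpolates linearly between its values at the two ideal
endpoints. -/
theorem lineForm_interpolate {s t p q : ℝ} {z : ℍ} (hz : z ∈ hypLine s t) :
    (t - s) * lineForm p q z =
      (t - z.re) * ((s - p) * (s - q)) + (z.re - s) * ((t - p) * (t - q)) := by
  rw [lineForm_of_mem_hypLine hz]; ring

/-- A geodesic whose ideal endpoints are outside the interval `(p, q)` and not both on its boundary
lies outside the semicircle on `[p, q]`. -/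
theorem lineForm_pos {s t p q : ℝ} (hst : s < t) (hs : 0 ≤ (s - p) * (s - q))
    (ht : 0 ≤ (t - p) * (t - q)) (h : (s - p) * (s - q) ≠ 0 ∨ (t - p) * (t - q) ≠ 0)
    {z : ℍ} (hz : z ∈ hypLine s t) : 0 < lineForm p q z := by
  obtain ⟨h1, h2⟩ := re_mem_of_mem_hypLine hst hz
  have h3 := lineForm_interpolate (p := p) (q := q) hz
  have : 0 < (t - s) * lineForm p q z := by
    rw [h3]
    rcases h with h | h
    · have := mul_pos (sub_pos.2 h2) (lt_of_le_of_ne hs h.symm)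
      have := mul_nonneg (sub_pos.2 h1).le ht
      linarith
    · have := mul_pos (sub_pos.2 h1) (lt_of_le_of_ne ht h.symm)
      have := mul_nonneg (sub_pos.2 h2).le hs
      linarith
  exact (mul_pos_iff_of_pos_left (sub_pos.2 hst)).1 this

/-- A geodesic whose ideal endpoints are in the interval `[p, q]` and not both on its boundary
lies inside the semicircle on `[p, q]`. -/
theorem lineForm_neg {s t p q : ℝ} (hst : s < t) (hs : (s - p) * (s - q) ≤ 0)
    (ht : (t - p) * (t - q) ≤ 0) (h : (s - p) * (s - q) ≠ 0 ∨ (t - p) * (t - q) ≠ 0)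
    {z : ℍ} (hz : z ∈ hypLine s t) : lineForm p q z < 0 := by
  obtain ⟨h1, h2⟩ := re_mem_of_mem_hypLine hst hz
  have h3 := lineForm_interpolate (p := p) (q := q) hz
  have : 0 < (t - s) * (-lineForm p q z) := by
    rw [mul_neg, h3]
    rcases h with h | h
    · have := mul_pos (sub_pos.2 h2) (neg_pos.2 (lt_of_le_of_ne hs h))
      have := mul_nonneg (sub_pos.2 h1).le (neg_nonneg.2 ht)
      linarith
    · have := mul_pos (sub_pos.2 h1) (neg_pos.2 (lt_of_le_of_ne ht h))
      have := mul_nonneg (sub_pos.2 h2).le (neg_nonneg.2 hs)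
      linarith
  linarith [(mul_pos_iff_of_pos_left (sub_pos.2 hst)).1 this]

theorem exists_mem_hypLine_re {s t x : ℝ} (h1 : s < x) (h2 : x < t) :
    ∃ z ∈ hypLine s t, z.re = x := by
  have h : 0 < (x - s) * (t - x) := mul_pos (by linarith) (by linarith)
  refine ⟨UpperHalfPlane.mk ⟨x, √((x - s) * (t - x))⟩ (Real.sqrt_pos.2 h), ?_, rfl⟩
  rw [mem_hypLine_iff]
  have : √((x - s) * (t - x)) ^ 2 = (x - s) * (t - x) := Real.sq_sqrt h.le
  change x ^ 2 + √((x - s) * (t - x)) ^ 2 - (s + t) * x + s * t = 0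
  rw [this]; ring

/-- Geodesics with linked ideal endpoints intersect. -/
theorem exists_mem_hypLine_inter {s p t q : ℝ} (h1 : s < p) (h2 : p < t) (h3 : t < q) :
    ∃ z, z ∈ hypLine s t ∧ z ∈ hypLine p q ∧ z.re * (p + q - s - t) = p * q - s * t ∧
      p < z.re := by
  have hpos : 0 < p + q - s - t := by linarith
  have e : (p * q - s * t) / (p + q - s - t) * (p + q - s - t) = p * q - s * t :=
    div_mul_cancel₀ _ hpos.ne'
  have hp : p < (p * q - s * t) / (p + q - s - t) := by
    rw [lt_div_iff₀ hpos]; nlinarith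
  have ht : (p * q - s * t) / (p + q - s - t) < t := by
    rw [div_lt_iff₀ hpos]; nlinarith
  obtain ⟨z, hz, hx⟩ := exists_mem_hypLine_re (h1.trans hp) ht
  refine ⟨z, hz, ?_, by rw [hx, e], by rw [hx]; exact hp⟩
  rw [mem_hypLine_iff, lineForm_of_mem_hypLine hz, hx]
  linarith

/-- Two points of the hyperbolic plane are joined inside any set that contains the geodesic segment
between them; here the segment is characterized by its straightness in the projective model. -/
theorem joinedIn_of_segment {z w : ℍ} {F : Set ℍ}
    (hF : ∀ x : ℍ, ∀ t : ℝ, 0 ≤ t → t ≤ 1 → x.re = (1 - t) * z.re + t * w.re →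
      (∀ a b, lineForm a b x = (1 - t) * lineForm a b z + t * lineForm a b w) → x ∈ F) :
    JoinedIn F z w := by
  let u : ℝ → ℝ := fun t => (1 - t) * z.re + t * w.re
  let v : ℝ → ℝ := fun t => (1 - t) * (z.re ^ 2 + z.im ^ 2) + t * (w.re ^ 2 + w.im ^ 2)
  have hz : 0 < z.im ^ 2 := pow_pos z.im_pos 2
  have hw : 0 < w.im ^ 2 := pow_pos w.im_pos 2
  have huv : ∀ t : unitInterval, 0 < v t - u t ^ 2 := by
    rintro ⟨t, ht0, ht1⟩
    have e : v t - u t ^ 2 =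
        (1 - t) * z.im ^ 2 + t * w.im ^ 2 + t * (1 - t) * (z.re - w.re) ^ 2 := by
      simp only [u, v]; ring
    have h1 : 0 ≤ t * (1 - t) * (z.re - w.re) ^ 2 :=
      mul_nonneg (mul_nonneg ht0 (by linarith)) (sq_nonneg _)
    have h2 : 0 < (1 - t) * z.im ^ 2 + t * w.im ^ 2 := by
      rcases ht0.eq_or_lt with rfl | h
      · simpa using hz
      · have := mul_pos h hw
        have := mul_nonneg (sub_nonneg.2 ht1) hz.le
        linarith
    change 0 < v t - u t ^ 2
    rw [e]; linarith
  have hc : Continuous fun t : unitInterval => (⟨u t, √(v t - u t ^ 2)⟩ : ℂ) := by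
    have e : (fun t : unitInterval => (⟨u t, √(v t - u t ^ 2)⟩ : ℂ)) =
        fun t : unitInterval => ((u t : ℝ) : ℂ) + ((√(v t - u t ^ 2) : ℝ) : ℂ) * Complex.I := by
      funext t; rw [Complex.mk_eq_add_mul_I]
    rw [e]; simp only [u, v]; fun_prop
  let γ : unitInterval → ℍ := fun t => ⟨⟨u t, √(v t - u t ^ 2)⟩, Real.sqrt_pos.2 (huv t)⟩
  have hγ : Continuous γ := Continuous.upperHalfPlaneMk hc _
  have hre : ∀ t, (γ t).re = u t := fun _ => rfl
  have him : ∀ t, (γ t).im = √(v t - u t ^ 2) := fun _ => rfl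
  refine ⟨⟨⟨γ, hγ⟩, ?_, ?_⟩, fun t => ?_⟩
  · apply UpperHalfPlane.ext_re_im
    · change (γ 0).re = _; rw [hre]; simp [u]
    · change (γ 0).im = _; rw [him]; simp [u, v, Real.sqrt_sq z.im_pos.le]
  · apply UpperHalfPlane.ext_re_im
    · change (γ 1).re = _; rw [hre]; simp [u]
    · change (γ 1).im = _; rw [him]; simp [u, v, Real.sqrt_sq w.im_pos.le]
  · refine hF (γ t) t t.2.1 t.2.2 (hre t) fun a b => ?_
    have h2 : (γ t).im ^ 2 = v t - u t ^ 2 := by rw [him, Real.sq_sqrt (huv t).le]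
    unfold lineForm
    rw [h2, hre]
    simp only [u, v]; ring

theorem not_joinedIn_of_sign {z w : ℍ} {F : Set ℍ} {φ : ℍ → ℝ} (hφ : Continuous φ)
    (hF : ∀ x ∈ F, φ x ≠ 0) (hz : φ z ≤ 0) (hw : 0 ≤ φ w) : ¬ JoinedIn F z w := by
  rintro ⟨γ, hγ⟩
  have h : (0 : ℝ) ∈ Set.Icc ((φ ∘ γ) 0) ((φ ∘ γ) 1) := by
    simpa using ⟨hz, hw⟩
  obtain ⟨t, -, ht⟩ := intermediate_value_Icc (zero_le_one' unitInterval)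
    (hφ.comp γ.continuous).continuousOn h
  exact hF _ (hγ t) ht

/-! ### Crossing and separation of arcs on a crown -/

namespace HyperbolicCrown

variable {m : ℕ} (C : HyperbolicCrown m)

theorem mem_cover_iff (z : ℍ) :
    z ∈ C.cover ↔ 0 ≤ z.re ∧ ∀ i, 0 ≤ lineForm (C.cusp i) (C.cusp (i + 1)) z := by
  refine and_congr Iff.rfl (forall_congr' fun i => ?_)
  exact lineForm_nonneg_iff (C.cusp_strictMono (lt_add_one i)) z

theorem cusp_sub_mul_nonneg {i a b : ℤ} (h : i ≤ a ∨ b ≤ i) (hab : a ≤ b) :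
    0 ≤ (C.cusp i - C.cusp a) * (C.cusp i - C.cusp b) := by
  rcases h with h | h
  · have h1 := C.cusp_strictMono.monotone h
    have h2 := C.cusp_strictMono.monotone (h.trans hab)
    exact mul_nonneg_of_nonpos_of_nonpos (by linarith) (by linarith)
  · have h1 := C.cusp_strictMono.monotone h
    have h2 := C.cusp_strictMono.monotone (hab.trans h)
    exact mul_nonneg (by linarith) (by linarith)

theorem cusp_sub_mul_nonpos {i a b : ℤ} (h1 : a ≤ i) (h2 : i ≤ b) :
    (C.cusp i - C.cusp a) * (C.cusp i - C.cusp b) ≤ 0 := by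
  have h1 := C.cusp_strictMono.monotone h1
  have h2 := C.cusp_strictMono.monotone h2
  exact mul_nonpos_of_nonneg_of_nonpos (by linarith) (by linarith)

theorem cusp_sub_mul_ne_zero {i a b : ℤ} (h1 : i ≠ a) (h2 : i ≠ b) :
    (C.cusp i - C.cusp a) * (C.cusp i - C.cusp b) ≠ 0 :=
  mul_ne_zero (sub_ne_zero.2 fun h => h1 (C.cusp_strictMono.injective h))
    (sub_ne_zero.2 fun h => h2 (C.cusp_strictMono.injective h))

theorem side_subset_cover (i : ℤ) : C.side i ⊆ C.cover := by
  intro z hz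
  have hlt := C.cusp_strictMono (lt_add_one i)
  obtain ⟨h1, h2⟩ := re_mem_of_mem_hypLine hlt hz
  refine (C.mem_cover_iff z).2 ⟨by linarith [C.cusp_pos i], fun j => ?_⟩
  rcases eq_or_ne i j with rfl | hij
  · exact ((mem_hypLine_iff _ _ _).1 hz).ge
  · refine (lineForm_pos hlt (C.cusp_sub_mul_nonneg (by omega) (by omega))
      (C.cusp_sub_mul_nonneg (by omega) (by omega)) ?_ hz).le
    rcases lt_or_gt_of_ne hij with h | h
    · exact Or.inl (C.cusp_sub_mul_ne_zero (by omega) (by omega))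
    · exact Or.inr (C.cusp_sub_mul_ne_zero (by omega) (by omega))

theorem side_nonempty (i : ℤ) : (C.side i).Nonempty := by
  have hlt := C.cusp_strictMono (lt_add_one i)
  obtain ⟨x, h1, h2⟩ := exists_between hlt
  obtain ⟨z, hz, -⟩ := exists_mem_hypLine_re h1 h2
  exact ⟨z, hz⟩

/-- Criterion for separation: the arc is cut out of the universal cover by one function `lineForm`,
which has constant signs on the two sets (negative on `A` if and only if `P`, and negative on `B` if
and only if `Q`). -/
theorem separates_iff_of_sign {a : CrownArc} {A B : Set ℍ} {p q : ℝ} {P Q : Prop}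
    (ha : ∀ z ∈ C.cover, z ∈ a.carrier C ↔ lineForm p q z = 0)
    (hA : A.Nonempty) (hB : B.Nonempty) (hAc : A ⊆ C.cover) (hBc : B ⊆ C.cover)
    (hP : P → ∀ z ∈ A, lineForm p q z < 0) (hP' : ¬ P → ∀ z ∈ A, 0 < lineForm p q z)
    (hQ : Q → ∀ z ∈ B, lineForm p q z < 0) (hQ' : ¬ Q → ∀ z ∈ B, 0 < lineForm p q z) :
    C.Separates a A B ↔ ¬ (P ↔ Q) := by
  have hne : ∀ x ∈ C.cover \ a.carrier C, lineForm p q x ≠ 0 := fun x hx h =>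
    hx.2 ((ha x hx.1).2 h)
  have key : ∀ z ∈ A, ∀ w ∈ B, (0 < lineForm p q z * lineForm p q w) →
      JoinedIn (C.cover \ a.carrier C) z w := by
    intro z hz w hw h
    have hz' := (C.mem_cover_iff z).1 (hAc hz)
    have hw' := (C.mem_cover_iff w).1 (hBc hw)
    refine joinedIn_of_segment fun x t ht0 ht1 hre hform => ?_
    have ht1' : 0 ≤ 1 - t := by linarith
    have hx : x ∈ C.cover := (C.mem_cover_iff x).2
      ⟨by rw [hre]; exact add_nonneg (mul_nonneg ht1' hz'.1) (mul_nonneg ht0 hw'.1),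
       fun i => by
        rw [hform]; exact add_nonneg (mul_nonneg ht1' (hz'.2 i)) (mul_nonneg ht0 (hw'.2 i))⟩
    refine ⟨hx, fun hxa => ?_⟩
    have h0 := (ha x hx).1 hxa
    rw [hform] at h0
    rcases pos_and_pos_or_neg_and_neg_of_mul_pos h with ⟨h1, h2⟩ | ⟨h1, h2⟩
    · rcases ht0.eq_or_lt with rfl | ht
      · simp at h0; linarith
      · have := mul_pos ht h2
        have := mul_nonneg ht1' h1.le
        linarith
    · rcases ht0.eq_or_lt with rfl | ht
      · simp at h0; linarith
      · have := mul_neg_of_pos_of_neg ht h2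
        have := mul_nonpos_of_nonneg_of_nonpos ht1' h1.le
        linarith
  constructor
  · intro hs hPQ
    obtain ⟨z, hz⟩ := hA
    obtain ⟨w, hw⟩ := hB
    refine hs z hz w hw (key z hz w hw ?_)
    by_cases h : P
    · exact mul_pos_of_neg_of_neg (hP h z hz) (hQ (hPQ.1 h) w hw)
    · exact mul_pos (hP' h z hz) (hQ' (fun h' => h (hPQ.2 h')) w hw)
  · intro hPQ z hz w hw hj
    by_cases h : P
    · have h' : ¬ Q := fun h' => hPQ ⟨fun _ => h', fun _ => h⟩
      exact not_joinedIn_of_sign (continuous_lineForm p q) hne (hP h z hz).le (hQ' h' w hw).le hj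
    · have h' : Q := by tauto
      exact not_joinedIn_of_sign (continuous_lineForm p q) hne (hQ h' w hw).le (hP' h z hz).le
        hj.symm

theorem lineForm_side_neg {a b i : ℤ} (hab : a + 2 ≤ b) (h : a ≤ i ∧ i < b) :
    ∀ z ∈ C.side i, lineForm (C.cusp a) (C.cusp b) z < 0 := by
  intro z hz
  refine lineForm_neg (C.cusp_strictMono (lt_add_one i)) (C.cusp_sub_mul_nonpos h.1 (by omega))
    (C.cusp_sub_mul_nonpos (by omega) (by omega)) ?_ hz
  by_cases hi : i = a
  · exact Or.inr (C.cusp_sub_mul_ne_zero (by omega) (by omega))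
  · exact Or.inl (C.cusp_sub_mul_ne_zero (by omega) (by omega))

theorem lineForm_side_pos {a b i : ℤ} (hab : a + 2 ≤ b) (h : ¬ (a ≤ i ∧ i < b)) :
    ∀ z ∈ C.side i, 0 < lineForm (C.cusp a) (C.cusp b) z := by
  intro z hz
  refine lineForm_pos (C.cusp_strictMono (lt_add_one i))
    (C.cusp_sub_mul_nonneg (by omega) (by omega))
    (C.cusp_sub_mul_nonneg (by omega) (by omega)) ?_ hz
  by_cases hi : i + 1 = a
  · exact Or.inl (C.cusp_sub_mul_ne_zero (by omega) (by omega))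
  by_cases hi : i < a
  · exact Or.inl (C.cusp_sub_mul_ne_zero (by omega) (by omega))
  · exact Or.inr (C.cusp_sub_mul_ne_zero (by omega) (by omega))

theorem ray_foot_neg (c : ℤ) {y : ℝ} (hy : 0 < y) : -(y ^ 2 / C.cusp c) < 0 :=
  neg_neg_of_pos (div_pos (pow_pos hy 2) (C.cusp_pos c))

theorem ray_foot_mul (c : ℤ) (y : ℝ) : -(y ^ 2 / C.cusp c) * C.cusp c = -y ^ 2 := by
  rw [neg_mul, div_mul_cancel₀ _ (C.cusp_pos c).ne']

theorem lineForm_ray_side_neg {c i : ℤ} {y : ℝ} (hy : 0 < y) (h : i < c) :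
    ∀ z ∈ C.side i, lineForm (-(y ^ 2 / C.cusp c)) (C.cusp c) z < 0 := by
  intro z hz
  have hf := C.ray_foot_neg c hy
  have h0 := C.cusp_pos i
  have h1 := C.cusp_strictMono (lt_add_one i)
  have h2 := C.cusp_strictMono h
  have h3 := C.cusp_strictMono.monotone (show i + 1 ≤ c by omega)
  have h4 : (C.cusp i - -(y ^ 2 / C.cusp c)) * (C.cusp i - C.cusp c) < 0 :=
    mul_neg_of_pos_of_neg (by linarith) (by linarith)
  exact lineForm_neg h1 h4.le (mul_nonpos_of_nonneg_of_nonpos (by linarith) (by linarith))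
    (Or.inl h4.ne) hz

theorem lineForm_ray_side_pos {c i : ℤ} {y : ℝ} (hy : 0 < y) (h : ¬ i < c) :
    ∀ z ∈ C.side i, 0 < lineForm (-(y ^ 2 / C.cusp c)) (C.cusp c) z := by
  intro z hz
  have hf := C.ray_foot_neg c hy
  have h0 := C.cusp_pos i
  have h1 := C.cusp_strictMono (lt_add_one i)
  have h2 := C.cusp_strictMono.monotone (not_lt.1 h)
  have h4 : 0 < (C.cusp (i + 1) - -(y ^ 2 / C.cusp c)) * (C.cusp (i + 1) - C.cusp c) :=
    mul_pos (by linarith) (by linarith)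
  exact lineForm_pos h1 (mul_nonneg (by linarith) (by linarith)) h4.le (Or.inr h4.ne') hz

theorem separates_line_side {a b : ℤ} (hab : a + 2 ≤ b) (i j : ℤ) :
    C.Separates (.line a b) (C.side i) (C.side j) ↔ ¬ ((a ≤ i ∧ i < b) ↔ (a ≤ j ∧ j < b)) :=
  C.separates_iff_of_sign (fun z _ => mem_hypLine_iff _ _ z) (C.side_nonempty i)
    (C.side_nonempty j) (C.side_subset_cover i) (C.side_subset_cover j)
    (C.lineForm_side_neg hab) (C.lineForm_side_pos hab) (C.lineForm_side_neg hab)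
    (C.lineForm_side_pos hab)

theorem mem_ray_carrier_iff (c : ℤ) (y : ℝ) {z : ℍ} (hz : z ∈ C.cover) :
    z ∈ (CrownArc.ray c y).carrier C ↔ lineForm (-(y ^ 2 / C.cusp c)) (C.cusp c) z = 0 := by
  rw [← mem_hypLine_iff]
  exact ⟨fun h => h.1, fun h => ⟨h, hz.1⟩⟩

theorem separates_ray_side (c : ℤ) {y : ℝ} (hy : 0 < y) (i j : ℤ) :
    C.Separates (.ray c y) (C.side i) (C.side j) ↔ ¬ (i < c ↔ j < c) :=
  C.separates_iff_of_sign (fun _ hz => C.mem_ray_carrier_iff c y hz) (C.side_nonempty i)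
    (C.side_nonempty j) (C.side_subset_cover i) (C.side_subset_cover j)
    (C.lineForm_ray_side_neg hy) (C.lineForm_ray_side_pos hy) (C.lineForm_ray_side_neg hy)
    (C.lineForm_ray_side_pos hy)

theorem not_separates_boundary_side (i j : ℤ) :
    ¬ C.Separates .boundary (C.side i) (C.side j) := by
  intro hs
  obtain ⟨z, hz⟩ := C.side_nonempty i
  obtain ⟨w, hw⟩ := C.side_nonempty j
  have hzre := (C.cusp_pos i).trans (re_mem_of_mem_hypLine (C.cusp_strictMono (lt_add_one i)) hz).1
  have hwre := (C.cusp_pos j).trans (re_mem_of_mem_hypLine (C.cusp_strictMono (lt_add_one j)) hw).1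
  have hz' := (C.mem_cover_iff z).1 (C.side_subset_cover i hz)
  have hw' := (C.mem_cover_iff w).1 (C.side_subset_cover j hw)
  refine hs z hz w hw (joinedIn_of_segment fun x t ht0 ht1 hre hform => ?_)
  have ht1' : 0 ≤ 1 - t := by linarith
  have hpos : 0 < x.re := by
    rw [hre]
    rcases ht0.eq_or_lt with rfl | ht
    · simpa using hzre
    · have := mul_pos ht hwre
      have := mul_nonneg ht1' hzre.le
      linarith
  refine ⟨(C.mem_cover_iff x).2 ⟨hpos.le, fun k => ?_⟩, fun h => hpos.ne' h⟩
  rw [hform]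
  exact add_nonneg (mul_nonneg ht1' (hz'.2 k)) (mul_nonneg ht0 (hw'.2 k))

theorem mult_pos : 0 < C.mult := one_pos.trans C.one_lt_mult

theorem line_inter_line {a b a' b' : ℤ} (h1 : a < a') (h2 : a' < b) (h3 : b < b') :
    ¬ Disjoint ((CrownArc.line a b).carrier C) ((CrownArc.line a' b').carrier C) := by
  obtain ⟨z, hz, hz', -⟩ := exists_mem_hypLine_inter (C.cusp_strictMono h1) (C.cusp_strictMono h2)
    (C.cusp_strictMono h3)
  exact Set.not_disjoint_iff.2 ⟨z, hz, hz'⟩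

theorem ray_inter_line {a b c : ℤ} {y : ℝ} (hy : 0 < y) (h1 : a < c) (h2 : c < b) :
    ¬ Disjoint ((CrownArc.ray c y).carrier C) ((CrownArc.line a b).carrier C) := by
  have h0 := C.cusp_pos a
  obtain ⟨z, hz, hz', -, h⟩ := exists_mem_hypLine_inter ((C.ray_foot_neg c hy).trans h0)
    (C.cusp_strictMono h1) (C.cusp_strictMono h2)
  exact Set.not_disjoint_iff.2 ⟨z, ⟨hz, (h0.trans h).le⟩, hz'⟩

theorem ray_inter_ray {c c' : ℤ} {y y' : ℝ} (hy' : 0 < y') (h1 : c < c') (h2 : y' ≤ y) :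
    ¬ Disjoint ((CrownArc.ray c y).carrier C) ((CrownArc.ray c' y').carrier C) := by
  have h0 := C.cusp_pos c
  have h3 := C.cusp_strictMono h1
  have h4 : y' ^ 2 / C.cusp c' < y ^ 2 / C.cusp c := by
    have h5 : y' ^ 2 ≤ y ^ 2 := pow_le_pow_left₀ hy'.le h2 2
    exact (div_le_div_of_nonneg_right h5 (C.cusp_pos c').le).trans_lt
      (div_lt_div_of_pos_left (pow_pos (hy'.trans_le h2) 2) h0 h3)
  obtain ⟨z, hz, hz', h, -⟩ := exists_mem_hypLine_inter
    (show -(y ^ 2 / C.cusp c) < -(y' ^ 2 / C.cusp c') by linarith)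
    ((C.ray_foot_neg c' hy').trans h0) h3
  rw [C.ray_foot_mul, C.ray_foot_mul] at h
  have hre : 0 ≤ z.re := by
    by_contra! hneg
    have : y' ^ 2 ≤ y ^ 2 := pow_le_pow_left₀ hy'.le h2 2
    nlinarith
  exact Set.not_disjoint_iff.2 ⟨z, ⟨hz, hre⟩, ⟨hz', hre⟩⟩

theorem ray_inter_boundary {c : ℤ} {y : ℝ} (hy : 0 < y) :
    ¬ Disjoint ((CrownArc.ray c y).carrier C) (CrownArc.boundary.carrier C) := by
  obtain ⟨z, hz, hre⟩ := exists_mem_hypLine_re (C.ray_foot_neg c hy) (C.cusp_pos c)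
  exact Set.not_disjoint_iff.2 ⟨z, ⟨hz, hre.ge⟩, hre⟩

theorem disjoint_line_line {a b a' b' : ℤ} (hab : a < b) (hab' : a' < b')
    (hne : (a, b) ≠ (a', b'))
    (h : ¬ (a < a' ∧ a' < b ∧ b < b')) (h' : ¬ (a' < a ∧ a < b' ∧ b' < b)) :
    Disjoint ((CrownArc.line a b).carrier C) ((CrownArc.line a' b').carrier C) := by
  have hne' : a ≠ a' ∨ b ≠ b' := by
    by_contra! hc; exact hne (Prod.ext hc.1 hc.2)
  refine Set.disjoint_left.2 fun z hz hz' => ?_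
  have hz0 := (mem_hypLine_iff _ _ _).1 hz'
  by_cases hin : a' ≤ a ∧ b ≤ b'
  · refine (lineForm_neg (C.cusp_strictMono hab) (C.cusp_sub_mul_nonpos hin.1 (by omega))
      (C.cusp_sub_mul_nonpos (by omega) hin.2) ?_ hz).ne hz0
    by_cases ha : a = a'
    · exact Or.inr (C.cusp_sub_mul_ne_zero (by omega) (by omega))
    · exact Or.inl (C.cusp_sub_mul_ne_zero (by omega) (by omega))
  · refine (lineForm_pos (C.cusp_strictMono hab)
      (C.cusp_sub_mul_nonneg (by omega) hab'.le)
      (C.cusp_sub_mul_nonneg (by omega) hab'.le) ?_ hz).ne' hz0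
    by_cases ha : a = a' ∨ a = b'
    · exact Or.inr (C.cusp_sub_mul_ne_zero (by omega) (by omega))
    · exact Or.inl (C.cusp_sub_mul_ne_zero (by omega) (by omega))

theorem disjoint_ray_line {a b c : ℤ} {y : ℝ} (hy : 0 < y) (hab : a < b)
    (h : ¬ (a < c ∧ c < b)) :
    Disjoint ((CrownArc.ray c y).carrier C) ((CrownArc.line a b).carrier C) := by
  refine Set.disjoint_left.2 fun z hz hz' => ?_
  have h0 := (C.ray_foot_neg c hy).trans (C.cusp_pos a)
  have h1 := C.cusp_strictMono hab
  have h4 : 0 < (-(y ^ 2 / C.cusp c) - C.cusp a) * (-(y ^ 2 / C.cusp c) - C.cusp b) :=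
    mul_pos_of_neg_of_neg (by linarith) (by linarith)
  exact (lineForm_pos ((C.ray_foot_neg c hy).trans (C.cusp_pos c)) h4.le
    (C.cusp_sub_mul_nonneg (by omega) hab.le) (Or.inl h4.ne') hz.1).ne'
    ((mem_hypLine_iff _ _ _).1 hz')

theorem disjoint_ray_ray {c c' : ℤ} {y y' : ℝ} (hy : 0 < y) (hc : c ≤ c') (hyy : y < y') :
    Disjoint ((CrownArc.ray c y).carrier C) ((CrownArc.ray c' y').carrier C) := by
  refine Set.disjoint_left.2 fun z hz hz' => ?_
  have hlt := (C.ray_foot_neg c hy).trans (C.cusp_pos c)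
  obtain ⟨-, hx⟩ := re_mem_of_mem_hypLine hlt hz.1
  have hx0 : 0 ≤ z.re := hz.2
  have hz0 := (mem_hypLine_iff _ _ _).1 hz'.1
  have h1 := lineForm_of_mem_hypLine (p := -(y' ^ 2 / C.cusp c')) (q := C.cusp c') hz.1
  have hsq : y ^ 2 < y' ^ 2 := pow_lt_pow_left₀ hyy hy.le two_ne_zero
  have hcc := C.cusp_strictMono.monotone hc
  have hf := C.ray_foot_neg c' (hy.trans hyy)
  rw [hz0, C.ray_foot_mul, add_sub_assoc, C.ray_foot_mul] at h1
  have h2 := C.ray_foot_mul c' y'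
  have h3 := C.ray_foot_mul c y
  have hc0 := C.cusp_pos c
  set f := -(y ^ 2 / C.cusp c)
  set f' := -(y' ^ 2 / C.cusp c')
  -- the affine function on the right is negative at both ends of `[0, cusp c]`
  have h4 : (C.cusp c - z.re) * (y' ^ 2 - y ^ 2)
      + z.re * ((C.cusp c - f') * (C.cusp c' - C.cusp c)) = 0 := by
    have e : (C.cusp c - z.re) * (y' ^ 2 - y ^ 2)
      + z.re * ((C.cusp c - f') * (C.cusp c' - C.cusp c)) =
      -C.cusp c * ((f + C.cusp c - f' - C.cusp c') * z.re + (-y' ^ 2 - -y ^ 2))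
        + z.re * (f * C.cusp c - f' * C.cusp c' - (y' ^ 2 - y ^ 2)) := by ring
    rw [e, ← h1, h2, h3]; ring
  have h5 := mul_pos (sub_pos.2 hx) (sub_pos.2 hsq)
  have h6 := mul_nonneg hx0 (mul_nonneg (show 0 ≤ C.cusp c - f' by linarith) (sub_nonneg.2 hcc))
  linarith

theorem disjoint_line_boundary {a b : ℤ} (hab : a < b) :
    Disjoint ((CrownArc.line a b).carrier C) (CrownArc.boundary.carrier C) := by
  refine Set.disjoint_left.2 fun z hz hz' => ?_
  have h1 := (re_mem_of_mem_hypLine (C.cusp_strictMono hab) hz).1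
  have h2 : z.re = 0 := hz'
  linarith [C.cusp_pos a]

end HyperbolicCrown

namespace MarkedCrown

variable {m : ℕ} (C : MarkedCrown m)

theorem lineForm_basePoint (p q : ℝ) : lineForm p q C.basePoint = C.base ^ 2 + p * q := by
  change (0 : ℝ) ^ 2 + C.base ^ 2 - (p + q) * 0 + p * q = _
  ring

theorem basePoint_mem_cover : C.basePoint ∈ C.cover := by
  refine (C.mem_cover_iff _).2 ⟨le_rfl, fun i => ?_⟩
  rw [lineForm_basePoint]
  have := mul_pos (C.cusp_pos i) (C.cusp_pos (i + 1))
  positivity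

theorem separates_line_basePoint {a b : ℤ} (hab : a + 2 ≤ b) (i : ℤ) :
    C.Separates (.line a b) (C.side i) {C.basePoint} ↔ (a ≤ i ∧ i < b) := by
  rw [C.separates_iff_of_sign (a := .line a b) (Q := False)
    (fun z _ => mem_hypLine_iff _ _ z) (C.side_nonempty i)
    (Set.singleton_nonempty _) (C.side_subset_cover i)
    (Set.singleton_subset_iff.2 C.basePoint_mem_cover)
    (C.lineForm_side_neg hab) (C.lineForm_side_pos hab) (fun h => h.elim)]
  · tauto
  · rintro - z rfl
    rw [lineForm_basePoint]
    have := mul_pos (C.cusp_pos a) (C.cusp_pos b)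
    positivity

theorem separates_ray_basePoint (c : ℤ) {y : ℝ} (hy : 0 < y) (hne : y ≠ C.base) (i : ℤ) :
    C.Separates (.ray c y) (C.side i) {C.basePoint} ↔ ¬ (i < c ↔ C.base < y) := by
  refine C.separates_iff_of_sign (fun _ hz => C.mem_ray_carrier_iff c y hz) (C.side_nonempty i)
    (Set.singleton_nonempty _) (C.side_subset_cover i)
    (Set.singleton_subset_iff.2 C.basePoint_mem_cover)
    (C.lineForm_ray_side_neg hy) (C.lineForm_ray_side_pos hy) ?_ ?_
  · rintro h z rfl
    rw [lineForm_basePoint, C.ray_foot_mul]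
    have := pow_lt_pow_left₀ h C.base_pos.le two_ne_zero
    linarith
  · rintro h z rfl
    rw [lineForm_basePoint, C.ray_foot_mul]
    have := pow_lt_pow_left₀ (lt_of_le_of_ne (not_lt.1 h) hne) hy.le two_ne_zero
    linarith

theorem separates_boundary_basePoint (i : ℤ) :
    C.Separates .boundary (C.side i) {C.basePoint} := by
  rintro z - w rfl h
  exact h.target_mem.2 rfl

end MarkedCrown

/-! ### The mass of a set of leaves -/

namespace CrownArc

/-- The arcs `line p q` whose pair of cusps satisfies `P`. -/
def lines (P : ℤ → ℤ → Prop) : Set CrownArc := {a | ∃ p q, a = line p q ∧ P p q}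

/-- The arcs `ray c y` whose cusp and endpoint satisfy `P`. -/
def rays (P : ℤ → ℝ → Prop) : Set CrownArc := {a | ∃ c y, a = ray c y ∧ P c y}

@[simp] theorem line_mem_lines {P : ℤ → ℤ → Prop} {p q : ℤ} : line p q ∈ lines P ↔ P p q :=
  ⟨by rintro ⟨_, _, ⟨⟩, h⟩; exact h, fun h => ⟨_, _, rfl, h⟩⟩

@[simp] theorem ray_notMem_lines {P : ℤ → ℤ → Prop} {c : ℤ} {y : ℝ} : ray c y ∉ lines P := by
  rintro ⟨_, _, ⟨⟩, _⟩

@[simp] theorem boundary_notMem_lines {P : ℤ → ℤ → Prop} : boundary ∉ lines P := by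
  rintro ⟨_, _, ⟨⟩, _⟩

@[simp] theorem ray_mem_rays {P : ℤ → ℝ → Prop} {c : ℤ} {y : ℝ} : ray c y ∈ rays P ↔ P c y :=
  ⟨by rintro ⟨_, _, ⟨⟩, h⟩; exact h, fun h => ⟨_, _, rfl, h⟩⟩

@[simp] theorem line_notMem_rays {P : ℤ → ℝ → Prop} {p q : ℤ} : line p q ∉ rays P := by
  rintro ⟨_, _, ⟨⟩, _⟩

@[simp] theorem boundary_notMem_rays {P : ℤ → ℝ → Prop} : boundary ∉ rays P := by
  rintro ⟨_, _, ⟨⟩, _⟩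

theorem isSide_line {p q : ℤ} : (line p q).IsSide ↔ q = p + 1 :=
  ⟨by rintro ⟨_, ⟨⟩⟩; rfl, by rintro rfl; exact ⟨p, rfl⟩⟩

theorem not_isSide_ray {c : ℤ} {y : ℝ} : ¬ (ray c y).IsSide := by rintro ⟨_, ⟨⟩⟩

theorem not_isSide_boundary : ¬ boundary.IsSide := by rintro ⟨_, ⟨⟩⟩

variable {m : ℕ} (C : HyperbolicCrown m)

/-- The deck transformation `z ↦ mult ^ k * z` as a permutation of the arcs. -/
noncomputable def translateEquiv (k : ℤ) : CrownArc ≃ CrownArc where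
  toFun := translate C k
  invFun := translate C (-k)
  left_inv a := by
    have h := zpow_ne_zero k C.mult_pos.ne'
    cases a <;> simp [translate, h]
  right_inv a := by
    have h := zpow_ne_zero k C.mult_pos.ne'
    cases a <;> simp [translate, h]

theorem isSide_translate (k : ℤ) (a : CrownArc) : (a.translate C k).IsSide ↔ a.IsSide := by
  cases a with
  | line p q => simp only [CrownArc.translate, isSide_line]; omega
  | ray c y => simp [translate, not_isSide_ray]
  | boundary => simp [CrownArc.translate]

end CrownArc

namespace MeasuredLamination

open CrownArc

variable {m : ℕ} {C : MarkedCrown m} (μ : MeasuredLamination C)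

open Classical in
/-- The weight of an arc, where the geodesic sides are not counted. -/
noncomputable def leafWeight (a : CrownArc) : ℝ≥0∞ := if a.IsSide then 0 else μ.weight a

/-- The total weight of the leaves in a set of arcs; the geodesic sides are not counted. -/
noncomputable def mass (S : Set CrownArc) : ℝ≥0∞ := ∑' a, S.indicator μ.leafWeight a

theorem leafWeight_ne_zero {a : CrownArc} : μ.leafWeight a ≠ 0 ↔ ¬ a.IsSide ∧ μ.weight a ≠ 0 := by
  unfold leafWeight; split_ifs with h <;> simp [h]

theorem leafWeight_of_not_isSide {a : CrownArc} (h : ¬ a.IsSide) :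
    μ.leafWeight a = μ.weight a := if_neg h

theorem leafWeight_ne_top (a : CrownArc) : μ.leafWeight a ≠ ⊤ := by
  unfold leafWeight
  split_ifs with h
  · exact ENNReal.zero_ne_top
  · exact μ.weight_ne_top a h

theorem mass_congr {S T : Set CrownArc} (h : ∀ a, μ.leafWeight a ≠ 0 → (a ∈ S ↔ a ∈ T)) :
    μ.mass S = μ.mass T := by
  classical
  refine tsum_congr fun a => ?_
  by_cases h0 : μ.leafWeight a = 0
  · simp [Set.indicator_apply, h0]
  · simp [Set.indicator_apply, h a h0]

theorem mass_union {U S T : Set CrownArc}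
    (h : ∀ a, μ.leafWeight a ≠ 0 → ((a ∈ U ↔ a ∈ S ∨ a ∈ T) ∧ ¬ (a ∈ S ∧ a ∈ T))) :
    μ.mass U = μ.mass S + μ.mass T := by
  unfold mass
  rw [← ENNReal.tsum_add]
  classical
  refine tsum_congr fun a => ?_
  by_cases h0 : μ.leafWeight a = 0
  · simp [Set.indicator_apply, h0]
  · obtain ⟨h1, h2⟩ := h a h0
    by_cases hS : a ∈ S <;> by_cases hT : a ∈ T <;> simp_all

theorem mass_mono {S T : Set CrownArc} (h : S ⊆ T) : μ.mass S ≤ μ.mass T :=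
  ENNReal.tsum_le_tsum fun a => Set.indicator_le_indicator_of_subset h (fun _ => zero_le) a

theorem mass_eq_zero_iff {S : Set CrownArc} :
    μ.mass S = 0 ↔ ∀ a, μ.leafWeight a ≠ 0 → a ∉ S := by
  unfold mass
  rw [ENNReal.tsum_eq_zero]
  refine forall_congr' fun a => ?_
  rw [Set.indicator_apply_eq_zero]
  tauto

theorem exists_of_mass_ne_zero {S : Set CrownArc} (h : μ.mass S ≠ 0) :
    ∃ a, μ.leafWeight a ≠ 0 ∧ a ∈ S := by
  by_contra! hc
  exact h ((μ.mass_eq_zero_iff).2 hc)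

theorem mass_singleton (a : CrownArc) : μ.mass {a} = μ.leafWeight a := by
  unfold mass
  rw [tsum_eq_single a]
  · simp
  · intro b hb
    simp [hb]

theorem mass_ne_top {S : Set CrownArc} (h : {a | a ∈ S ∧ μ.leafWeight a ≠ 0}.Finite) :
    μ.mass S ≠ ⊤ := by
  unfold mass
  rw [tsum_eq_sum (s := h.toFinset)]
  · refine ENNReal.sum_ne_top.2 fun a _ => ne_top_of_le_ne_top (μ.leafWeight_ne_top a) ?_
    exact Set.indicator_le_self' (fun _ _ => zero_le) a
  · intro a ha
    rw [Set.indicator_apply_eq_zero]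
    intro haS
    by_contra h0
    exact ha (by simpa using ⟨haS, h0⟩)

theorem mass_eq_tsum_weight {S : Set CrownArc} :
    μ.mass S = ∑' a : {a : CrownArc // ¬ a.IsSide ∧ a ∈ S}, μ.weight a := by
  rw [show (∑' a : {a : CrownArc // ¬ a.IsSide ∧ a ∈ S}, μ.weight a) = _ from
    tsum_subtype {a : CrownArc | ¬ a.IsSide ∧ a ∈ S} μ.weight]
  refine tsum_congr fun a => ?_
  by_cases h : a.IsSide <;> by_cases hS : a ∈ S <;> simp [leafWeight, h, hS]

theorem transverseMeasure_eq_mass (A B : Set ℍ) :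
    μ.transverseMeasure A B = μ.mass {a | C.Separates a A B} :=
  μ.mass_eq_tsum_weight.symm

theorem mass_rays_eq_tsum (P : ℤ → ℝ → Prop) :
    μ.mass (rays P) = ∑' q : {q : ℤ × ℝ // P q.1 q.2}, μ.weight (.ray q.1.1 q.1.2) := by
  have hinj : Set.InjOn (fun q : ℤ × ℝ => ray q.1 q.2) {q | P q.1 q.2} := by
    rintro ⟨_, _⟩ - ⟨_, _⟩ - h
    simpa using h
  have h1 := tsum_image μ.weight hinj
  have h2 : (fun q : ℤ × ℝ => ray q.1 q.2) '' {q | P q.1 q.2} =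
      {a | ¬ a.IsSide ∧ a ∈ rays P} := by
    ext a
    constructor
    · rintro ⟨⟨c, y⟩, h, rfl⟩
      exact ⟨not_isSide_ray, ray_mem_rays.2 h⟩
    · rintro ⟨-, c, y, rfl, h⟩
      exact ⟨(c, y), h, rfl⟩
  rw [h2] at h1
  rw [mass_eq_tsum_weight]
  exact h1

theorem leafWeight_translate (k : ℤ) (a : CrownArc) :
    μ.leafWeight (a.translate C.toHyperbolicCrown k) = μ.leafWeight a := by
  unfold leafWeight
  rw [μ.weight_translate]
  by_cases h : a.IsSide
  · rw [if_pos h, if_pos ((isSide_translate _ k a).2 h)]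
  · rw [if_neg h, if_neg (mt (isSide_translate _ k a).1 h)]

theorem mass_preimage_translate (k : ℤ) (S : Set CrownArc) :
    μ.mass (CrownArc.translate C.toHyperbolicCrown k ⁻¹' S) = μ.mass S := by
  unfold mass
  rw [← (translateEquiv C.toHyperbolicCrown k).tsum_eq (S.indicator μ.leafWeight)]
  refine tsum_congr fun a => ?_
  change _ = Set.indicator S μ.leafWeight (a.translate C.toHyperbolicCrown k)
  by_cases h : a.translate C.toHyperbolicCrown k ∈ S
  · rw [Set.indicator_of_mem h, Set.indicator_of_mem (by exact h), leafWeight_translate]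
  · rw [Set.indicator_of_notMem h, Set.indicator_of_notMem (by exact h)]

/-! ### How leaves can lie with respect to each other -/

theorem leaf_induction {p : CrownArc → Prop}
    (line : ∀ a b : ℤ, a + 2 ≤ b → μ.weight (.line a b) ≠ 0 → p (.line a b))
    (ray : ∀ (c : ℤ) (y : ℝ), 0 < y → μ.weight (.ray c y) ≠ 0 → p (.ray c y))
    (boundary : μ.weight .boundary ≠ 0 → p .boundary) (a : CrownArc)
    (ha : μ.leafWeight a ≠ 0) : p a := by
  obtain ⟨h1, h2⟩ := μ.leafWeight_ne_zero.1 ha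
  have h3 := μ.valid a h2
  cases a with
  | line a b =>
    rw [isSide_line] at h1
    change a < b at h3
    exact line a b (by omega) h2
  | ray c y => exact ray c y h3 h2
  | boundary => exact boundary h2

variable {μ}

theorem not_cross {a b a' b' : ℤ} (h : μ.weight (.line a b) ≠ 0)
    (h' : μ.weight (.line a' b') ≠ 0) : ¬ (a < a' ∧ a' < b ∧ b < b') := by
  rintro ⟨h1, h2, h3⟩
  refine C.line_inter_line h1 h2 h3 (μ.disjoint _ _ h h' ?_)
  rintro ⟨⟩
  exact lt_irrefl _ h1

theorem line_le (hm : 0 < m) {a b : ℤ} (h : μ.weight (.line a b) ≠ 0) : b ≤ a + m := by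
  have h' : μ.weight (.line (a + 1 * m) (b + 1 * m)) ≠ 0 := by
    rwa [show line (a + 1 * m) (b + 1 * m) = (line a b).translate C.toHyperbolicCrown 1 from rfl,
      μ.weight_translate]
  have := not_cross h h'
  omega

theorem ray_pos {c : ℤ} {y : ℝ} (h : μ.weight (.ray c y) ≠ 0) : 0 < y := μ.valid _ h

theorem not_ray_under_line {a b c : ℤ} {y : ℝ} (h : μ.weight (.line a b) ≠ 0)
    (h' : μ.weight (.ray c y) ≠ 0) : ¬ (a < c ∧ c < b) := by
  rintro ⟨h1, h2⟩
  exact C.ray_inter_line (ray_pos h') h1 h2 (μ.disjoint _ _ h' h (by rintro ⟨⟩))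

theorem ray_lt_ray {c c' : ℤ} {y y' : ℝ} (h : μ.weight (.ray c y) ≠ 0)
    (h' : μ.weight (.ray c' y') ≠ 0) (hc : c < c') : y < y' := by
  by_contra! hy
  refine C.ray_inter_ray (ray_pos h') hc hy (μ.disjoint _ _ h h' ?_)
  rintro ⟨⟩
  exact lt_irrefl _ hc

theorem weight_ray_of_boundary (h : μ.weight .boundary ≠ 0) (c : ℤ) (y : ℝ) :
    μ.weight (.ray c y) = 0 := by
  by_contra h'
  exact C.ray_inter_boundary (ray_pos h') (μ.disjoint _ _ h' h (by rintro ⟨⟩))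

theorem ray_ne_base {c : ℤ} {y : ℝ} (h : μ.weight (.ray c y) ≠ 0) : y ≠ C.base := by
  simpa using μ.ray_end_ne c y h 0

theorem weight_ray_translate (k c : ℤ) (y : ℝ) :
    μ.weight (.ray (c + k * m) (C.mult ^ k * y)) = μ.weight (.ray c y) :=
  μ.weight_translate k (.ray c y)

variable (μ)

/-! ### Leaves between cusps -/

/-- The total weight of the leaves that pass above the cusp `i`. -/
noncomputable def depth (i : ℤ) : ℝ≥0∞ := μ.mass (lines fun p q => p < i ∧ i < q)

/-- The total weight of the leaves between cusps that pass above the side `i`, possibly with an end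
at one of its two cusps. -/
noncomputable def sideDepth (i : ℤ) : ℝ≥0∞ := μ.mass (lines fun p q => p ≤ i ∧ i < q)

/-- The total weight of the leaves between cusps that pass above all cusps from `i + 1` to `j`. -/
noncomputable def commonDepth (i j : ℤ) : ℝ≥0∞ := μ.mass (lines fun p q => p ≤ i ∧ j < q)

theorem lines_mono {P Q : ℤ → ℤ → Prop} (h : ∀ p q, P p q → Q p q) : lines P ⊆ lines Q := by
  rintro _ ⟨p, q, rfl, hP⟩
  exact ⟨p, q, rfl, h p q hP⟩

theorem sideDepth_ne_top (hm : 0 < m) (i : ℤ) : μ.sideDepth i ≠ ⊤ := by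
  refine μ.mass_ne_top (((Set.finite_Icc (i - m) i).prod (Set.finite_Icc i (i + m))).image
    (fun q : ℤ × ℤ => line q.1 q.2) |>.subset ?_)
  rintro _ ⟨⟨p, q, rfl, h1, h2⟩, h⟩
  have := line_le hm (μ.leafWeight_ne_zero.1 h).2
  exact ⟨(p, q), ⟨⟨by omega, by omega⟩, ⟨by omega, by omega⟩⟩, rfl⟩

theorem depth_ne_top (hm : 0 < m) (i : ℤ) : μ.depth i ≠ ⊤ :=
  ne_top_of_le_ne_top (μ.sideDepth_ne_top hm i)
    (μ.mass_mono (lines_mono fun _ _ h => ⟨h.1.le, h.2⟩))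

theorem commonDepth_ne_top (hm : 0 < m) {i j : ℤ} (hij : i < j) : μ.commonDepth i j ≠ ⊤ :=
  ne_top_of_le_ne_top (μ.sideDepth_ne_top hm i)
    (μ.mass_mono (lines_mono fun _ _ h => ⟨h.1, by omega⟩))

theorem commonDepth_le_depth {i j c : ℤ} (h1 : i < c) (h2 : c ≤ j) :
    μ.commonDepth i j ≤ μ.depth c :=
  μ.mass_mono (lines_mono fun _ _ h => ⟨by omega, by omega⟩)

/-- Over some cusp between `i + 1` and `j` there are only leaves that pass above all these cusps.
Otherwise every one of these cusps lies below a leaf that does not pass above all of them. Such a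
leaf ends at another of these cusps, so there is a longer one, whereas the length of the leaves is
bounded. -/
theorem exists_depth_eq_commonDepth (hm : 0 < m) {i j : ℤ} (hij : i < j) :
    ∃ c ∈ Finset.Ioc i j, μ.depth c = μ.commonDepth i j := by
  by_contra! hc
  have hbad : ∀ c, i < c → c ≤ j → ∃ p q : ℤ, μ.weight (.line p q) ≠ 0 ∧ p < c ∧ c < q ∧
      ¬ (p ≤ i ∧ j < q) := by
    intro c h1 h2
    by_contra! h
    refine hc c (Finset.mem_Ioc.2 ⟨h1, h2⟩) (μ.mass_congr (μ.leaf_induction ?_ ?_ ?_))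
    · intro a b _ hw
      simp only [line_mem_lines]
      exact ⟨fun h' => h a b hw h'.1 h'.2, fun h' => by omega⟩
    · simp
    · simp
  have hlong : ∀ N : ℕ, ∃ p q c : ℤ, μ.weight (.line p q) ≠ 0 ∧ (i < c ∧ c ≤ j) ∧
      (p < c ∧ c < q) ∧ ¬ (p ≤ i ∧ j < q) ∧ N ≤ q - p := by
    intro N
    induction N with
    | zero =>
      obtain ⟨p, q, h0, h1, h2, h3⟩ := hbad j hij le_rfl
      exact ⟨p, q, j, h0, ⟨hij, le_rfl⟩, ⟨h1, h2⟩, h3, by push_cast; omega⟩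
    | succ N ih =>
      obtain ⟨p, q, c, h0, h1, h2, h3, h4⟩ := ih
      by_cases hp : i < p
      · obtain ⟨p', q', h0', h1', h2', h3'⟩ := hbad p hp (by omega)
        have := not_cross h0' h0
        exact ⟨p', q', p, h0', ⟨hp, by omega⟩, ⟨h1', h2'⟩, h3', by push_cast; omega⟩
      · obtain ⟨p', q', h0', h1', h2', h3'⟩ := hbad q (by omega) (by omega)
        have := not_cross h0 h0'
        exact ⟨p', q', q, h0', ⟨by omega, by omega⟩, ⟨h1', h2'⟩, h3', by push_cast; omega⟩
  obtain ⟨p, q, c, h0, -, -, -, h⟩ := hlong (m + 1)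
  have := line_le hm h0
  push_cast at h
  omega

theorem commonDepth_eq_zero (hm : 0 < m) {i j : ℤ} (h : i + m ≤ j) : μ.commonDepth i j = 0 := by
  refine μ.mass_eq_zero_iff.2 (μ.leaf_induction ?_ ?_ ?_)
  · intro a b _ hw
    have := line_le hm hw
    simp only [line_mem_lines]
    omega
  · simp
  · simp

/-- A leaf that ends at the left cusp of a side and a leaf that ends at its right cusp cannot both
pass above the side. -/
theorem sideDepth_eq_max (i : ℤ) : μ.sideDepth i = max (μ.depth i) (μ.depth (i + 1)) := by
  have h1 : μ.depth i ≤ μ.sideDepth i := μ.mass_mono (lines_mono fun _ _ h => ⟨h.1.le, h.2⟩)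
  have h2 : μ.depth (i + 1) ≤ μ.sideDepth i :=
    μ.mass_mono (lines_mono fun _ _ h => ⟨by omega, by omega⟩)
  by_cases h : ∃ b, i + 2 ≤ b ∧ μ.weight (.line i b) ≠ 0
  · obtain ⟨b, hb, hw⟩ := h
    have h3 : μ.sideDepth i = μ.depth (i + 1) := by
      refine μ.mass_congr (μ.leaf_induction ?_ (by simp) (by simp))
      intro a' b' _ hw'
      have := not_cross hw' hw
      simp only [line_mem_lines]
      omega
    rw [h3] at h1 ⊢
    exact (max_eq_right h1).symm
  · have h3 : μ.sideDepth i = μ.depth i := by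
      refine μ.mass_congr (μ.leaf_induction ?_ (by simp) (by simp))
      intro a' b' hab hw'
      simp only [line_mem_lines]
      constructor
      · intro h'
        refine ⟨lt_of_le_of_ne h'.1 ?_, h'.2⟩
        rintro rfl
        exact h ⟨b', hab, hw'⟩
      · omega
    rw [h3] at h2 ⊢
    exact (max_eq_left h2).symm

theorem depth_add_nat (i : ℤ) : μ.depth (i + m) = μ.depth i := by
  rw [depth, ← μ.mass_preimage_translate 1]
  congr 1
  ext a
  cases a <;> simp [CrownArc.translate]

/-- The weight of a leaf between cusps as an alternating sum of common depths. -/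
theorem weight_line_add {a b : ℤ} (hab : a + 2 ≤ b) :
    μ.weight (.line a b) + (μ.commonDepth (a - 1) (b - 1) + μ.commonDepth a b) =
      μ.commonDepth a (b - 1) + μ.commonDepth (a - 1) b := by
  have hs : ¬ (line a b).IsSide := by rw [isSide_line]; omega
  rw [← μ.leafWeight_of_not_isSide hs, ← mass_singleton]
  have e1 : μ.commonDepth a (b - 1) = μ.mass {line a b} +
      μ.mass (lines fun p q => p ≤ a ∧ b ≤ q ∧ (p, q) ≠ (a, b)) := by
    refine μ.mass_union (μ.leaf_induction ?_ (by simp) (by simp))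
    intro p q _ _
    simp only [line_mem_lines, Set.mem_singleton_iff, CrownArc.line.injEq, ne_eq, Prod.mk.injEq]
    omega
  have e2 : μ.commonDepth a b = μ.commonDepth (a - 1) b +
      μ.mass (lines fun p q => p = a ∧ b < q) := by
    refine μ.mass_union (μ.leaf_induction ?_ (by simp) (by simp))
    intro p q _ _
    simp only [line_mem_lines]
    omega
  have e3 : μ.mass (lines fun p q => p ≤ a ∧ b ≤ q ∧ (p, q) ≠ (a, b)) =
      μ.commonDepth (a - 1) (b - 1) + μ.mass (lines fun p q => p = a ∧ b < q) := by
    refine μ.mass_union (μ.leaf_induction ?_ (by simp) (by simp))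
    intro p q _ _
    simp only [line_mem_lines, ne_eq, Prod.mk.injEq]
    omega
  rw [e1, e2, e3]
  ring

/-! ### Leaves that end on the crown boundary -/

/-- The total weight of the leaves from the cusp `i` to the crown boundary. -/
noncomputable def rayWeight (i : ℤ) : ℝ≥0∞ := μ.mass (rays fun c _ => c = i)

/-- The total weight of the leaves that start at a cusp before the side `i` and end beyond the
basepoint. -/
noncomputable def raysBeyond (i : ℤ) : ℝ≥0∞ := μ.mass (rays fun c y => c ≤ i ∧ C.base < y)

/-- The total weight of the leaves that start at a cusp after the side `i` and end before the
basepoint. -/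
noncomputable def raysBefore (i : ℤ) : ℝ≥0∞ := μ.mass (rays fun c y => i < c ∧ y < C.base)

/-- The signed measure on the crown boundary between the foot of the perpendicular from the side `i`
and the basepoint. -/
noncomputable def twistAt (i : ℤ) : ℝ := (μ.raysBeyond i).toReal - (μ.raysBefore i).toReal

theorem finite_rays (hm : 0 < m) (i : ℤ) :
    {a | a ∈ rays (fun c _ => c = i) ∧ μ.leafWeight a ≠ 0}.Finite := by
  obtain ⟨F, hF, h⟩ := μ.finite_mod_deck
  -- an arc that has a translate at the cusp `i` has only one
  let g : CrownArc → CrownArc := fun b =>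
    match b with
    | .ray c _ => b.translate C.toHyperbolicCrown ((i - c) / m)
    | _ => b
  refine (hF.image g).subset ?_
  rintro _ ⟨⟨c, y, rfl, rfl⟩, hw⟩
  obtain ⟨b, hb, k, hk⟩ := h _ (μ.leafWeight_ne_zero.1 hw).2
  refine ⟨b, hb, ?_⟩
  cases b with
  | line _ _ => simp [CrownArc.translate] at hk
  | boundary => simp [CrownArc.translate] at hk
  | ray c' y' =>
    have hc : c = c' + k * m := by
      simp only [CrownArc.translate, CrownArc.ray.injEq] at hk
      exact hk.1
    have : (c - c') / m = k := by
      rw [hc, add_sub_cancel_left]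
      exact Int.mul_ediv_cancel _ (by omega)
    simp only [g, this, hk]

theorem rayWeight_ne_top (hm : 0 < m) (i : ℤ) : μ.rayWeight i ≠ ⊤ :=
  μ.mass_ne_top (μ.finite_rays hm i)

theorem mass_rays_ne_top (hm : 0 < m) {P : ℤ → ℝ → Prop} (lo hi : ℤ)
    (h : ∀ c y, μ.weight (.ray c y) ≠ 0 → P c y → lo ≤ c ∧ c ≤ hi) :
    μ.mass (rays P) ≠ ⊤ := by
  refine μ.mass_ne_top (((Set.finite_Icc lo hi).biUnion fun i _ => μ.finite_rays hm i).subset ?_)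
  rintro _ ⟨⟨c, y, rfl, hP⟩, hw⟩
  obtain ⟨h1, h2⟩ := h c y (μ.leafWeight_ne_zero.1 hw).2 hP
  exact Set.mem_biUnion (x := c) ⟨h1, h2⟩ ⟨ray_mem_rays.2 rfl, hw⟩

theorem raysBeyond_ne_top (hm : 0 < m) (i : ℤ) : μ.raysBeyond i ≠ ⊤ := by
  by_cases h : ∃ c y, μ.weight (.ray c y) ≠ 0
  · obtain ⟨c, y, hw⟩ := h
    obtain ⟨k, hk, -⟩ := exists_mem_Ioc_zpow (div_pos C.base_pos (ray_pos hw)) C.one_lt_mult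
    rw [lt_div_iff₀ (ray_pos hw)] at hk
    refine μ.mass_rays_ne_top hm (c + k * m) i fun c' y' hw' h => ⟨?_, h.1⟩
    by_contra! hlt
    rw [← weight_ray_translate k] at hw
    linarith [ray_lt_ray hw' hw hlt, h.2]
  · push Not at h
    exact μ.mass_rays_ne_top hm 0 0 fun c y hw => absurd (h c y) hw

theorem raysBefore_ne_top (hm : 0 < m) (i : ℤ) : μ.raysBefore i ≠ ⊤ := by
  by_cases h : ∃ c y, μ.weight (.ray c y) ≠ 0
  · obtain ⟨c, y, hw⟩ := h
    obtain ⟨k, -, hk⟩ := exists_mem_Ioc_zpow (div_pos C.base_pos (ray_pos hw)) C.one_lt_mult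
    rw [div_le_iff₀ (ray_pos hw)] at hk
    refine μ.mass_rays_ne_top hm i (c + (k + 1) * m) fun c' y' hw' h => ⟨h.1.le, ?_⟩
    by_contra! hlt
    rw [← weight_ray_translate (k + 1)] at hw
    linarith [ray_lt_ray hw hw' hlt, h.2]
  · push Not at h
    exact μ.mass_rays_ne_top hm 0 0 fun c y hw => absurd (h c y) hw

theorem raysBeyond_eq_zero_or (i : ℤ) : μ.raysBeyond i = 0 ∨ μ.raysBefore i = 0 := by
  by_contra! h
  obtain ⟨_, hw, c, y, rfl, h1, h2⟩ := μ.exists_of_mass_ne_zero h.1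
  obtain ⟨_, hw', c', y', rfl, h1', h2'⟩ := μ.exists_of_mass_ne_zero h.2
  have := ray_lt_ray (μ.leafWeight_ne_zero.1 hw).2 (μ.leafWeight_ne_zero.1 hw').2
    (show c < c' by omega)
  linarith

theorem abs_twistAt (i : ℤ) :
    |μ.twistAt i| = (μ.raysBeyond i).toReal + (μ.raysBefore i).toReal := by
  rcases μ.raysBeyond_eq_zero_or i with h | h <;> simp [twistAt, h]

theorem toReal_raysBeyond (i : ℤ) : (μ.raysBeyond i).toReal = max (μ.twistAt i) 0 := by
  rcases μ.raysBeyond_eq_zero_or i with h | h <;> simp [twistAt, h]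

theorem twist_eq_twistAt : μ.twist = μ.twistAt 0 := by
  unfold twist twistAt raysBeyond raysBefore
  rw [mass_rays_eq_tsum, mass_rays_eq_tsum]
  rfl

theorem raysBeyond_succ (i : ℤ) : μ.raysBeyond (i + 1) =
    μ.raysBeyond i + μ.mass (rays fun c y => c = i + 1 ∧ C.base < y) := by
  refine μ.mass_union (μ.leaf_induction (by simp) ?_ (by simp))
  intro c y _ _
  simp only [ray_mem_rays]
  have h1 : c ≤ i + 1 ↔ c ≤ i ∨ c = i + 1 := by omega
  have h2 : ¬ (c ≤ i ∧ c = i + 1) := by omega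
  tauto

theorem raysBefore_eq_add (i : ℤ) : μ.raysBefore i =
    μ.raysBefore (i + 1) + μ.mass (rays fun c y => c = i + 1 ∧ y < C.base) := by
  refine μ.mass_union (μ.leaf_induction (by simp) ?_ (by simp))
  intro c y _ _
  simp only [ray_mem_rays]
  have h1 : i < c ↔ i + 1 < c ∨ c = i + 1 := by omega
  have h2 : ¬ (i + 1 < c ∧ c = i + 1) := by omega
  tauto

theorem rayWeight_eq_add (i : ℤ) : μ.rayWeight i =
    μ.mass (rays fun c y => c = i ∧ C.base < y) + μ.mass (rays fun c y => c = i ∧ y < C.base) := by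
  refine μ.mass_union (μ.leaf_induction (by simp) ?_ (by simp))
  intro c y _ hw
  simp only [ray_mem_rays]
  have h1 := lt_or_gt_of_ne (ray_ne_base hw)
  have h2 : ¬ (C.base < y ∧ y < C.base) := fun h => lt_asymm h.1 h.2
  tauto

theorem twistAt_succ (hm : 0 < m) (i : ℤ) :
    μ.twistAt (i + 1) = μ.twistAt i + (μ.rayWeight (i + 1)).toReal := by
  have h1 := μ.raysBeyond_succ i
  have h2 := μ.raysBefore_eq_add i
  have h3 := μ.rayWeight_eq_add (i + 1)
  have t1 := μ.raysBeyond_ne_top hm (i + 1)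
  have t2 := μ.raysBefore_ne_top hm i
  have t3 := μ.rayWeight_ne_top hm (i + 1)
  rw [h1, ENNReal.add_ne_top] at t1
  rw [h2, ENNReal.add_ne_top] at t2
  rw [twistAt, twistAt, h1, h2, h3, ENNReal.toReal_add t1.1 t1.2, ENNReal.toReal_add t2.1 t2.2,
    ENNReal.toReal_add t1.2 t2.2]
  ring

theorem rayWeight_add_nat (i : ℤ) : μ.rayWeight (i + m) = μ.rayWeight i := by
  rw [rayWeight, ← μ.mass_preimage_translate 1]
  congr 1
  ext a
  cases a <;> simp [CrownArc.translate]

/-- The transverse measure of the crown boundary, if it is not a leaf, is the increment of the twist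
over one period. -/
theorem boundaryMeasure_eq (hm : 0 < m) :
    μ.boundaryMeasure = μ.twistAt m - μ.twistAt 0 - (μ.weight .boundary).toReal := by
  have hM := C.mult_pos
  have hM1 := C.one_lt_mult
  have e1 : μ.raysBeyond m = μ.mass (rays fun c y => c ≤ 0 ∧ C.base < C.mult * y) := by
    rw [raysBeyond, ← μ.mass_preimage_translate 1]
    congr 1
    ext a
    cases a <;> simp [CrownArc.translate]
  have e2 : μ.raysBefore m = μ.mass (rays fun c y => 0 < c ∧ C.mult * y < C.base) := by
    rw [raysBefore, ← μ.mass_preimage_translate 1]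
    congr 1
    ext a
    cases a <;> simp [CrownArc.translate]
  have e3 : μ.mass (rays fun c y => C.base ≤ y ∧ y < C.mult * C.base) =
      μ.mass (rays fun c y => C.base < C.mult * y ∧ y < C.base) := by
    rw [← μ.mass_preimage_translate 1]
    refine μ.mass_congr (μ.leaf_induction (by simp [CrownArc.translate]) ?_
      (by simp [CrownArc.translate]))
    intro c y _ hw
    have hne : C.base ≠ C.mult * y := by
      rw [← weight_ray_translate 1] at hw
      simpa using (ray_ne_base hw).symm
    simp only [CrownArc.translate, Set.mem_preimage, ray_mem_rays, zpow_one,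
      mul_lt_mul_iff_right₀ hM]
    rw [hne.le_iff_lt]
  have key : μ.raysBeyond m + μ.raysBefore 0 = μ.raysBeyond 0 + μ.raysBefore m +
      μ.mass (rays fun c y => C.base ≤ y ∧ y < C.mult * C.base) := by
    rw [e1, e2, e3]
    have d1 : μ.mass (rays fun c y => c ≤ 0 ∧ C.base < C.mult * y) = μ.raysBeyond 0 +
        μ.mass (rays fun c y => c ≤ 0 ∧ C.base < C.mult * y ∧ y < C.base) := by
      refine μ.mass_union (μ.leaf_induction (by simp) ?_ (by simp))
      intro c y hy hw
      simp only [ray_mem_rays]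
      have h1 := lt_or_gt_of_ne (ray_ne_base hw)
      have h2 : ¬ (C.base < y ∧ y < C.base) := fun h => lt_asymm h.1 h.2
      have h3 : C.base < y → C.base < C.mult * y := fun h => by nlinarith
      tauto
    have d2 : μ.raysBefore 0 = μ.mass (rays fun c y => 0 < c ∧ C.mult * y < C.base) +
        μ.mass (rays fun c y => 0 < c ∧ C.base < C.mult * y ∧ y < C.base) := by
      refine μ.mass_union (μ.leaf_induction (by simp) ?_ (by simp))
      intro c y hy hw
      have hne : C.mult * y ≠ C.base := by
        rw [← weight_ray_translate 1] at hw
        simpa using ray_ne_base hw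
      simp only [ray_mem_rays]
      have h1 := lt_or_gt_of_ne hne
      have h2 : ¬ (C.base < C.mult * y ∧ C.mult * y < C.base) := fun h => lt_asymm h.1 h.2
      have h3 : C.mult * y < C.base → y < C.base := fun h => by nlinarith
      tauto
    have d3 : μ.mass (rays fun c y => C.base < C.mult * y ∧ y < C.base) =
        μ.mass (rays fun c y => c ≤ 0 ∧ C.base < C.mult * y ∧ y < C.base) +
        μ.mass (rays fun c y => 0 < c ∧ C.base < C.mult * y ∧ y < C.base) := by
      refine μ.mass_union (μ.leaf_induction (by simp) ?_ (by simp))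
      intro c y hy hw
      simp only [ray_mem_rays]
      have h1 := le_or_gt c 0
      have h2 : ¬ (c ≤ 0 ∧ 0 < c) := by omega
      tauto
    rw [d1, d2, d3]
    ring
  have ht := congrArg ENNReal.toReal key
  have t1 := μ.raysBeyond_ne_top hm
  have t2 := μ.raysBefore_ne_top hm
  have t3 : μ.mass (rays fun c y => C.base ≤ y ∧ y < C.mult * C.base) ≠ ⊤ := by
    refine ne_top_of_le_ne_top (ENNReal.add_ne_top.2 ⟨t1 m, t2 0⟩) ?_
    rw [key]
    exact le_add_self
  rw [ENNReal.toReal_add (t1 m) (t2 0),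
    ENNReal.toReal_add (ENNReal.add_ne_top.2 ⟨t1 0, t2 m⟩) t3,
    ENNReal.toReal_add (t1 0) (t2 m), mass_rays_eq_tsum] at ht
  unfold boundaryMeasure twistAt
  linarith

theorem twistAt_eq_zero (h : ∀ c y, μ.weight (.ray c y) = 0) (i : ℤ) : μ.twistAt i = 0 := by
  have h0 : ∀ P, μ.mass (rays P) = 0 := fun P =>
    μ.mass_eq_zero_iff.2 (μ.leaf_induction (by simp) (fun c y _ hw => absurd (h c y) hw) (by simp))
  simp [twistAt, raysBeyond, raysBefore, h0]

theorem weight_ray_of_rayWeight {c : ℤ} (h : μ.rayWeight c = 0) (y : ℝ) :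
    μ.weight (.ray c y) = 0 := by
  by_contra hw
  exact μ.mass_eq_zero_iff.1 h (.ray c y) (μ.leafWeight_ne_zero.2 ⟨not_isSide_ray, hw⟩)
    (ray_mem_rays.2 rfl)

theorem depth_eq_zero_or (i : ℤ) : μ.depth i = 0 ∨ μ.rayWeight i = 0 := by
  by_contra! h
  obtain ⟨_, hw, p, q, rfl, hpq⟩ := μ.exists_of_mass_ne_zero h.1
  obtain ⟨_, hw', c, y, rfl, rfl⟩ := μ.exists_of_mass_ne_zero h.2
  exact not_ray_under_line (μ.leafWeight_ne_zero.1 hw).2 (μ.leafWeight_ne_zero.1 hw').2 hpq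

/-! ### The transverse measures -/

theorem mass_rays_mem_finset (s : Finset ℤ) :
    μ.mass (rays fun c _ => c ∈ s) = ∑ c ∈ s, μ.rayWeight c := by
  induction s using Finset.induction_on with
  | empty => exact μ.mass_eq_zero_iff.2 (μ.leaf_induction (by simp) (by simp) (by simp))
  | insert a s ha ih =>
    rw [Finset.sum_insert ha, ← ih]
    refine μ.mass_union (μ.leaf_induction (by simp) ?_ (by simp))
    intro c y _ _
    simp only [ray_mem_rays, Finset.mem_insert, true_and]
    rintro ⟨rfl, h⟩
    exact ha h

theorem transverseMeasure_side_side {i j : ℤ} (hij : i < j) :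
    μ.transverseMeasure (C.side i) (C.side j) + (μ.commonDepth i j + μ.commonDepth i j) =
      μ.sideDepth i + μ.sideDepth j + ∑ c ∈ Finset.Ioc i j, μ.rayWeight c := by
  have e1 : μ.sideDepth i = μ.commonDepth i j +
      μ.mass (lines fun p q => (p ≤ i ∧ i < q) ∧ ¬ (j < q)) := by
    refine μ.mass_union (μ.leaf_induction ?_ (by simp) (by simp))
    intro p q _ _
    simp only [line_mem_lines]
    omega
  have e2 : μ.sideDepth j = μ.commonDepth i j +
      μ.mass (lines fun p q => (p ≤ j ∧ j < q) ∧ ¬ (p ≤ i)) := by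
    refine μ.mass_union (μ.leaf_induction ?_ (by simp) (by simp))
    intro p q _ _
    simp only [line_mem_lines]
    omega
  have e3 : μ.transverseMeasure (C.side i) (C.side j) =
      μ.mass (lines fun p q => ¬ ((p ≤ i ∧ i < q) ↔ (p ≤ j ∧ j < q))) +
        μ.mass (rays fun c _ => c ∈ Finset.Ioc i j) := by
    rw [transverseMeasure_eq_mass]
    refine μ.mass_union (μ.leaf_induction ?_ ?_ ?_)
    · intro p q hpq _
      simp [C.separates_line_side hpq]
    · intro c y hy _
      simp only [Set.mem_ofPred_eq, C.separates_ray_side c hy, ray_mem_rays, Finset.mem_Ioc,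
        ray_notMem_lines, false_or, false_and, not_false_eq_true, and_true]
      rw [not_iff, not_lt]
      omega
    · simp [C.not_separates_boundary_side]
  have e4 : μ.mass (lines fun p q => ¬ ((p ≤ i ∧ i < q) ↔ (p ≤ j ∧ j < q))) =
      μ.mass (lines fun p q => (p ≤ i ∧ i < q) ∧ ¬ (j < q)) +
      μ.mass (lines fun p q => (p ≤ j ∧ j < q) ∧ ¬ (p ≤ i)) := by
    refine μ.mass_union (μ.leaf_induction ?_ (by simp) (by simp))
    intro p q _ _
    simp only [line_mem_lines]
    omega
  rw [e1, e2, e3, e4, mass_rays_mem_finset]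
  ring

theorem transverseMeasure_side_comm (i j : ℤ) :
    μ.transverseMeasure (C.side i) (C.side j) = μ.transverseMeasure (C.side j) (C.side i) := by
  simp only [transverseMeasure_eq_mass]
  refine μ.mass_congr (μ.leaf_induction ?_ ?_ ?_)
  · intro p q hpq _
    simp only [Set.mem_ofPred_eq, C.separates_line_side hpq]
    tauto
  · intro c y hy _
    simp only [Set.mem_ofPred_eq, C.separates_ray_side c hy]
    tauto
  · simp [C.not_separates_boundary_side]

theorem transverseMeasure_side_self (i : ℤ) :
    μ.transverseMeasure (C.side i) (C.side i) = 0 := by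
  rw [transverseMeasure_eq_mass, mass_eq_zero_iff]
  refine μ.leaf_induction ?_ ?_ ?_
  · intro p q hpq _
    simp [C.separates_line_side hpq]
  · intro c y hy _
    simp [C.separates_ray_side c hy]
  · simp [C.not_separates_boundary_side]

theorem transverseMeasure_side_basePoint (i : ℤ) :
    μ.transverseMeasure (C.side i) {C.basePoint} =
      μ.sideDepth i + (μ.raysBeyond i + μ.raysBefore i) + μ.weight .boundary := by
  have e1 : μ.transverseMeasure (C.side i) {C.basePoint} =
      μ.mass (lines (fun p q => p ≤ i ∧ i < q) ∪ rays fun c y => ¬ (i < c ↔ C.base < y)) +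
        μ.mass {boundary} := by
    rw [transverseMeasure_eq_mass]
    refine μ.mass_union (μ.leaf_induction ?_ ?_ ?_)
    · intro p q hpq _
      simp [C.separates_line_basePoint hpq]
    · intro c y hy hw
      simp [C.separates_ray_basePoint c hy (ray_ne_base hw)]
    · simp [C.separates_boundary_basePoint]
  have e2 : μ.mass (lines (fun p q => p ≤ i ∧ i < q) ∪ rays fun c y => ¬ (i < c ↔ C.base < y)) =
      μ.sideDepth i + μ.mass (rays fun c y => ¬ (i < c ↔ C.base < y)) := by
    refine μ.mass_union (μ.leaf_induction (by simp) (by simp) (by simp))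
  have e3 : μ.mass (rays fun c y => ¬ (i < c ↔ C.base < y)) =
      μ.raysBeyond i + μ.raysBefore i := by
    refine μ.mass_union (μ.leaf_induction (by simp) ?_ (by simp))
    intro c y _ hw
    simp only [ray_mem_rays]
    have h1 := lt_or_gt_of_ne (ray_ne_base hw)
    have h2 : ¬ (C.base < y ∧ y < C.base) := fun h => lt_asymm h.1 h.2
    have h3 : i < c ↔ ¬ c ≤ i := by omega
    tauto
  rw [e1, e2, e3, mass_singleton, leafWeight_of_not_isSide _ not_isSide_boundary]

end MeasuredLamination

/-! ### Proper homotopy classes -/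

namespace CrownArc

variable {m : ℕ} (C : MarkedCrown m)

/-- A complete invariant of the proper homotopy class of an arc. For an arc to the crown boundary it
consists of the cusp and of the set of the lifts of the basepoint below the endpoint. -/
def homotopyClass : CrownArc → CrownArc ⊕ (ℤ × Set ℤ)
  | ray c y => .inr (c, {k | C.mult ^ k * C.base < y})
  | a => .inl a

theorem properlyHomotopic_iff (a b : CrownArc) :
    ProperlyHomotopic C a b ↔ homotopyClass C b = homotopyClass C a := by
  cases a <;> cases b <;>
    simp [ProperlyHomotopic, homotopyClass, Set.ext_iff, eq_comm]

end CrownArc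

namespace MeasuredLamination

open CrownArc

variable {m : ℕ} {C : MarkedCrown m} (μ ν : MeasuredLamination C)

theorem classWeight_of_forall_eq {a : CrownArc} (h : ∀ b, ProperlyHomotopic C a b ↔ b = a) :
    μ.classWeight a = μ.weight a := by
  rw [classWeight, tsum_eq_single ⟨a, (h a).2 rfl⟩]
  rintro ⟨b, hb⟩ hne
  exact absurd (Subtype.ext ((h b).1 hb)) hne

theorem classWeight_line (p q : ℤ) : μ.classWeight (.line p q) = μ.weight (.line p q) :=
  μ.classWeight_of_forall_eq fun b => by
    rw [properlyHomotopic_iff]; cases b <;> simp [homotopyClass]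

theorem classWeight_boundary : μ.classWeight .boundary = μ.weight .boundary :=
  μ.classWeight_of_forall_eq fun b => by
    rw [properlyHomotopic_iff]; cases b <;> simp [homotopyClass]

theorem classWeight_ray (c : ℤ) (y : ℝ) : μ.classWeight (.ray c y) =
    μ.mass (rays fun c' y' => c' = c ∧
      ∀ k : ℤ, C.mult ^ k * C.base < y ↔ C.mult ^ k * C.base < y') := by
  rw [mass_eq_tsum_weight]
  have h : {b | ProperlyHomotopic C (.ray c y) b} = {a | ¬ a.IsSide ∧ a ∈ rays fun c' y' =>
      c' = c ∧ ∀ k : ℤ, C.mult ^ k * C.base < y ↔ C.mult ^ k * C.base < y'} := by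
    ext b
    cases b <;> simp [ProperlyHomotopic, not_isSide_ray, eq_comm]
  change ∑' b : ↥{b | ProperlyHomotopic C (.ray c y) b}, μ.weight b = _
  rw [h]
  rfl

/-- The class weights determine the mass of every set that is a union of proper homotopy classes. -/
theorem mass_eq_of_classWeight_eq (h : μ.classWeight = ν.classWeight) {S : Set CrownArc}
    (hS : ∀ a b, ProperlyHomotopic C a b → (a ∈ S ↔ b ∈ S)) : μ.mass S = ν.mass S := by
  classical
  have key : ∀ (ρ : MeasuredLamination C) (b : CrownArc),
      ∑' a : {a // homotopyClass C a = homotopyClass C b}, S.indicator ρ.leafWeight a =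
        if b ∈ S ∧ ¬ b.IsSide then ρ.classWeight b else 0 := by
    intro ρ b
    have hside : ∀ a, homotopyClass C a = homotopyClass C b → (a.IsSide ↔ b.IsSide) := by
      intro a ha
      cases a <;> cases b <;> simp_all [homotopyClass, not_isSide_ray, not_isSide_boundary]
    have hmem : ∀ a, homotopyClass C a = homotopyClass C b → (b ∈ S ↔ a ∈ S) := fun a ha =>
      hS b a ((properlyHomotopic_iff C b a).2 ha)
    have hcls : ρ.classWeight b =
        ∑' a : {a // homotopyClass C a = homotopyClass C b}, ρ.weight a := by
      have e : {a | ProperlyHomotopic C b a} = {a | homotopyClass C a = homotopyClass C b} :=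
        Set.ext (properlyHomotopic_iff C b)
      change ∑' a : ↥{a | ProperlyHomotopic C b a}, ρ.weight a = _
      rw [e]
      rfl
    split_ifs with hb
    · rw [hcls]
      refine tsum_congr fun a => ?_
      rw [Set.indicator_of_mem ((hmem a a.2).1 hb.1),
        leafWeight_of_not_isSide _ (mt (hside a a.2).1 hb.2)]
    · refine ENNReal.tsum_eq_zero.2 fun a => ?_
      rw [Set.indicator_apply_eq_zero]
      intro ha
      exact if_pos ((hside a a.2).2 (by_contra fun hn => hb ⟨(hmem a a.2).2 ha, hn⟩))
  unfold mass
  rw [← (Equiv.sigmaFiberEquiv (homotopyClass C)).tsum_eq,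
    ← (Equiv.sigmaFiberEquiv (homotopyClass C)).tsum_eq (S.indicator ν.leafWeight),
    ENNReal.tsum_sigma', ENNReal.tsum_sigma']
  refine tsum_congr fun κ => ?_
  by_cases hκ : ∃ b, homotopyClass C b = κ
  · obtain ⟨b, rfl⟩ := hκ
    exact (key μ b).trans (by rw [h]; exact (key ν b).symm)
  · have : IsEmpty {a // homotopyClass C a = κ} := ⟨fun a => hκ ⟨a, a.2⟩⟩
    simp

theorem lines_saturated (P : ℤ → ℤ → Prop) (a b : CrownArc) (h : ProperlyHomotopic C a b) :
    a ∈ lines P ↔ b ∈ lines P := by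
  rw [properlyHomotopic_iff] at h
  cases a <;> cases b <;> simp_all [homotopyClass]

theorem rays_saturated (P : ℤ → Prop → Prop) (a b : CrownArc) (h : ProperlyHomotopic C a b) :
    a ∈ rays (fun c y => P c (C.base < y)) ↔ b ∈ rays (fun c y => P c (C.base < y)) := by
  cases a <;> cases b <;> simp_all [ProperlyHomotopic]
  have := h.2 0
  simp only [zpow_zero, one_mul] at this
  rw [this]

variable {μ ν}

theorem depth_eq_of_classWeight_eq (h : μ.classWeight = ν.classWeight) : μ.depth = ν.depth :=
  funext fun _ => mass_eq_of_classWeight_eq μ ν h (lines_saturated _)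

theorem rayWeight_eq_of_classWeight_eq (h : μ.classWeight = ν.classWeight) :
    μ.rayWeight = ν.rayWeight :=
  funext fun i => mass_eq_of_classWeight_eq μ ν h (rays_saturated fun c _ => c = i)

theorem weight_boundary_eq_of_classWeight_eq (h : μ.classWeight = ν.classWeight) :
    μ.weight .boundary = ν.weight .boundary := by
  rw [← classWeight_boundary, h, classWeight_boundary]

theorem raysBefore_eq_mass_not (μ : MeasuredLamination C) (i : ℤ) :
    μ.raysBefore i = μ.mass (rays fun c y => i < c ∧ ¬ C.base < y) := by
  refine μ.mass_congr (μ.leaf_induction (by simp) ?_ (by simp))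
  intro c y _ hw
  simp only [ray_mem_rays]
  rw [not_lt, (ray_ne_base hw).le_iff_lt]

theorem twistAt_eq_of_classWeight_eq (h : μ.classWeight = ν.classWeight) :
    μ.twistAt = ν.twistAt := by
  funext i
  unfold twistAt
  rw [raysBefore_eq_mass_not, raysBefore_eq_mass_not]
  rw [mass_eq_of_classWeight_eq μ ν h (rays_saturated fun c p => i < c ∧ ¬ p),
    raysBeyond, mass_eq_of_classWeight_eq μ ν h (rays_saturated fun c p => c ≤ i ∧ p)]
  rfl

theorem commonDepth_eq_of_depth_eq (hm : 0 < m) (h : μ.depth = ν.depth) {i j : ℤ} (hij : i < j) :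
    μ.commonDepth i j = ν.commonDepth i j := by
  apply le_antisymm
  · obtain ⟨c, hc, e⟩ := ν.exists_depth_eq_commonDepth hm hij
    rw [Finset.mem_Ioc] at hc
    rw [← e, ← h]
    exact μ.commonDepth_le_depth hc.1 hc.2
  · obtain ⟨c, hc, e⟩ := μ.exists_depth_eq_commonDepth hm hij
    rw [Finset.mem_Ioc] at hc
    rw [← e, h]
    exact ν.commonDepth_le_depth hc.1 hc.2

theorem weight_line_eq_of_depth_eq (hm : 0 < m) (h : μ.depth = ν.depth) (a b : ℤ) :
    μ.weight (.line a b) = ν.weight (.line a b) := by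
  rcases lt_trichotomy (a + 1) b with hab | rfl | hab
  · have h1 := μ.weight_line_add (show a + 2 ≤ b by omega)
    have h2 := ν.weight_line_add (show a + 2 ≤ b by omega)
    have e := fun {i j : ℤ} (hij : i < j) => commonDepth_eq_of_depth_eq hm h hij
    rw [e (show a - 1 < b - 1 by omega), e (show a < b by omega), e (show a < b - 1 by omega),
      e (show a - 1 < b by omega), ← h2] at h1
    exact (ENNReal.add_left_inj (ENNReal.add_ne_top.2
      ⟨ν.commonDepth_ne_top hm (by omega), ν.commonDepth_ne_top hm (by omega)⟩)).1 h1
  · rw [μ.weight_side _ ⟨a, rfl⟩, ν.weight_side _ ⟨a, rfl⟩]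
  · have e : ∀ ρ : MeasuredLamination C, ρ.weight (.line a b) = 0 := fun ρ => by
      by_contra hw
      have : a < b := ρ.valid _ hw
      omega
    rw [e, e]

/-- The total weight of the rays from the cusp `i` that end beyond the `k`-th lift of the
basepoint. -/
theorem mass_rays_beyond_zpow (μ : MeasuredLamination C) (i k : ℤ) :
    μ.mass (rays fun c y => c = i ∧ C.mult ^ k * C.base < y) =
      μ.mass (rays fun c y => c = i - k * m ∧ C.base < y) := by
  rw [← μ.mass_preimage_translate k]
  congr 1
  have h : (0 : ℝ) < C.mult ^ k := zpow_pos C.mult_pos k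
  ext a
  cases a <;> simp [CrownArc.translate, mul_lt_mul_iff_right₀ h, eq_sub_iff_add_eq]

theorem raysBeyond_eq_of_twistAt_eq (hm : 0 < m) (h : μ.twistAt = ν.twistAt) (i : ℤ) :
    μ.raysBeyond i = ν.raysBeyond i := by
  rw [← ENNReal.toReal_eq_toReal_iff' (μ.raysBeyond_ne_top hm i) (ν.raysBeyond_ne_top hm i),
    toReal_raysBeyond, toReal_raysBeyond, h]

theorem mass_rays_beyond_eq (hm : 0 < m) (h : μ.twistAt = ν.twistAt) (i k : ℤ) :
    μ.mass (rays fun c y => c = i ∧ C.mult ^ k * C.base < y) =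
      ν.mass (rays fun c y => c = i ∧ C.mult ^ k * C.base < y) := by
  rw [mass_rays_beyond_zpow, mass_rays_beyond_zpow]
  have h1 := μ.raysBeyond_succ (i - k * m - 1)
  have h2 := ν.raysBeyond_succ (i - k * m - 1)
  rw [raysBeyond_eq_of_twistAt_eq hm h, raysBeyond_eq_of_twistAt_eq hm h (i - k * m - 1), h2,
    sub_add_cancel] at h1
  exact ((ENNReal.add_right_inj (ν.raysBeyond_ne_top hm _)).1 h1).symm

theorem classWeight_ray_add (μ : MeasuredLamination C) (c k : ℤ) {y : ℝ}
    (h1 : C.mult ^ k * C.base < y) (h2 : y ≤ C.mult ^ (k + 1) * C.base) :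
    μ.mass (rays fun c' y' => c' = c ∧ C.mult ^ k * C.base < y') =
      μ.classWeight (.ray c y) +
        μ.mass (rays fun c' y' => c' = c ∧ C.mult ^ (k + 1) * C.base < y') := by
  have hle : ∀ {i j : ℤ}, i ≤ j → C.mult ^ i * C.base ≤ C.mult ^ j * C.base := fun hij =>
    mul_le_mul_of_nonneg_right (zpow_le_zpow_right₀ C.one_lt_mult.le hij) C.base_pos.le
  have hcell : ∀ y', (∀ j : ℤ, C.mult ^ j * C.base < y ↔ C.mult ^ j * C.base < y') ↔
      C.mult ^ k * C.base < y' ∧ ¬ C.mult ^ (k + 1) * C.base < y' := by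
    intro y'
    constructor
    · exact fun h => ⟨(h k).1 h1, fun h' => h2.not_gt ((h (k + 1)).2 h')⟩
    · rintro ⟨h3, h4⟩ j
      rcases le_or_gt j k with hj | hj
      · exact ⟨fun _ => (hle hj).trans_lt h3, fun _ => (hle hj).trans_lt h1⟩
      · exact ⟨fun h => absurd ((hle (show k + 1 ≤ j by omega)).trans_lt h) h2.not_gt,
          fun h => absurd ((hle (show k + 1 ≤ j by omega)).trans_lt h) h4⟩
  rw [classWeight_ray]
  simp only [hcell]
  refine μ.mass_union (μ.leaf_induction (by simp) ?_ (by simp))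
  intro c' y' _ _
  simp only [ray_mem_rays]
  have h3 : C.mult ^ (k + 1) * C.base < y' → C.mult ^ k * C.base < y' := fun h =>
    (hle (by omega)).trans_lt h
  tauto

/-- The depths of the cusps, the twists and the weight of the crown boundary determine a measured
lamination up to proper homotopy. -/
theorem classWeight_eq_of_invariants_eq (hm : 0 < m) (hD : μ.depth = ν.depth)
    (hT : μ.twistAt = ν.twistAt) (hβ : μ.weight .boundary = ν.weight .boundary) :
    μ.classWeight = ν.classWeight := by
  funext a
  cases a with
  | line p q => rw [classWeight_line, classWeight_line, weight_line_eq_of_depth_eq hm hD]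
  | boundary => rw [classWeight_boundary, classWeight_boundary, hβ]
  | ray c y =>
    rcases le_or_gt y 0 with hy | hy
    · have e : ∀ ρ : MeasuredLamination C, ρ.classWeight (.ray c y) = 0 := fun ρ => by
        rw [classWeight_ray, mass_eq_zero_iff]
        refine ρ.leaf_induction (by simp) ?_ (by simp)
        intro c' y' hy' _ h
        rw [ray_mem_rays] at h
        obtain ⟨k, hk, -⟩ := exists_mem_Ioc_zpow (div_pos hy' C.base_pos) C.one_lt_mult
        rw [lt_div_iff₀ C.base_pos] at hk
        have := (h.2 k).2 hk
        have := mul_pos (zpow_pos C.mult_pos k) C.base_pos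
        linarith
      rw [e, e]
    · obtain ⟨k, hk, hk'⟩ := exists_mem_Ioc_zpow (div_pos hy C.base_pos) C.one_lt_mult
      rw [lt_div_iff₀ C.base_pos] at hk
      rw [div_le_iff₀ C.base_pos] at hk'
      have h1 := μ.classWeight_ray_add c k hk hk'
      have h2 := ν.classWeight_ray_add c k hk hk'
      rw [mass_rays_beyond_eq hm hT, mass_rays_beyond_eq hm hT, h2] at h1
      refine ((ENNReal.add_left_inj ?_).1 h1).symm
      exact ne_top_of_le_ne_top (ν.rayWeight_ne_top hm c)
        (ν.mass_mono (by rintro _ ⟨c', y', rfl, h⟩; exact ⟨c', y', rfl, h.1⟩))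

end MeasuredLamination

/-! ### Laminations with prescribed invariants -/

/-- The numerical invariants of a measured lamination on a crown with `m` cusps, in the universal
cover: `depth i` is the weight of the leaves above the cusp `i`; the leaves from the cusp `i` to the
crown boundary are parametrized by the interval from `twist (i - 1)` to `twist i`, in such a way
that the lifts of the basepoint correspond to the multiples of `length`; `boundary` is the weight of
the crown boundary. -/
structure CrownInvariants (m : ℕ) where
  depth : ℤ → ℝ
  twist : ℤ → ℝ
  length : ℝ
  boundary : ℝ
  depth_add : ∀ i, depth (i + m) = depth i
  exists_depth_nonpos : ∃ i, depth i ≤ 0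
  twist_mono : Monotone twist
  twist_add : ∀ i, twist (i + m) = twist i + length
  twist_eq : ∀ i, 0 < depth i → twist (i - 1) = twist i
  length_eq : 0 < boundary → length = 0

namespace CrownInvariants

variable {m : ℕ} (I : CrownInvariants m)

theorem depth_add_mul (i k : ℤ) : I.depth (i + k * m) = I.depth i := by
  have h : Function.Periodic I.depth (m : ℤ) := I.depth_add
  exact h.int_mul k i

theorem twist_add_mul (i k : ℤ) : I.twist (i + k * m) = I.twist i + k * I.length := by
  induction k using Int.induction_on with
  | zero => simp
  | succ k ih =>
    have h := I.twist_add (i + k * m)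
    rw [show i + (k + 1 : ℤ) * m = i + k * m + m by ring, h, ih]
    push_cast; ring
  | pred k ih =>
    have h := I.twist_add (i + (-k - 1 : ℤ) * m)
    rw [show i + (-k - 1 : ℤ) * m + m = i + -k * m by ring, ih] at h
    push_cast at h ⊢
    linarith

theorem length_nonneg : 0 ≤ I.length := by
  have h1 := I.twist_mono (show (0 : ℤ) ≤ 0 + m by omega)
  rw [I.twist_add] at h1
  linarith

/-- The heights `x` such that `a` and `b` are consecutive among the cusps of depth at most `x`. The
leaves from `a` to `b` are parametrized by these heights. -/
def level (a b : ℤ) : Set ℝ :=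
  {x | 0 ≤ x ∧ I.depth a ≤ x ∧ I.depth b ≤ x ∧ ∀ c, a < c → c < b → x < I.depth c}

theorem measurableSet_level (a b : ℤ) : MeasurableSet (I.level a b) := by
  refine Set.OrdConnected.measurableSet ⟨?_⟩
  rintro x ⟨h0, h1, h2, -⟩ y ⟨-, -, -, h3⟩ z ⟨hz1, hz2⟩
  exact ⟨h0.trans hz1, h1.trans hz1, h2.trans hz1, fun c hc hc' => hz2.trans_lt (h3 c hc hc')⟩

theorem level_add_mul (k a b : ℤ) : I.level (a + k * m) (b + k * m) = I.level a b := by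
  ext x
  simp only [level, Set.mem_ofPred_eq, I.depth_add_mul]
  refine and_congr_right fun _ => and_congr_right fun _ => and_congr_right fun _ => ?_
  constructor
  · intro h c hc hc'
    rw [← I.depth_add_mul c k]
    exact h _ (by omega) (by omega)
  · intro h c hc hc'
    rw [← I.depth_add_mul c (-k)]
    exact h _ (by linarith) (by linarith)

theorem level_subset {a b c : ℤ} (h1 : a < c) (h2 : c < b) :
    I.level a b ⊆ Set.Ico 0 (I.depth c) :=
  fun _ hx => ⟨hx.1, hx.2.2.2 c h1 h2⟩

/-- The parameters of the leaves from the cusp `i` to the `k`-th lift of the complement of the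
basepoint in the crown boundary. -/
def cell (i k : ℤ) : Set ℝ :=
  Set.Ico (I.twist (i - 1)) (I.twist i) ∩ Set.Ico (k * I.length) ((k + 1) * I.length)

theorem measurableSet_cell (i k : ℤ) : MeasurableSet (I.cell i k) :=
  measurableSet_Ico.inter measurableSet_Ico

theorem volume_cell_add_mul (i j k : ℤ) :
    MeasureTheory.volume (I.cell (i + k * m) (j + k)) = MeasureTheory.volume (I.cell i j) := by
  have h := I.twist_add_mul (i - 1) k
  rw [show i - 1 + k * m = i + k * m - 1 by ring] at h
  unfold cell
  rw [Set.Ico_inter_Ico, Set.Ico_inter_Ico, Real.volume_Ico, Real.volume_Ico, h, I.twist_add_mul]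
  push_cast
  rw [show ((j : ℝ) + k) * I.length = j * I.length + k * I.length by ring,
    show ((j : ℝ) + k + 1) * I.length = (j + 1) * I.length + k * I.length by ring,
    max_add_add_right, min_add_add_right]
  congr 1
  ring

theorem cell_lt_of_lt {i i' : ℤ} {k k' : ℤ} (h : i < i') {x x' : ℝ} (hx : x ∈ I.cell i k)
    (hx' : x' ∈ I.cell i' k') : x < x' :=
  hx.1.2.trans_le ((I.twist_mono (by omega)).trans hx'.1.1)

theorem length_pos_of_mem_cell {i k : ℤ} {x : ℝ} (hx : x ∈ I.cell i k) : 0 < I.length := by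
  have h1 := hx.2.1.trans_lt hx.2.2
  linarith

theorem index_le_of_le {i i' k k' : ℤ} {x x' : ℝ} (h : x ≤ x') (hx : x ∈ I.cell i k)
    (hx' : x' ∈ I.cell i' k') : k ≤ k' := by
  have h1 := (hx.2.1.trans h).trans_lt hx'.2.2
  have h2 := lt_of_mul_lt_mul_right h1 I.length_nonneg
  have h3 : k < k' + 1 := by exact_mod_cast h2
  omega

theorem cell_disjoint : Pairwise (Function.onFun Disjoint fun q : ℤ × ℤ => I.cell q.1 q.2) := by
  rintro ⟨i, k⟩ ⟨i', k'⟩ hne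
  refine Set.disjoint_left.2 fun x hx hx' => hne ?_
  have h1 := I.index_le_of_le le_rfl hx hx'
  have h2 := I.index_le_of_le le_rfl hx' hx
  rcases lt_trichotomy i i' with h | h | h
  · exact absurd (I.cell_lt_of_lt h hx hx') (lt_irrefl _)
  · exact Prod.ext h (le_antisymm h1 h2)
  · exact absurd (I.cell_lt_of_lt h hx' hx) (lt_irrefl _)

theorem exists_mem_cell (hl : 0 < I.length) (x : ℝ) : ∃ i k, x ∈ I.cell i k := by
  have hx : ∃ i, x < I.twist i := by
    obtain ⟨k, hk⟩ := exists_nat_gt ((x - I.twist 0) / I.length)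
    rw [div_lt_iff₀ hl] at hk
    refine ⟨0 + k * m, ?_⟩
    rw [I.twist_add_mul]
    push_cast
    linarith
  have hb : ∃ b, ∀ i, x < I.twist i → b ≤ i := by
    obtain ⟨k, hk⟩ := exists_nat_gt ((I.twist 0 - x) / I.length)
    rw [div_lt_iff₀ hl] at hk
    refine ⟨0 + -k * m, fun i hi => ?_⟩
    by_contra! h
    have h1 := I.twist_mono h.le
    rw [I.twist_add_mul] at h1
    push_cast at h1
    linarith
  obtain ⟨i, hi, hi'⟩ := Int.exists_least_of_bdd hb hx
  refine ⟨i, ⌊x / I.length⌋, ⟨?_, hi⟩, ?_, ?_⟩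
  · by_contra! h
    have := hi' _ h
    omega
  · rw [← le_div_iff₀ hl]; exact Int.floor_le _
  · rw [← div_lt_iff₀ hl]; exact Int.lt_floor_add_one _

variable (C : MarkedCrown m)

/-- The endpoint on the lifted crown boundary of the leaves from the cusp `i` to the `k`-th lift of
the complement of the basepoint. The sigmoid function is used as a strictly increasing function from
the integers to the unit interval: endpoints in the same interval are in the order of the cusps. -/
noncomputable def rayEnd (i k : ℤ) : ℝ :=
  C.mult ^ k * (C.base * (1 + (C.mult - 1) * Real.sigmoid (i - k * m : ℤ)))

variable {C}

theorem rayEnd_mem (i k : ℤ) :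
    C.mult ^ k * C.base < rayEnd C i k ∧ rayEnd C i k < C.mult ^ (k + 1) * C.base := by
  have h0 : 0 < C.mult ^ k := zpow_pos C.mult_pos k
  have h1 := C.base_pos
  have h2 := C.one_lt_mult
  have h3 := Real.sigmoid_pos ((i - k * m : ℤ) : ℝ)
  have h4 := Real.sigmoid_lt_one ((i - k * m : ℤ) : ℝ)
  unfold rayEnd
  rw [zpow_add_one₀ C.mult_pos.ne', mul_assoc (C.mult ^ k) C.mult]
  constructor <;> apply mul_lt_mul_of_pos_left _ h0
  · exact lt_mul_of_one_lt_right h1 (by nlinarith)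
  · rw [mul_comm C.mult]
    exact mul_lt_mul_of_pos_left (by nlinarith) h1

theorem rayEnd_pos (i k : ℤ) : 0 < rayEnd C i k :=
  (mul_pos (zpow_pos C.mult_pos k) C.base_pos).trans (rayEnd_mem i k).1

theorem zpow_mul_base_le {j k : ℤ} (h : j ≤ k) : C.mult ^ j * C.base ≤ C.mult ^ k * C.base :=
  mul_le_mul_of_nonneg_right (zpow_le_zpow_right₀ C.one_lt_mult.le h) C.base_pos.le

theorem rayEnd_lt_of_lt {i i' k k' : ℤ} (h : k < k') : rayEnd C i k < rayEnd C i' k' :=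
  ((rayEnd_mem i k).2.trans_le (zpow_mul_base_le (by omega))).trans (rayEnd_mem i' k').1

theorem rayEnd_lt_of_le {i i' k k' : ℤ} (hi : i < i') (h : k ≤ k') :
    rayEnd C i k < rayEnd C i' k' := by
  rcases h.eq_or_lt with rfl | h
  · have h1 : Real.sigmoid (i - k * m : ℤ) < Real.sigmoid (i' - k * m : ℤ) :=
      Real.sigmoid_strictMono (by exact_mod_cast (by omega : i - k * (m : ℤ) < i' - k * m))
    unfold rayEnd
    have h2 := C.one_lt_mult
    exact mul_lt_mul_of_pos_left (mul_lt_mul_of_pos_left (by nlinarith) C.base_pos)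
      (zpow_pos C.mult_pos k)
  · exact rayEnd_lt_of_lt h

theorem base_lt_rayEnd {i k : ℤ} : C.base < rayEnd C i k ↔ 0 ≤ k := by
  constructor
  · intro h
    by_contra! hk
    have := (rayEnd_mem (C := C) i k).2.trans_le (zpow_mul_base_le (show k + 1 ≤ 0 by omega))
    simp at this
    linarith
  · intro h
    have := (zpow_mul_base_le h).trans_lt (rayEnd_mem (C := C) i k).1
    simpa using this

theorem rayEnd_lt_base {i k : ℤ} : rayEnd C i k < C.base ↔ k < 0 := by
  constructor
  · intro h
    by_contra! hk
    exact lt_asymm h (base_lt_rayEnd.2 hk)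
  · intro h
    have := (rayEnd_mem (C := C) i k).2.trans_le (zpow_mul_base_le (show k + 1 ≤ 0 by omega))
    simpa using this

theorem rayEnd_add_mul (i j k : ℤ) :
    rayEnd C (i + k * m) (j + k) = C.mult ^ k * rayEnd C i j := by
  unfold rayEnd
  rw [show i + k * m - (j + k) * m = i - j * (m : ℤ) by ring, zpow_add₀ C.mult_pos.ne']
  ring

theorem rayEnd_injective :
    Function.Injective fun q : ℤ × ℤ => (q.1, rayEnd C q.1 q.2) := by
  rintro ⟨i, k⟩ ⟨i', k'⟩ h
  simp only [Prod.mk.injEq] at h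
  obtain ⟨rfl, h⟩ := h
  rcases lt_trichotomy k k' with hk | rfl | hk
  · exact absurd h (rayEnd_lt_of_lt hk).ne
  · rfl
  · exact absurd h (rayEnd_lt_of_lt hk).ne'

variable (C)

/-- The weights of a lamination with the given invariants. -/
noncomputable def weight : CrownArc → ℝ≥0∞
  | .line a b =>
    if b = a + 1 then ⊤ else if a < b then MeasureTheory.volume (I.level a b) else 0
  | .ray c y =>
    Function.extend (fun q : ℤ × ℤ => (q.1, rayEnd C q.1 q.2))
      (fun q => MeasureTheory.volume (I.cell q.1 q.2)) 0 (c, y)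
  | .boundary => ENNReal.ofReal I.boundary

theorem weight_rayEnd (i k : ℤ) :
    I.weight C (.ray i (rayEnd C i k)) = MeasureTheory.volume (I.cell i k) := by
  have h := (rayEnd_injective (C := C)).extend_apply
    (fun q : ℤ × ℤ => MeasureTheory.volume (I.cell q.1 q.2)) 0 (i, k)
  exact h

variable {C}

theorem lt_of_weight_line {a b : ℤ} (h : I.weight C (.line a b) ≠ 0) : a < b := by
  simp only [weight] at h
  split_ifs at h <;> first | omega | exact absurd rfl h

theorem exists_level_of_weight {a b : ℤ} (h : I.weight C (.line a b) ≠ 0) :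
    b = a + 1 ∨ a < b ∧ ∃ x, x ∈ I.level a b := by
  simp only [weight] at h
  split_ifs at h with h1 h2
  · exact Or.inl h1
  · exact Or.inr ⟨h2, MeasureTheory.nonempty_of_measure_ne_zero h⟩
  · exact absurd rfl h

theorem exists_cell_of_weight {c : ℤ} {y : ℝ} (h : I.weight C (.ray c y) ≠ 0) :
    ∃ k, y = rayEnd C c k ∧ ∃ x, x ∈ I.cell c k := by
  by_cases hy : ∃ q : ℤ × ℤ, (q.1, rayEnd C q.1 q.2) = (c, y)
  · obtain ⟨⟨i, k⟩, hq⟩ := hy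
    simp only [Prod.mk.injEq] at hq
    obtain ⟨rfl, rfl⟩ := hq
    rw [weight_rayEnd] at h
    exact ⟨k, rfl, MeasureTheory.nonempty_of_measure_ne_zero h⟩
  · have h0 := Function.extend_apply'
      (fun q : ℤ × ℤ => MeasureTheory.volume (I.cell q.1 q.2)) (0 : ℤ × ℝ → ℝ≥0∞) (c, y) hy
    exact absurd h0 h

theorem line_le_of_weight (hm : 0 < m) {a b : ℤ} (h : I.weight C (.line a b) ≠ 0) :
    b ≤ a + m := by
  rcases I.exists_level_of_weight h with h | ⟨-, x, -, hx, -, hx'⟩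
  · omega
  · by_contra! hb
    have := hx' (a + m) (by omega) hb
    rw [I.depth_add] at this
    linarith

theorem not_cross_of_weight {a b a' b' : ℤ} (h : I.weight C (.line a b) ≠ 0)
    (h' : I.weight C (.line a' b') ≠ 0) : ¬ (a < a' ∧ a' < b ∧ b < b') := by
  rintro ⟨h1, h2, h3⟩
  rcases I.exists_level_of_weight h with h | ⟨-, x, hx⟩
  · omega
  rcases I.exists_level_of_weight h' with h' | ⟨-, x', hx'⟩
  · omega
  have e1 := hx.2.2.2 a' h1 h2
  have e2 := hx'.2.2.2 b h2 h3
  linarith [hx'.2.1, hx.2.2.1]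

theorem not_ray_under_line_of_weight {a b c : ℤ} {y : ℝ} (h : I.weight C (.line a b) ≠ 0)
    (h' : I.weight C (.ray c y) ≠ 0) : ¬ (a < c ∧ c < b) := by
  rintro ⟨h1, h2⟩
  obtain ⟨k, rfl, x', hx'⟩ := I.exists_cell_of_weight h'
  rcases I.exists_level_of_weight h with h | ⟨-, x, hx⟩
  · omega
  have h3 := I.twist_eq c (hx.1.trans_lt (hx.2.2.2 c h1 h2))
  have h4 := hx'.1.1.trans_lt hx'.1.2
  linarith

theorem ray_lt_ray_of_weight {c c' : ℤ} {y y' : ℝ} (h : I.weight C (.ray c y) ≠ 0)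
    (h' : I.weight C (.ray c' y') ≠ 0) (hc : c < c') : y < y' := by
  obtain ⟨k, rfl, x, hx⟩ := I.exists_cell_of_weight h
  obtain ⟨k', rfl, x', hx'⟩ := I.exists_cell_of_weight h'
  exact rayEnd_lt_of_le hc (I.index_le_of_le (I.cell_lt_of_lt hc hx hx').le hx hx')

theorem weight_ray_of_boundary (h : I.weight C .boundary ≠ 0) (c : ℤ) (y : ℝ) :
    I.weight C (.ray c y) = 0 := by
  by_contra h'
  obtain ⟨k, rfl, x, hx⟩ := I.exists_cell_of_weight h'
  have h1 := I.length_pos_of_mem_cell hx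
  have h2 : 0 < I.boundary := by
    by_contra! h2
    exact h (ENNReal.ofReal_of_nonpos h2)
  exact h1.ne' (I.length_eq h2)

theorem weight_translate (k : ℤ) (a : CrownArc) :
    I.weight C (a.translate C.toHyperbolicCrown k) = I.weight C a := by
  cases a with
  | line a b =>
    simp only [CrownArc.translate, weight, I.level_add_mul]
    congr 1
    · simp only [eq_iff_iff]; omega
    · congr 1
      simp only [eq_iff_iff]; omega
  | boundary => rfl
  | ray c y =>
    change I.weight C (.ray (c + k * m) (C.mult ^ k * y)) = _
    by_cases h : ∃ j, y = rayEnd C c j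
    · obtain ⟨j, rfl⟩ := h
      rw [← rayEnd_add_mul, weight_rayEnd, weight_rayEnd, volume_cell_add_mul]
    · have h1 : I.weight C (.ray c y) = 0 := by
        by_contra h1
        obtain ⟨j, hj, -⟩ := I.exists_cell_of_weight h1
        exact h ⟨j, hj⟩
      rw [h1]
      by_contra h2
      obtain ⟨j, hj, -⟩ := I.exists_cell_of_weight h2
      rw [show j = j - k + k by ring, rayEnd_add_mul] at hj
      exact h ⟨j - k, mul_left_cancel₀ (zpow_pos C.mult_pos k).ne' hj⟩

theorem disjoint_of_weight {a b : CrownArc} (ha : I.weight C a ≠ 0) (hb : I.weight C b ≠ 0)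
    (hab : a ≠ b) :
    Disjoint (a.carrier C.toHyperbolicCrown) (b.carrier C.toHyperbolicCrown) := by
  have ray_line : ∀ {c y p q}, I.weight C (.ray c y) ≠ 0 → I.weight C (.line p q) ≠ 0 →
      Disjoint ((CrownArc.ray c y).carrier C.toHyperbolicCrown)
        ((CrownArc.line p q).carrier C.toHyperbolicCrown) := by
    intro c y p q h1 h2
    have h3 := I.not_ray_under_line_of_weight h2 h1
    obtain ⟨k, rfl, -⟩ := I.exists_cell_of_weight h1
    exact C.disjoint_ray_line (rayEnd_pos c k) (I.lt_of_weight_line h2) h3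
  have ray_ray : ∀ {c y c' y'}, I.weight C (.ray c y) ≠ 0 → I.weight C (.ray c' y') ≠ 0 →
      y < y' → Disjoint ((CrownArc.ray c y).carrier C.toHyperbolicCrown)
        ((CrownArc.ray c' y').carrier C.toHyperbolicCrown) := by
    intro c y c' y' h1 h2 hy
    have h3 : c ≤ c' := by
      by_contra! h3
      exact lt_asymm hy (I.ray_lt_ray_of_weight h2 h1 h3)
    obtain ⟨k, rfl, -⟩ := I.exists_cell_of_weight h1
    exact C.disjoint_ray_ray (rayEnd_pos c k) h3 hy
  cases a with
  | line p q =>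
    cases b with
    | line p' q' =>
      exact C.disjoint_line_line (I.lt_of_weight_line ha) (I.lt_of_weight_line hb)
        (by rintro ⟨⟩; exact hab rfl) (I.not_cross_of_weight ha hb) (I.not_cross_of_weight hb ha)
    | ray c y => exact (ray_line hb ha).symm
    | boundary => exact C.disjoint_line_boundary (I.lt_of_weight_line ha)
  | ray c y =>
    cases b with
    | line p' q' => exact ray_line ha hb
    | ray c' y' =>
      rcases lt_trichotomy y y' with h | rfl | h
      · exact ray_ray ha hb h
      · rcases lt_trichotomy c c' with h | rfl | h
        · exact absurd (I.ray_lt_ray_of_weight ha hb h) (lt_irrefl _)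
        · exact absurd rfl hab
        · exact absurd (I.ray_lt_ray_of_weight hb ha h) (lt_irrefl _)
      · exact (ray_ray hb ha h).symm
    | boundary => exact absurd (I.weight_ray_of_boundary hb c y) ha
  | boundary =>
    cases b with
    | line p' q' => exact (C.disjoint_line_boundary (I.lt_of_weight_line hb)).symm
    | ray c y => exact absurd (I.weight_ray_of_boundary ha c y) hb
    | boundary => exact absurd rfl hab

theorem finite_cell_index (c : ℤ) : {k | ∃ x, x ∈ I.cell c k}.Finite := by
  by_cases h : ∃ k x, x ∈ I.cell c k
  · obtain ⟨k, x, hx⟩ := h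
    have hl := I.length_pos_of_mem_cell hx
    refine (Set.finite_Icc (⌊I.twist (c - 1) / I.length⌋ - 1) ⌈I.twist c / I.length⌉).subset ?_
    rintro k ⟨x, hx⟩
    have h1 := hx.2.1.trans_lt hx.1.2
    have h2 := hx.1.1.trans_lt hx.2.2
    rw [← lt_div_iff₀ hl] at h1
    rw [← div_lt_iff₀ hl] at h2
    have h3 : (k : ℝ) < ⌈I.twist c / I.length⌉ := h1.trans_le (Int.le_ceil _)
    have h4 : (⌊I.twist (c - 1) / I.length⌋ : ℝ) < k + 1 := (Int.floor_le _).trans_lt h2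
    have h3' : k < ⌈I.twist c / I.length⌉ := by exact_mod_cast h3
    have h4' : ⌊I.twist (c - 1) / I.length⌋ < k + 1 := by exact_mod_cast h4
    exact ⟨by omega, by omega⟩
  · push Not at h
    convert Set.finite_empty
    ext k
    simpa using h k

theorem finite_mod_deck_weight (hm : 0 < m) : ∃ F : Set CrownArc, F.Finite ∧
    ∀ a, I.weight C a ≠ 0 → ∃ b ∈ F, ∃ k : ℤ, a = b.translate C.toHyperbolicCrown k := by
  refine ⟨(fun q : ℤ × ℤ => CrownArc.line q.1 q.2) '' (Set.Icc 0 (m : ℤ) ×ˢ Set.Icc 0 (2 * m : ℤ)) ∪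
    (⋃ c ∈ Set.Icc 0 (m : ℤ), (fun k => CrownArc.ray c (rayEnd C c k)) ''
      {k | ∃ x, x ∈ I.cell c k}) ∪ {.boundary}, ?_, ?_⟩
  · refine ((Set.Finite.image _ ((Set.finite_Icc _ _).prod (Set.finite_Icc _ _))).union
      ((Set.finite_Icc _ _).biUnion fun c _ => (I.finite_cell_index c).image _)).union
      (Set.finite_singleton _)
  · have hdiv : ∀ c : ℤ, c % m + c / m * m = c := fun c => by
      rw [mul_comm]; exact Int.emod_add_mul_ediv c m
    have hmod : ∀ c : ℤ, 0 ≤ c % m ∧ c % m < m := fun c =>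
      ⟨Int.emod_nonneg _ (by omega), Int.emod_lt_of_pos _ (by omega)⟩
    intro a ha
    cases a with
    | line p q =>
      have h1 := I.lt_of_weight_line ha
      have h2 := I.line_le_of_weight hm ha
      have h3 := hdiv p
      have h4 := hmod p
      refine ⟨.line (p % m) (q - p / m * m), Or.inl (Or.inl ⟨(p % m, q - p / m * m),
        ⟨⟨h4.1, h4.2.le⟩, ⟨by linarith, by linarith⟩⟩, rfl⟩), p / m, ?_⟩
      simp only [CrownArc.translate, CrownArc.line.injEq]
      exact ⟨h3.symm, by ring⟩
    | ray c y =>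
      obtain ⟨k, rfl, -⟩ := I.exists_cell_of_weight ha
      have h3 := hdiv c
      have h4 := hmod c
      have hr : CrownArc.ray c (rayEnd C c k) = (CrownArc.ray (c % m)
          (rayEnd C (c % m) (k - c / m))).translate C.toHyperbolicCrown (c / m) := by
        have := rayEnd_add_mul (C := C) (c % m) (k - c / m) (c / m)
        rw [sub_add_cancel, h3] at this
        simp only [CrownArc.translate, CrownArc.ray.injEq, this]
        exact ⟨h3.symm, trivial⟩
      rw [hr, I.weight_translate, weight_rayEnd] at ha
      refine ⟨_, Or.inl (Or.inr ?_), c / m, hr⟩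
      exact Set.mem_biUnion (x := c % m) ⟨h4.1, h4.2.le⟩
        ⟨k - c / m, MeasureTheory.nonempty_of_measure_ne_zero ha, rfl⟩
    | boundary => exact ⟨.boundary, Or.inr rfl, 0, rfl⟩

variable (C)

/-- A measured lamination with the given invariants. -/
noncomputable def lamination (hm : 0 < m) : MeasuredLamination C where
  weight := I.weight C
  valid a ha := by
    cases a with
    | line p q => exact I.lt_of_weight_line ha
    | ray c y =>
      obtain ⟨k, rfl, -⟩ := I.exists_cell_of_weight ha
      exact rayEnd_pos c k
    | boundary => trivial
  weight_side := by
    rintro _ ⟨i, rfl⟩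
    simp [weight]
  weight_ne_top a ha := by
    cases a with
    | line p q =>
      rw [CrownArc.isSide_line] at ha
      simp only [weight, if_neg ha]
      split_ifs with h
      · exact ne_top_of_le_ne_top (by simp)
          (MeasureTheory.measure_mono (I.level_subset (lt_add_one p) (show p + 1 < q by omega)))
      · exact ENNReal.zero_ne_top
    | ray c y =>
      by_cases h : I.weight C (.ray c y) = 0
      · rw [h]; exact ENNReal.zero_ne_top
      · obtain ⟨k, rfl, -⟩ := I.exists_cell_of_weight h
        rw [weight_rayEnd]
        exact ne_top_of_le_ne_top (by simp) (MeasureTheory.measure_mono Set.inter_subset_left)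
    | boundary => exact ENNReal.ofReal_ne_top
  weight_translate := I.weight_translate
  disjoint _ _ := I.disjoint_of_weight
  finite_mod_deck := I.finite_mod_deck_weight hm
  ray_end_ne c y h k := by
    obtain ⟨j, rfl, -⟩ := I.exists_cell_of_weight h
    obtain ⟨h1, h2⟩ := rayEnd_mem (C := C) c j
    intro he
    rw [he] at h1 h2
    have h3 := (zpow_lt_zpow_iff_right₀ C.one_lt_mult).1 (lt_of_mul_lt_mul_right h1 C.base_pos.le)
    have h4 := (zpow_lt_zpow_iff_right₀ C.one_lt_mult).1 (lt_of_mul_lt_mul_right h2 C.base_pos.le)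
    omega

theorem weight_boundary_lamination (hm : 0 < m) :
    (I.lamination C hm).weight .boundary = ENNReal.ofReal I.boundary := rfl

open CrownArc

theorem mass_lines_lamination (hm : 0 < m) {P : ℤ → ℤ → Prop} (hP : ∀ p q, P p q → p + 2 ≤ q) :
    (I.lamination C hm).mass (lines P) =
      ∑' q : {q : ℤ × ℤ // P q.1 q.2}, MeasureTheory.volume (I.level q.1.1 q.1.2) := by
  have hinj : Function.Injective fun q : ℤ × ℤ => line q.1 q.2 := by
    rintro ⟨_, _⟩ ⟨_, _⟩ h
    simpa using h
  unfold MeasuredLamination.mass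
  rw [← hinj.tsum_eq]
  · refine Eq.trans (tsum_congr fun q => ?_) (tsum_subtype {q : ℤ × ℤ | P q.1 q.2}
      fun q => MeasureTheory.volume (I.level q.1 q.2)).symm
    by_cases h : P q.1 q.2
    · have h2 := hP _ _ h
      rw [Set.indicator_of_mem (line_mem_lines.2 h), Set.indicator_of_mem (by exact h),
        MeasuredLamination.leafWeight_of_not_isSide _ (by rw [isSide_line]; omega)]
      change I.weight C (.line q.1 q.2) = _
      simp only [weight]
      rw [if_neg (by omega), if_pos (by omega)]
    · rw [Set.indicator_of_notMem (by simpa using h), Set.indicator_of_notMem (by exact h)]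
  · intro a ha
    obtain ⟨p, q, rfl, -⟩ := Set.mem_of_indicator_ne_zero ha
    exact ⟨(p, q), rfl⟩

theorem mass_rays_lamination (hm : 0 < m) (P : ℤ → ℝ → Prop) :
    (I.lamination C hm).mass (rays P) =
      MeasureTheory.volume
        (⋃ q : {q : ℤ × ℤ // P q.1 (rayEnd C q.1 q.2)}, I.cell q.1.1 q.1.2) := by
  rw [MeasureTheory.measure_iUnion
    (f := fun q : {q : ℤ × ℤ // P q.1 (rayEnd C q.1 q.2)} => I.cell q.1.1 q.1.2)
    (fun q q' h => I.cell_disjoint fun h' => h (Subtype.ext h'))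
    fun q => I.measurableSet_cell _ _]
  have hinj : Function.Injective fun q : ℤ × ℤ => ray q.1 (rayEnd C q.1 q.2) := by
    intro q q' h
    apply rayEnd_injective (C := C)
    simpa using h
  unfold MeasuredLamination.mass
  rw [← hinj.tsum_eq]
  · refine Eq.trans (tsum_congr fun q => ?_)
      (tsum_subtype {q : ℤ × ℤ | P q.1 (rayEnd C q.1 q.2)}
        fun q => MeasureTheory.volume (I.cell q.1 q.2)).symm
    by_cases h : P q.1 (rayEnd C q.1 q.2)
    · rw [Set.indicator_of_mem (ray_mem_rays.2 h), Set.indicator_of_mem (by exact h),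
        MeasuredLamination.leafWeight_of_not_isSide _ not_isSide_ray]
      exact I.weight_rayEnd C q.1 q.2
    · rw [Set.indicator_of_notMem (by simpa using h), Set.indicator_of_notMem (by exact h)]
  · intro a ha
    obtain ⟨c, y, rfl, -⟩ := Set.mem_of_indicator_ne_zero ha
    have hw : I.weight C (.ray c y) ≠ 0 := by
      have h0 : (I.lamination C hm).leafWeight (.ray c y) ≠ 0 := fun h0 => ha (by
        rw [Set.indicator_apply_eq_zero]; exact fun _ => h0)
      exact ((I.lamination C hm).leafWeight_ne_zero.1 h0).2
    obtain ⟨k, rfl, -⟩ := I.exists_cell_of_weight hw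
    exact ⟨(c, k), rfl⟩

theorem depth_lamination (hm : 0 < m) (i : ℤ) :
    (I.lamination C hm).depth i = ENNReal.ofReal (I.depth i) := by
  unfold MeasuredLamination.depth
  rw [mass_lines_lamination _ _ _ fun p q h => by omega, ← MeasureTheory.measure_iUnion]
  · have e : (⋃ q : {q : ℤ × ℤ // q.1 < i ∧ i < q.2}, I.level q.1.1 q.1.2) =
        Set.Ico 0 (I.depth i) := by
      apply subset_antisymm
      · exact Set.iUnion_subset fun q => I.level_subset q.2.1 q.2.2
      · rintro x ⟨hx0, hx⟩
        obtain ⟨c, hc⟩ := I.exists_depth_nonpos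
        have hlow : ∀ k : ℤ, I.depth (c + k * m) ≤ x := fun k => by
          rw [I.depth_add_mul]; linarith
        have hlarge : (|i - c| + 1) ≤ (|i - c| + 1) * m :=
          le_mul_of_one_le_right (by positivity) (by omega)
        have habs := abs_le.1 (le_refl |i - c|)
        obtain ⟨a, ⟨ha, hax⟩, ha'⟩ := Int.exists_greatest_of_bdd
          (P := fun a => a < i ∧ I.depth a ≤ x) ⟨i, fun z hz => hz.1.le⟩
          ⟨c + -(|i - c| + 1) * m, by linarith, hlow _⟩
        obtain ⟨b, ⟨hb, hbx⟩, hb'⟩ := Int.exists_least_of_bdd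
          (P := fun b => i < b ∧ I.depth b ≤ x) ⟨i, fun z hz => hz.1.le⟩
          ⟨c + (|i - c| + 1) * m, by linarith, hlow _⟩
        refine Set.mem_iUnion.2 ⟨⟨(a, b), ha, hb⟩, hx0, hax, hbx, fun k hak hkb => ?_⟩
        by_contra! hk
        simp only at hak hkb
        rcases lt_trichotomy k i with h | rfl | h
        · have := ha' k ⟨h, hk⟩
          omega
        · linarith
        · have := hb' k ⟨h, hk⟩
          omega
    rw [e, Real.volume_Ico, sub_zero]
  · rintro ⟨⟨a, b⟩, ha, hb⟩ ⟨⟨a', b'⟩, ha', hb'⟩ hne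
    simp only at ha hb ha' hb'
    refine Set.disjoint_left.2 fun x hx hx' => hne ?_
    simp only [level, Set.mem_ofPred_eq] at hx hx'
    have h1 : a = a' := by
      rcases lt_trichotomy a a' with h | h | h
      · have := hx.2.2.2 a' h (by omega)
        linarith [hx'.2.1]
      · exact h
      · have := hx'.2.2.2 a h (by omega)
        linarith [hx.2.1]
    have h2 : b = b' := by
      rcases lt_trichotomy b b' with h | h | h
      · have := hx'.2.2.2 b (by omega) h
        linarith [hx.2.2.1]
      · exact h
      · have := hx.2.2.2 b' (by omega) h
        linarith [hx'.2.2.1]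
    subst h1 h2
    rfl
  · exact fun q => I.measurableSet_level _ _

theorem rayWeight_lamination (hm : 0 < m) (i : ℤ) :
    (I.lamination C hm).rayWeight i = ENNReal.ofReal (I.twist i - I.twist (i - 1)) := by
  unfold MeasuredLamination.rayWeight
  rw [mass_rays_lamination, ← Real.volume_Ico]
  congr 1
  apply subset_antisymm
  · rintro x hx
    obtain ⟨⟨⟨i', k⟩, rfl⟩, hx⟩ := Set.mem_iUnion.1 hx
    exact hx.1
  · intro x hx
    have hl : 0 < I.length := by
      have h1 := hx.1.trans_lt hx.2
      have h2 := I.twist_mono (show i ≤ i - 1 + m by omega)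
      rw [I.twist_add] at h2
      linarith
    obtain ⟨i', k, hx'⟩ := I.exists_mem_cell hl x
    exact Set.mem_iUnion.2 ⟨⟨(i, k), rfl⟩, hx, hx'.2⟩

theorem twistAt_lamination (hm : 0 < m) (hl : 0 < I.length) :
    (I.lamination C hm).twistAt 0 = I.twist 0 := by
  have h1 : (I.lamination C hm).raysBeyond 0 = ENNReal.ofReal (I.twist 0 - 0) := by
    unfold MeasuredLamination.raysBeyond
    rw [mass_rays_lamination, ← Real.volume_Ico]
    congr 1
    apply subset_antisymm
    · rintro x hx
      obtain ⟨⟨⟨i, k⟩, hi, hk⟩, hx⟩ := Set.mem_iUnion.1 hx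
      rw [base_lt_rayEnd] at hk
      have hk' : (0 : ℝ) ≤ k := by exact_mod_cast hk
      exact ⟨(mul_nonneg hk' hl.le).trans hx.2.1, hx.1.2.trans_le (I.twist_mono hi)⟩
    · intro x hx
      obtain ⟨i, k, hx'⟩ := I.exists_mem_cell hl x
      refine Set.mem_iUnion.2 ⟨⟨(i, k), ?_, ?_⟩, hx'⟩
      · by_contra! hi
        have := I.twist_mono (show (0 : ℤ) ≤ i - 1 by simp only at hi; omega)
        linarith [hx'.1.1, hx.2]
      · rw [base_lt_rayEnd]
        have h1 := hx.1.trans_lt hx'.2.2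
        have h2 : (0 : ℝ) < k + 1 := pos_of_mul_pos_left h1 hl.le
        have h3 : (0 : ℤ) < k + 1 := by exact_mod_cast h2
        change 0 ≤ k
        omega
  have h2 : (I.lamination C hm).raysBefore 0 = ENNReal.ofReal (0 - I.twist 0) := by
    unfold MeasuredLamination.raysBefore
    rw [mass_rays_lamination, ← Real.volume_Ico]
    congr 1
    apply subset_antisymm
    · rintro x hx
      obtain ⟨⟨⟨i, k⟩, hi, hk⟩, hx⟩ := Set.mem_iUnion.1 hx
      rw [rayEnd_lt_base] at hk
      simp only at hi hk
      have hk' : (k : ℝ) + 1 ≤ 0 := by exact_mod_cast hk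
      exact ⟨(I.twist_mono (show (0 : ℤ) ≤ i - 1 by omega)).trans hx.1.1,
        hx.2.2.trans_le (mul_nonpos_of_nonpos_of_nonneg hk' hl.le)⟩
    · intro x hx
      obtain ⟨i, k, hx'⟩ := I.exists_mem_cell hl x
      refine Set.mem_iUnion.2 ⟨⟨(i, k), ?_, ?_⟩, hx'⟩
      · by_contra! hi
        have := I.twist_mono hi
        linarith [hx'.1.2, hx.1]
      · rw [rayEnd_lt_base]
        have h1 := hx'.2.1.trans_lt hx.2
        have h2 : (k : ℝ) < 0 := by
          by_contra! h
          exact h1.not_ge (mul_nonneg h hl.le)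
        exact_mod_cast h2
  rw [MeasuredLamination.twistAt, h1, h2, sub_zero, zero_sub]
  rcases le_total 0 (I.twist 0) with h | h
  · rw [ENNReal.toReal_ofReal h, ENNReal.ofReal_of_nonpos (by linarith)]; simp
  · rw [ENNReal.ofReal_of_nonpos h, ENNReal.toReal_ofReal (by linarith)]; simp

end CrownInvariants

/-! ### The space of boundary parameters -/

/-- The map `z ↦ z ^ 2` on the closed upper half-plane, which identifies `(x, 0)` with `(-x, 0)`. -/
noncomputable def halfPlaneSq (q : {q : ℝ × ℝ // 0 ≤ q.2}) : EuclideanSpace ℝ (Fin 2) :=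
  !₂[q.1.1 ^ 2 - q.1.2 ^ 2, 2 * q.1.1 * q.1.2]

@[simp] theorem halfPlaneSq_zero (q : {q : ℝ × ℝ // 0 ≤ q.2}) :
    halfPlaneSq q 0 = q.1.1 ^ 2 - q.1.2 ^ 2 := rfl

@[simp] theorem halfPlaneSq_one (q : {q : ℝ × ℝ // 0 ≤ q.2}) :
    halfPlaneSq q 1 = 2 * q.1.1 * q.1.2 := rfl

theorem continuous_halfPlaneSq : Continuous halfPlaneSq := by
  refine (PiLp.continuous_toLp 2 _).comp (continuous_pi fun i => ?_)
  fin_cases i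
  · change Continuous fun q : {q : ℝ × ℝ // 0 ≤ q.2} => q.1.1 ^ 2 - q.1.2 ^ 2
    fun_prop
  · change Continuous fun q : {q : ℝ × ℝ // 0 ≤ q.2} => 2 * q.1.1 * q.1.2
    fun_prop

theorem halfPlaneSq_eq_iff (a b : {q : ℝ × ℝ // 0 ≤ q.2}) :
    halfPlaneSq a = halfPlaneSq b ↔ halfPlaneSetoid.r a b := by
  obtain ⟨⟨x, y⟩, hy⟩ := a
  obtain ⟨⟨x', y'⟩, hy'⟩ := b
  simp only at hy hy'
  constructor
  · intro h
    have h0 : x ^ 2 - y ^ 2 = x' ^ 2 - y' ^ 2 := congrFun (congrArg WithLp.ofLp h) 0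
    have h1 : 2 * x * y = 2 * x' * y' := congrFun (congrArg WithLp.ofLp h) 1
    have h2 : (x ^ 2 + y ^ 2) ^ 2 = (x' ^ 2 + y' ^ 2) ^ 2 := by
      have e1 : (x ^ 2 + y ^ 2) ^ 2 = (x ^ 2 - y ^ 2) ^ 2 + (2 * x * y) ^ 2 := by ring
      have e2 : (x' ^ 2 + y' ^ 2) ^ 2 = (x' ^ 2 - y' ^ 2) ^ 2 + (2 * x' * y') ^ 2 := by ring
      rw [e1, e2, h0, h1]
    have h3 : x ^ 2 + y ^ 2 = x' ^ 2 + y' ^ 2 :=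
      (pow_left_inj₀ (by positivity) (by positivity) two_ne_zero).1 h2
    have h4 : y = y' := (pow_left_inj₀ hy hy' two_ne_zero).1 (by linarith)
    subst h4
    rcases hy.eq_or_lt with rfl | hy0
    · rcases sq_eq_sq_iff_eq_or_eq_neg.1 (show x ^ 2 = x' ^ 2 by linarith) with rfl | h
      · exact Or.inl rfl
      · exact Or.inr ⟨rfl, rfl, h⟩
    · have : x = x' := mul_right_cancel₀ hy0.ne' (by linarith)
      exact Or.inl (by subst this; rfl)
  · rintro (h | ⟨h1, h2, h3⟩)
    · rw [h]
    · simp only at h1 h2 h3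
      subst h1 h2 h3
      ext i
      fin_cases i <;> simp [halfPlaneSq]

theorem exists_halfPlaneSq_eq (u v : ℝ) : ∃ q, halfPlaneSq q 0 = u ∧ halfPlaneSq q 1 = v := by
  set r := √(u ^ 2 + v ^ 2)
  have hr : r ^ 2 = u ^ 2 + v ^ 2 := Real.sq_sqrt (by positivity)
  have hr0 : 0 ≤ r := Real.sqrt_nonneg _
  have hu : |u| ≤ r := Real.abs_le_sqrt (by nlinarith [sq_nonneg v])
  obtain ⟨hu1, hu2⟩ := abs_le.1 hu
  have hy : √((r - u) / 2) ^ 2 = (r - u) / 2 := Real.sq_sqrt (by linarith)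
  have hx : √((r + u) / 2) ^ 2 = (r + u) / 2 := Real.sq_sqrt (by linarith)
  have hxy : 2 * √((r + u) / 2) * √((r - u) / 2) = |v| := by
    rw [mul_assoc, ← Real.sqrt_mul (by linarith), ← Real.sqrt_sq_eq_abs,
      show (r + u) / 2 * ((r - u) / 2) = (v / 2) ^ 2 by linarith, Real.sqrt_sq_eq_abs,
      Real.sqrt_sq_eq_abs, abs_div, abs_two]
    ring
  rcases le_total 0 v with hv | hv
  · refine ⟨⟨(√((r + u) / 2), √((r - u) / 2)), Real.sqrt_nonneg _⟩, ?_, ?_⟩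
    · simp only [halfPlaneSq_zero, hx, hy]; ring
    · simp only [halfPlaneSq_one, hxy, abs_of_nonneg hv]
  · refine ⟨⟨(-√((r + u) / 2), √((r - u) / 2)), Real.sqrt_nonneg _⟩, ?_, ?_⟩
    · simp only [halfPlaneSq_zero, neg_sq, hx, hy]; ring
    · simp only [halfPlaneSq_one, mul_neg, neg_mul, hxy, abs_of_nonpos hv, neg_neg]

theorem surjective_halfPlaneSq : Function.Surjective halfPlaneSq := by
  intro w
  obtain ⟨q, h0, h1⟩ := exists_halfPlaneSq_eq (w 0) (w 1)
  refine ⟨q, ?_⟩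
  ext i
  fin_cases i
  · exact h0
  · exact h1

theorem isClosedMap_halfPlaneSq : IsClosedMap halfPlaneSq := by
  have hclosed : IsClosed {q : ℝ × ℝ | 0 ≤ q.2} := isClosed_le continuous_const continuous_snd
  refine (isProperMap_iff_isCompact_preimage.2 ⟨continuous_halfPlaneSq, fun K hK => ?_⟩).isClosedMap
  rw [Subtype.isCompact_iff]
  obtain ⟨R, hR⟩ := hK.isBounded.exists_norm_le
  refine Metric.isCompact_of_isClosed_isBounded
    (hclosed.isClosedEmbedding_subtypeVal.isClosedMap _ (hK.isClosed.preimage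
      continuous_halfPlaneSq)) ?_
  refine (Metric.isBounded_closedBall (x := (0 : ℝ × ℝ)) (r := R + 1)).subset ?_
  rintro _ ⟨⟨⟨x, y⟩, hy⟩, hq, rfl⟩
  have h1 := hR _ hq
  have h2 : ‖halfPlaneSq ⟨(x, y), hy⟩‖ = x ^ 2 + y ^ 2 := by
    rw [EuclideanSpace.norm_eq, Fin.sum_univ_two, halfPlaneSq_zero, halfPlaneSq_one,
      Real.norm_eq_abs, Real.norm_eq_abs, sq_abs, sq_abs,
      show (x ^ 2 - y ^ 2) ^ 2 + (2 * x * y) ^ 2 = (x ^ 2 + y ^ 2) ^ 2 by ring,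
      Real.sqrt_sq (by positivity)]
  rw [h2] at h1
  rw [mem_closedBall_zero_iff, Prod.norm_def, max_le_iff, Real.norm_eq_abs, Real.norm_eq_abs]
  constructor
  · linarith [sq_nonneg (|x| - 1), sq_abs x, abs_nonneg x, sq_nonneg y]
  · linarith [sq_nonneg (|y| - 1), sq_abs y, abs_nonneg y, sq_nonneg x]

/-- The space of boundary parameters is a plane. -/
noncomputable def boundaryParameterHomeomorph :
    BoundaryParameterSpace ≃ₜ EuclideanSpace ℝ (Fin 2) :=
  (Equiv.ofBijective
      (Quotient.lift halfPlaneSq fun a b h => (halfPlaneSq_eq_iff a b).2 h)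
      ⟨by
        rintro ⟨a⟩ ⟨b⟩ h
        exact Quotient.sound ((halfPlaneSq_eq_iff a b).1 h),
       fun w => by
        obtain ⟨q, hq⟩ := surjective_halfPlaneSq w
        exact ⟨Quotient.mk _ q, hq⟩⟩).toHomeomorphOfContinuousClosed
      (continuous_halfPlaneSq.quotient_lift _) (by
        intro K hK
        have h := isClosedMap_halfPlaneSq _ (hK.preimage continuous_quotient_mk')
        convert h using 1
        ext w
        constructor
        · rintro ⟨⟨q⟩, hq, rfl⟩
          exact ⟨q, hq, rfl⟩
        · rintro ⟨q, hq, rfl⟩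
          exact ⟨Quotient.mk _ q, hq, rfl⟩)

theorem boundaryParameterHomeomorph_mk (q : {q : ℝ × ℝ // 0 ≤ q.2}) :
    boundaryParameterHomeomorph (Quotient.mk halfPlaneSetoid q) = halfPlaneSq q := rfl

/-! ### Vectors modulo the diagonal -/

section Diagonal

variable {ι : Type*} [Fintype ι] [Nonempty ι]

/-- The total negative part of a vector, continued below `0` by minus the minimum of the vector if
that is positive. Along the diagonal direction it is strictly decreasing and surjective, so that a
vector is determined by its differences and this number. -/
noncomputable def negPartSum (E : ι → ℝ) : ℝ :=
  ∑ i, max (-E i) 0 - max (Finset.univ.inf' Finset.univ_nonempty E) 0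

theorem continuous_negPartSum : Continuous (negPartSum : (ι → ℝ) → ℝ) := by
  unfold negPartSum
  refine Continuous.sub (by fun_prop) (Continuous.max ?_ continuous_const)
  exact Continuous.finset_inf'_apply Finset.univ_nonempty fun i _ => continuous_apply i

theorem sub_le_negPartSum_sub (d : ι → ℝ) {s t : ℝ} (h : s ≤ t) :
    t - s ≤ negPartSum (fun i => d i + s) - negPartSum (fun i => d i + t) := by
  obtain ⟨j, -, hj⟩ := Finset.exists_mem_eq_inf' Finset.univ_nonempty d
  have hinf : ∀ u, Finset.univ.inf' Finset.univ_nonempty (fun i => d i + u) = d j + u := by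
    intro u
    apply le_antisymm
    · exact Finset.inf'_le _ (Finset.mem_univ j)
    · refine Finset.le_inf' _ _ fun i _ => ?_
      have := Finset.inf'_le d (Finset.mem_univ i)
      linarith
  have hsum : max (-(d j + s)) 0 - max (-(d j + t)) 0 ≤
      ∑ i, (max (-(d i + s)) 0 - max (-(d i + t)) 0) :=
    Finset.single_le_sum (f := fun i => max (-(d i + s)) 0 - max (-(d i + t)) 0)
      (fun i _ => sub_nonneg.2 (max_le_max_right 0 (by linarith))) (Finset.mem_univ j)
  rw [Finset.sum_sub_distrib] at hsum
  unfold negPartSum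
  rw [hinf, hinf]
  rcases le_total (d j + s) 0 with h1 | h1 <;> rcases le_total (d j + t) 0 with h2 | h2 <;>
    simp only [max_eq_left, max_eq_right, h1, h2, neg_nonneg, Left.neg_nonpos_iff]
      at hsum ⊢ <;>
    linarith

theorem abs_sub_le_abs_negPartSum_sub (d : ι → ℝ) (s t : ℝ) :
    |s - t| ≤ |negPartSum (fun i => d i + s) - negPartSum (fun i => d i + t)| := by
  rcases le_total s t with h | h
  · rw [abs_sub_comm s t, abs_of_nonneg (sub_nonneg.2 h)]
    exact (sub_le_negPartSum_sub d h).trans (le_abs_self _)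
  · rw [abs_of_nonneg (sub_nonneg.2 h), abs_sub_comm (negPartSum _)]
    exact (sub_le_negPartSum_sub d h).trans (le_abs_self _)

theorem exists_negPartSum_eq (d : ι → ℝ) (l : ℝ) : ∃ s, negPartSum (fun i => d i + s) = l := by
  have hc : Continuous fun s : ℝ => negPartSum fun i => d i + s :=
    continuous_negPartSum.comp (by fun_prop)
  refine mem_range_of_exists_le_of_exists_ge hc
    ⟨|negPartSum (fun i => d i + 0) - l|, ?_⟩ ⟨-|negPartSum (fun i => d i + 0) - l|, ?_⟩
  · have := sub_le_negPartSum_sub d (abs_nonneg (negPartSum (fun i => d i + 0) - l))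
    linarith [le_abs_self (negPartSum (fun i => d i + 0) - l)]
  · have := sub_le_negPartSum_sub d
      (neg_nonpos.2 (abs_nonneg (negPartSum (fun i => d i + 0) - l)))
    linarith [neg_abs_le (negPartSum (fun i => d i + 0) - l)]

theorem continuous_of_negPartSum {X : Type*} [TopologicalSpace X] {d : X → ι → ℝ} {s : X → ℝ}
    (hd : Continuous d) (h : Continuous fun x => negPartSum fun i => d x i + s x) :
    Continuous s := by
  refine continuous_iff_continuousAt.2 fun x₀ => ?_
  have hd' : ∀ i, Continuous fun x => d x i := fun i => (continuous_apply i).comp hd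
  have h1 : Continuous fun x => |negPartSum (fun i => d x i + s x) -
      negPartSum (fun i => d x i + s x₀)| :=
    (h.sub (continuous_negPartSum.comp (by fun_prop))).abs
  have h2 := h1.tendsto x₀
  simp only [sub_self, abs_zero] at h2
  rw [ContinuousAt, tendsto_iff_dist_tendsto_zero]
  exact squeeze_zero (fun x => dist_nonneg)
    (fun x => abs_sub_le_abs_negPartSum_sub (d x) (s x) (s x₀)) h2

end Diagonal

/-- A product of a locally bounded function `x` and a function `R` dominated by a continuous
function `l` is continuous if `x * l` is. -/
theorem continuous_mul_of_dominated {X : Type*} [TopologicalSpace X] {x l R A : X → ℝ} (K : ℝ)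
    (hA : Continuous A) (hxA : ∀ p, |x p| ≤ A p) (hl : Continuous l) (hR : Continuous R)
    (hRl : ∀ p, |R p| ≤ K * l p) (hxl : Continuous fun p => x p * l p) :
    Continuous fun p => x p * R p := by
  refine continuous_iff_continuousAt.2 fun p₀ => ?_
  by_cases h : l p₀ = 0
  · have h0 : x p₀ * R p₀ = 0 := by
      have := hRl p₀
      rw [h, mul_zero] at this
      rw [abs_nonpos_iff.1 this, mul_zero]
    have h1 : Filter.Tendsto (fun p => A p * (K * l p)) (nhds p₀) (nhds 0) := by
      have hc : Continuous fun p => A p * (K * l p) := by fun_prop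
      simpa only [h, mul_zero] using hc.tendsto p₀
    rw [ContinuousAt, h0]
    refine squeeze_zero_norm (fun p => ?_) h1
    rw [Real.norm_eq_abs, abs_mul]
    exact mul_le_mul (hxA p) (hRl p) (abs_nonneg _) ((abs_nonneg _).trans (hxA p))
  · have h1 : ContinuousAt (fun p => x p * l p / l p * R p) p₀ :=
      (hxl.continuousAt.div hl.continuousAt h).mul hR.continuousAt
    refine h1.congr ?_
    filter_upwards [hl.continuousAt.eventually_ne h] with p hp
    rw [mul_div_cancel_right₀ _ hp]

/-! ### Sequences with periodic increments -/

section PeriodicIncrements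

variable {m : ℕ} {T r : ℤ → ℝ}

theorem sub_eq_sum_Ioc_of_succ (hT : ∀ i, T (i + 1) = T i + r (i + 1)) {i j : ℤ} (hij : i ≤ j) :
    T j - T i = ∑ c ∈ Finset.Ioc i j, r c := by
  induction j, hij using Int.leInduction with
  | base => simp
  | succ j hij ih =>
    rw [← Finset.insert_Ioc_right_eq_Ioc_add_one hij, Finset.sum_insert (by simp), ← ih, hT]
    ring

theorem add_period_of_succ (hT : ∀ i, T (i + 1) = T i + r (i + 1)) (hr : ∀ i, r (i + m) = r i)
    (i : ℤ) : T (i + m) = T i + (T m - T 0) := by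
  have key : ∀ i, T (i + 1 + m) - T (i + 1) = T (i + m) - T i := fun i => by
    have h1 := hT (i + m)
    have h2 := hr (i + 1)
    rw [show i + m + 1 = i + 1 + m by ring, h2] at h1
    rw [h1, hT]; ring
  induction i using Int.induction_on with
  | zero => simp
  | succ k ih => linarith [key k]
  | pred k ih =>
    have := key (-k - 1)
    rw [sub_add_cancel] at this
    linarith

theorem sum_fin_eq_of_succ (hT : ∀ i, T (i + 1) = T i + r (i + 1)) (hr : ∀ i, r (i + m) = r i) :
    ∑ i : Fin m, r (i : ℤ) = T m - T 0 := by
  have key : ∀ k : ℕ, ∑ i ∈ Finset.range k, r (i : ℤ) = T (k - 1) - T (-1) := by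
    intro k
    induction k with
    | zero => simp
    | succ k ih =>
      have := hT (k - 1)
      rw [sub_add_cancel] at this
      rw [Finset.sum_range_succ, ih]
      push_cast
      rw [add_sub_cancel_right, this]
      ring
  have h := add_period_of_succ hT hr (-1)
  rw [show (-1 : ℤ) + m = m - 1 by ring] at h
  rw [Fin.sum_univ_eq_sum_range (fun i => r (i : ℤ)), key, h]
  ring

theorem exists_succ_eq_add (r : ℤ → ℝ) (t : ℝ) :
    ∃ T : ℤ → ℝ, T 0 = t ∧ ∀ i, T (i + 1) = T i + r (i + 1) := by
  refine ⟨fun i => t + ∑ c ∈ Finset.Ioc 0 i, r c - ∑ c ∈ Finset.Ioc i 0, r c, by simp, fun i => ?_⟩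
  rcases le_or_gt 0 i with h | h
  · simp only
    rw [← Finset.insert_Ioc_right_eq_Ioc_add_one h, Finset.sum_insert (by simp),
      Finset.Ioc_eq_empty (by omega : ¬ i + 1 < 0), Finset.Ioc_eq_empty (by omega : ¬ i < 0)]
    simp only [Finset.sum_empty]
    ring
  · have e : Finset.Ioc i 0 = insert (i + 1) (Finset.Ioc (i + 1) 0) := by
      ext c
      simp only [Finset.mem_insert, Finset.mem_Ioc]
      omega
    simp only
    rw [e, Finset.sum_insert (by simp), Finset.Ioc_eq_empty (by omega : ¬ (0 : ℤ) < i + 1),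
      Finset.Ioc_eq_empty (by omega : ¬ (0 : ℤ) < i)]
    simp only [Finset.sum_empty]
    ring

end PeriodicIncrements

/-! ### The coordinates of a measured lamination -/

namespace MeasuredLamination

variable {m : ℕ} {C : MarkedCrown m} (μ : MeasuredLamination C)

/-- The weight of the leaves above the cusp `i`, or minus the weight of the leaves from this cusp to
the crown boundary. Leaves of the two kinds do not occur together. -/
noncomputable def excess (i : ℤ) : ℝ := (μ.depth i).toReal - (μ.rayWeight i).toReal

/-- The total weight of the leaves that end on the crown boundary. -/
noncomputable def rayTotal : ℝ := μ.twistAt m - μ.twistAt 0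

/-- The part of the transverse measure between the side `0` and the basepoint that is not due to
leaves between cusps: the absolute value of the twist, or the weight of the crown boundary. At most
one of the two summands is nonzero. -/
noncomputable def reach : ℝ := |μ.twistAt 0| + (μ.weight .boundary).toReal

theorem toReal_depth (i : ℤ) : (μ.depth i).toReal = max (μ.excess i) 0 := by
  rcases μ.depth_eq_zero_or i with h | h <;> simp [excess, h]

theorem toReal_rayWeight (i : ℤ) : (μ.rayWeight i).toReal = max (-μ.excess i) 0 := by
  rcases μ.depth_eq_zero_or i with h | h <;> simp [excess, h]

theorem excess_add_nat (i : ℤ) : μ.excess (i + m) = μ.excess i := by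
  rw [excess, depth_add_nat, rayWeight_add_nat, excess]

theorem excess_emod (i : ℤ) : μ.excess (i % m) = μ.excess i := by
  have h : Function.Periodic μ.excess (m : ℤ) := μ.excess_add_nat
  rw [Int.emod_def, mul_comm]
  exact h.sub_int_mul_eq _

theorem toReal_sideDepth (hm : 0 < m) (i : ℤ) :
    (μ.sideDepth i).toReal = max (μ.depth i).toReal (μ.depth (i + 1)).toReal := by
  rw [sideDepth_eq_max, ENNReal.toReal_max (μ.depth_ne_top hm i) (μ.depth_ne_top hm (i + 1))]

theorem twistAt_sub (hm : 0 < m) {i j : ℤ} (hij : i ≤ j) :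
    μ.twistAt j - μ.twistAt i = ∑ c ∈ Finset.Ioc i j, (μ.rayWeight c).toReal :=
  sub_eq_sum_Ioc_of_succ (r := fun c => (μ.rayWeight c).toReal) (μ.twistAt_succ hm) hij

theorem twistAt_mono (hm : 0 < m) : Monotone μ.twistAt := fun i j hij => by
  have := μ.twistAt_sub hm hij
  have h : 0 ≤ ∑ c ∈ Finset.Ioc i j, (μ.rayWeight c).toReal :=
    Finset.sum_nonneg fun _ _ => ENNReal.toReal_nonneg
  linarith

theorem twistAt_add_nat (hm : 0 < m) (i : ℤ) :
    μ.twistAt (i + m) = μ.twistAt i + μ.rayTotal :=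
  add_period_of_succ (r := fun c => (μ.rayWeight c).toReal) (μ.twistAt_succ hm)
    (fun i => by rw [rayWeight_add_nat]) i

theorem twistAt_mul (hm : 0 < m) (k : ℤ) : μ.twistAt (k * m) = μ.twistAt 0 + k * μ.rayTotal := by
  induction k using Int.induction_on with
  | zero => simp
  | succ k ih =>
    have h := μ.twistAt_add_nat hm (k * m)
    rw [show (k + 1 : ℤ) * m = k * m + m by ring, h, ih]
    push_cast; ring
  | pred k ih =>
    have h := μ.twistAt_add_nat hm ((-k - 1 : ℤ) * m)
    rw [show (-k - 1 : ℤ) * m + m = -k * m by ring, ih] at h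
    push_cast at h ⊢
    linarith

theorem rayTotal_nonneg (hm : 0 < m) : 0 ≤ μ.rayTotal :=
  sub_nonneg.2 (μ.twistAt_mono hm (by omega))

theorem abs_twistAt_sub_le (hm : 0 < m) (i : ℤ) :
    |μ.twistAt i - μ.twistAt 0| ≤ |(i : ℝ)| * μ.rayTotal := by
  have h := μ.twistAt_mul hm i
  have hm' : (1 : ℤ) ≤ m := by omega
  rcases le_total 0 i with hi | hi
  · have h1 := μ.twistAt_mono hm hi
    have h2 := μ.twistAt_mono hm (le_mul_of_one_le_right hi hm')
    rw [abs_of_nonneg (by linarith), abs_of_nonneg (by exact_mod_cast hi)]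
    linarith
  · have h1 := μ.twistAt_mono hm hi
    have h2 := μ.twistAt_mono hm (mul_le_of_one_le_right hi hm')
    rw [abs_of_nonpos (by linarith), abs_of_nonpos (by exact_mod_cast hi)]
    linarith

theorem twistAt_eq_zero_of_rayTotal (hm : 0 < m) (h : μ.rayTotal = 0) (i : ℤ) :
    μ.twistAt i = 0 := by
  refine μ.twistAt_eq_zero (fun c => μ.weight_ray_of_rayWeight ?_) i
  have h1 := μ.twistAt_succ hm (c - 1)
  rw [sub_add_cancel] at h1
  have h2 := μ.abs_twistAt_sub_le hm (c - 1)
  have h3 := μ.abs_twistAt_sub_le hm c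
  rw [h, mul_zero, abs_nonpos_iff] at h2 h3
  exact ((ENNReal.toReal_eq_zero_iff _).1 (by linarith)).resolve_right (μ.rayWeight_ne_top hm c)

/-- If the crown boundary is a leaf then no leaves end on it. -/
theorem weight_boundary_eq_zero_or :
    (μ.weight .boundary).toReal = 0 ∨ ∀ i, μ.twistAt i = 0 := by
  by_cases h : μ.weight .boundary = 0
  · exact Or.inl (by rw [h, ENNReal.toReal_zero])
  · exact Or.inr (μ.twistAt_eq_zero (weight_ray_of_boundary h))

theorem rayTotal_eq_zero_or : (μ.weight .boundary).toReal = 0 ∨ μ.rayTotal = 0 :=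
  μ.weight_boundary_eq_zero_or.imp_right fun h => by rw [rayTotal, h, h, sub_zero]

theorem negPartSum_excess (hm : 0 < m) :
    haveI : Nonempty (Fin m) := ⟨⟨0, hm⟩⟩
    negPartSum (fun i : Fin m => μ.excess i) = μ.rayTotal := by
  have : Nonempty (Fin m) := ⟨⟨0, hm⟩⟩
  have h1 : ∑ i : Fin m, max (-μ.excess i) 0 = μ.rayTotal := by
    simp only [← toReal_rayWeight]
    exact sum_fin_eq_of_succ (r := fun c => (μ.rayWeight c).toReal) (μ.twistAt_succ hm)
      (fun i => by rw [rayWeight_add_nat])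
  have h2 : Finset.univ.inf' Finset.univ_nonempty (fun i : Fin m => μ.excess i) ≤ 0 := by
    obtain ⟨c, -, hc⟩ := μ.exists_depth_eq_commonDepth hm (show (0 : ℤ) < 0 + m by omega)
    rw [μ.commonDepth_eq_zero hm le_rfl] at hc
    have hmod : 0 ≤ c % m ∧ c % m < m :=
      ⟨Int.emod_nonneg _ (by omega), Int.emod_lt_of_pos _ (by omega)⟩
    refine (Finset.inf'_le (fun i : Fin m => μ.excess i)
      (Finset.mem_univ ⟨(c % m).toNat, by omega⟩)).trans ?_
    change μ.excess ((c % m).toNat : ℤ) ≤ 0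
    rw [Int.toNat_of_nonneg hmod.1, excess_emod, excess, hc, ENNReal.toReal_zero, zero_sub]
    exact neg_nonpos.2 ENNReal.toReal_nonneg
  rw [negPartSum, max_eq_right h2, h1, sub_zero]

theorem boundaryParameterHomeomorph_zero (hm : 0 < m) :
    boundaryParameterHomeomorph μ.boundaryParameters 0 = μ.reach ^ 2 - μ.rayTotal ^ 2 := by
  have h0 : μ.boundaryMeasure = μ.rayTotal - (μ.weight .boundary).toReal :=
    μ.boundaryMeasure_eq hm
  unfold boundaryParameters reach
  split_ifs with h
  · rw [boundaryParameterHomeomorph_mk, halfPlaneSq_zero]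
    simp only
    rcases μ.rayTotal_eq_zero_or with h1 | h1
    · rw [h0, h1, twist_eq_twistAt, add_zero, sub_zero, sq_abs]
    · have : 0 ≤ (μ.weight .boundary).toReal := ENNReal.toReal_nonneg
      linarith
  · rw [boundaryParameterHomeomorph_mk, halfPlaneSq_zero]
    simp only
    have h2 : μ.rayTotal = 0 := by
      rcases μ.rayTotal_eq_zero_or with h1 | h1
      · have := μ.rayTotal_nonneg hm
        linarith
      · exact h1
    rw [h0, h2, μ.twistAt_eq_zero_of_rayTotal hm h2, abs_zero]
    ring

theorem boundaryParameterHomeomorph_one (hm : 0 < m) :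
    boundaryParameterHomeomorph μ.boundaryParameters 1 = 2 * μ.twistAt 0 * μ.rayTotal := by
  have h0 : μ.boundaryMeasure = μ.rayTotal - (μ.weight .boundary).toReal :=
    μ.boundaryMeasure_eq hm
  unfold boundaryParameters
  split_ifs with h
  · rw [boundaryParameterHomeomorph_mk, halfPlaneSq_one]
    simp only
    rcases μ.rayTotal_eq_zero_or with h1 | h1
    · rw [h0, h1, twist_eq_twistAt, sub_zero]
    · have : 0 ≤ (μ.weight .boundary).toReal := ENNReal.toReal_nonneg
      linarith
  · rw [boundaryParameterHomeomorph_mk, halfPlaneSq_one]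
    simp only
    have h2 : μ.rayTotal = 0 := by
      rcases μ.rayTotal_eq_zero_or with h1 | h1
      · have := μ.rayTotal_nonneg hm
        linarith
      · exact h1
    rw [h2, mul_zero, mul_zero]

/-- The coordinates of a measured lamination: the boundary parameters as a point of the plane, and
the differences of the excesses of the cusps. -/
noncomputable def coordinates : EuclideanSpace ℝ (Fin (m + 1)) :=
  WithLp.toLp 2 fun j =>
    if (j : ℕ) = 0 then boundaryParameterHomeomorph μ.boundaryParameters 0
    else if (j : ℕ) = 1 then boundaryParameterHomeomorph μ.boundaryParameters 1
    else μ.excess ((j : ℤ) - 1) - μ.excess 0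

theorem coordinates_zero : μ.coordinates ⟨0, by omega⟩ =
    boundaryParameterHomeomorph μ.boundaryParameters 0 := rfl

theorem coordinates_one (hm : 0 < m) : μ.coordinates ⟨1, by omega⟩ =
    boundaryParameterHomeomorph μ.boundaryParameters 1 := rfl

theorem coordinates_add_two {i : ℕ} (hi : i + 2 < m + 1) : μ.coordinates ⟨i + 2, hi⟩ =
    μ.excess (i + 1 : ℕ) - μ.excess 0 := by
  have h : μ.coordinates ⟨i + 2, hi⟩ =
      if i + 2 = 0 then boundaryParameterHomeomorph μ.boundaryParameters 0
      else if i + 2 = 1 then boundaryParameterHomeomorph μ.boundaryParameters 1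
      else μ.excess (((i + 2 : ℕ) : ℤ) - 1) - μ.excess 0 := rfl
  rw [h, if_neg (by omega), if_neg (by omega)]
  congr 2
  push_cast
  ring

theorem reach_nonneg : 0 ≤ μ.reach := add_nonneg (abs_nonneg _) ENNReal.toReal_nonneg

theorem abs_twistAt_le_reach : |μ.twistAt 0| ≤ μ.reach :=
  le_add_of_nonneg_right ENNReal.toReal_nonneg

theorem sqrt_coordinates (hm : 0 < m) :
    √(μ.coordinates ⟨0, by omega⟩ ^ 2 + μ.coordinates ⟨1, by omega⟩ ^ 2) =
      μ.reach ^ 2 + μ.rayTotal ^ 2 := by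
  rw [coordinates_zero, coordinates_one _ hm, boundaryParameterHomeomorph_zero _ hm,
    boundaryParameterHomeomorph_one _ hm]
  have h : μ.twistAt 0 ^ 2 * μ.rayTotal ^ 2 = μ.reach ^ 2 * μ.rayTotal ^ 2 := by
    unfold reach
    rcases μ.rayTotal_eq_zero_or with h | h
    · rw [h, add_zero, sq_abs]
    · rw [h]; ring
  rw [show (μ.reach ^ 2 - μ.rayTotal ^ 2) ^ 2 + (2 * μ.twistAt 0 * μ.rayTotal) ^ 2 =
    (μ.reach ^ 2 + μ.rayTotal ^ 2) ^ 2 by linear_combination 4 * h]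
  exact Real.sqrt_sq (by positivity)

theorem rayTotal_eq_sqrt (hm : 0 < m) : μ.rayTotal =
    √((√(μ.coordinates ⟨0, by omega⟩ ^ 2 + μ.coordinates ⟨1, by omega⟩ ^ 2) -
      μ.coordinates ⟨0, by omega⟩) / 2) := by
  rw [sqrt_coordinates _ hm, coordinates_zero, boundaryParameterHomeomorph_zero _ hm,
    show (μ.reach ^ 2 + μ.rayTotal ^ 2 - (μ.reach ^ 2 - μ.rayTotal ^ 2)) / 2 = μ.rayTotal ^ 2 by
      ring, Real.sqrt_sq (μ.rayTotal_nonneg hm)]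

theorem reach_eq_sqrt (hm : 0 < m) : μ.reach =
    √((√(μ.coordinates ⟨0, by omega⟩ ^ 2 + μ.coordinates ⟨1, by omega⟩ ^ 2) +
      μ.coordinates ⟨0, by omega⟩) / 2) := by
  rw [sqrt_coordinates _ hm, coordinates_zero, boundaryParameterHomeomorph_zero _ hm,
    show (μ.reach ^ 2 + μ.rayTotal ^ 2 + (μ.reach ^ 2 - μ.rayTotal ^ 2)) / 2 = μ.reach ^ 2 by
      ring, Real.sqrt_sq μ.reach_nonneg]

theorem excess_sub_eq_coordinates {i : ℕ} (hi : i < m) : μ.excess i - μ.excess 0 =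
    if h : i = 0 then 0 else μ.coordinates ⟨i + 1, by omega⟩ := by
  cases i with
  | zero => simp
  | succ i => rw [dif_neg (by omega), ← coordinates_add_two]

/-! ### Transverse measures and coordinates -/

theorem toReal_transverseMeasure_side_side (hm : 0 < m) {i j : ℤ} (hij : i < j) :
    (μ.transverseMeasure (C.side i) (C.side j)).toReal =
      (μ.sideDepth i).toReal + (μ.sideDepth j).toReal - 2 * (μ.commonDepth i j).toReal +
        (μ.twistAt j - μ.twistAt i) ∧
    μ.transverseMeasure (C.side i) (C.side j) ≠ ⊤ := by
  have h := μ.transverseMeasure_side_side hij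
  have t1 := μ.sideDepth_ne_top hm
  have t2 := μ.commonDepth_ne_top hm hij
  have t3 : ∑ c ∈ Finset.Ioc i j, μ.rayWeight c ≠ ⊤ :=
    ENNReal.sum_ne_top.2 fun c _ => μ.rayWeight_ne_top hm c
  have t4 : μ.transverseMeasure (C.side i) (C.side j) ≠ ⊤ := by
    refine ne_top_of_le_ne_top (ENNReal.add_ne_top.2 ⟨ENNReal.add_ne_top.2 ⟨t1 i, t1 j⟩, t3⟩) ?_
    rw [← h]
    exact le_self_add
  refine ⟨?_, t4⟩
  have h' := congrArg ENNReal.toReal h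
  rw [ENNReal.toReal_add t4 (ENNReal.add_ne_top.2 ⟨t2, t2⟩), ENNReal.toReal_add t2 t2,
    ENNReal.toReal_add (ENNReal.add_ne_top.2 ⟨t1 i, t1 j⟩) t3, ENNReal.toReal_add (t1 i) (t1 j),
    ENNReal.toReal_sum fun c _ => μ.rayWeight_ne_top hm c] at h'
  rw [μ.twistAt_sub hm hij.le]
  linarith

theorem toReal_transverseMeasure_side_basePoint (hm : 0 < m) (i : ℤ) :
    (μ.transverseMeasure (C.side i) {C.basePoint}).toReal =
      (μ.sideDepth i).toReal + |μ.twistAt i| + (μ.weight .boundary).toReal ∧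
    μ.transverseMeasure (C.side i) {C.basePoint} ≠ ⊤ := by
  have t1 := μ.sideDepth_ne_top hm i
  have t2 := μ.raysBeyond_ne_top hm i
  have t3 := μ.raysBefore_ne_top hm i
  have t4 := μ.weight_ne_top .boundary CrownArc.not_isSide_boundary
  rw [transverseMeasure_side_basePoint, abs_twistAt]
  have t5 := ENNReal.add_ne_top.2 ⟨t2, t3⟩
  refine ⟨?_, ENNReal.add_ne_top.2 ⟨ENNReal.add_ne_top.2 ⟨t1, t5⟩, t4⟩⟩
  rw [ENNReal.toReal_add (ENNReal.add_ne_top.2 ⟨t1, t5⟩) t4, ENNReal.toReal_add t1 t5,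
    ENNReal.toReal_add t2 t3]

variable {X : Type*} [TopologicalSpace X] {F : X → MeasuredLamination C}

/-- The coordinates depend continuously on the transverse measures. The universal cover of the
crown is dual to a tree on which the deck group acts with translation length `rayTotal`, and
`sideDepth i` is the distance of the side `i` from the axis; hence both are linear combinations
of the displacements of the side `i` by the first two powers of the generator. -/
theorem continuous_coordinates_of_transverseMeasure (hm : 0 < m)
    (hf : ∀ i j, Continuous fun x => (F x).transverseMeasure (C.side i) (C.side j))
    (hg : ∀ i, Continuous fun x => (F x).transverseMeasure (C.side i) {C.basePoint}) :
    Continuous fun x => (F x).coordinates := by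
  have hf' : ∀ {i j}, i < j →
      Continuous fun x => ((F x).transverseMeasure (C.side i) (C.side j)).toReal := fun hij =>
    ENNReal.continuousOn_toReal.comp_continuous (hf _ _) fun x =>
      ((F x).toReal_transverseMeasure_side_side hm hij).2
  have hg' : ∀ i, Continuous fun x => ((F x).transverseMeasure (C.side i) {C.basePoint}).toReal :=
    fun i => ENNReal.continuousOn_toReal.comp_continuous (hg i) fun x =>
      ((F x).toReal_transverseMeasure_side_basePoint hm i).2
  have h1 : ∀ i x, ((F x).transverseMeasure (C.side i) (C.side (i + m))).toReal =
      2 * ((F x).sideDepth i).toReal + (F x).rayTotal := by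
    intro i x
    have hs : (F x).sideDepth (i + m) = (F x).sideDepth i := by
      rw [sideDepth_eq_max, depth_add_nat, show i + m + 1 = i + 1 + m by ring, depth_add_nat,
        sideDepth_eq_max]
    rw [((F x).toReal_transverseMeasure_side_side hm (show i < i + m by omega)).1,
      (F x).commonDepth_eq_zero hm le_rfl, (F x).twistAt_add_nat hm, hs, ENNReal.toReal_zero]
    ring
  have h2 : ∀ i x, ((F x).transverseMeasure (C.side i) (C.side (i + m + m))).toReal =
      2 * ((F x).sideDepth i).toReal + 2 * (F x).rayTotal := by
    intro i x
    have hs : ∀ i, (F x).sideDepth (i + m) = (F x).sideDepth i := by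
      intro i
      rw [sideDepth_eq_max, depth_add_nat, show i + m + 1 = i + 1 + m by ring, depth_add_nat,
        sideDepth_eq_max]
    rw [((F x).toReal_transverseMeasure_side_side hm (show i < i + m + m by omega)).1,
      (F x).commonDepth_eq_zero hm (by omega), (F x).twistAt_add_nat hm, (F x).twistAt_add_nat hm,
      hs, hs, ENNReal.toReal_zero]
    ring
  have hL : Continuous fun x => (F x).rayTotal := by
    have e : (fun x => (F x).rayTotal) = fun x =>
        ((F x).transverseMeasure (C.side 0) (C.side (0 + m + m))).toReal -
          ((F x).transverseMeasure (C.side 0) (C.side (0 + m))).toReal := by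
      funext x; rw [h1, h2]; ring
    rw [e]
    exact (hf' (by omega)).sub (hf' (by omega))
  have hH : ∀ i, Continuous fun x => ((F x).sideDepth i).toReal := by
    intro i
    have e : (fun x => ((F x).sideDepth i).toReal) = fun x =>
        (((F x).transverseMeasure (C.side i) (C.side (i + m))).toReal - (F x).rayTotal) / 2 := by
      funext x; rw [h1]; ring
    rw [e]
    exact ((hf' (by omega)).sub hL).div_const 2
  have hE : ∀ i, Continuous fun x => (F x).excess i := by
    intro i
    let Y : X → ℝ := fun x => ((F x).transverseMeasure (C.side (i - 1)) (C.side i)).toReal -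
      ((F x).sideDepth (i - 1)).toReal - ((F x).sideDepth i).toReal
    have hY : Continuous Y := ((hf' (by omega)).sub (hH _)).sub (hH _)
    have e : (fun x => (F x).excess i) = fun x => -max (Y x) 0 + max (-Y x) 0 / 2 := by
      funext x
      have h3 : Y x = -2 * max ((F x).excess i) 0 + max (-(F x).excess i) 0 := by
        have h4 := (F x).twistAt_succ hm (i - 1)
        have h5 : (F x).commonDepth (i - 1) i = (F x).depth i :=
          congrArg (F x).mass (congrArg CrownArc.lines (by
            funext p q
            simp only [eq_iff_iff]
            omega))
        rw [sub_add_cancel] at h4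
        simp only [Y]
        rw [((F x).toReal_transverseMeasure_side_side hm (show i - 1 < i by omega)).1, h4, h5,
          ← toReal_depth, ← toReal_rayWeight]
        ring
      rw [h3]
      rcases le_total 0 ((F x).excess i) with h | h
      · rw [max_eq_left h, max_eq_right (neg_nonpos.2 h), max_eq_right (by linarith),
          max_eq_left (by linarith)]
        ring
      · rw [max_eq_right h, max_eq_left (neg_nonneg.2 h), max_eq_left (by linarith),
          max_eq_right (by linarith)]
        ring
    rw [e]
    exact (hY.max continuous_const).neg.add ((hY.neg.max continuous_const).div_const 2)
  have hA : Continuous fun x => (F x).reach := by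
    have e : (fun x => (F x).reach) = fun x =>
        ((F x).transverseMeasure (C.side 0) {C.basePoint}).toReal -
          ((F x).sideDepth 0).toReal := by
      funext x
      rw [((F x).toReal_transverseMeasure_side_basePoint hm 0).1, reach]
      ring
    rw [e]
    exact (hg' 0).sub (hH 0)
  have hV : Continuous fun x => 2 * (F x).twistAt 0 * (F x).rayTotal := by
    have e : (fun x => 2 * (F x).twistAt 0 * (F x).rayTotal) = fun x =>
        (((F x).transverseMeasure (C.side m) {C.basePoint}).toReal -
          ((F x).sideDepth m).toReal) ^ 2 - (F x).reach ^ 2 - (F x).rayTotal ^ 2 := by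
      funext x
      have h3 := (F x).twistAt_add_nat hm 0
      rw [zero_add] at h3
      rw [((F x).toReal_transverseMeasure_side_basePoint hm m).1, reach, h3]
      rcases (F x).rayTotal_eq_zero_or with h | h
      · rw [h, add_zero, add_zero, add_sub_cancel_left, sq_abs, sq_abs]
        ring
      · rw [h, add_zero]
        ring
    rw [e]
    exact ((((hg' m).sub (hH m)).pow 2).sub (hA.pow 2)).sub (hL.pow 2)
  refine (PiLp.continuous_toLp 2 _).comp (continuous_pi fun j => ?_)
  by_cases h0 : (j : ℕ) = 0
  · simp only [if_pos h0, boundaryParameterHomeomorph_zero _ hm]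
    exact (hA.pow 2).sub (hL.pow 2)
  · by_cases h1 : (j : ℕ) = 1
    · simp only [if_neg h0, if_pos h1, boundaryParameterHomeomorph_one _ hm]
      exact hV
    · simp only [if_neg h0, if_neg h1]
      exact (hE _).sub (hE _)

theorem continuous_rayTotal (hm : 0 < m) (h : Continuous fun x => (F x).coordinates) :
    Continuous fun x => (F x).rayTotal := by
  have hc : ∀ j, Continuous fun x => (F x).coordinates j := fun j =>
    (EuclideanSpace.proj (𝕜 := ℝ) j).continuous.comp h
  simp only [fun x => (F x).rayTotal_eq_sqrt hm]
  have h0 := hc ⟨0, by omega⟩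
  have h1 := hc ⟨1, by omega⟩
  fun_prop

theorem continuous_reach (hm : 0 < m) (h : Continuous fun x => (F x).coordinates) :
    Continuous fun x => (F x).reach := by
  have hc : ∀ j, Continuous fun x => (F x).coordinates j := fun j =>
    (EuclideanSpace.proj (𝕜 := ℝ) j).continuous.comp h
  simp only [fun x => (F x).reach_eq_sqrt hm]
  have h0 := hc ⟨0, by omega⟩
  have h1 := hc ⟨1, by omega⟩
  fun_prop

theorem continuous_excess (hm : 0 < m) (h : Continuous fun x => (F x).coordinates) (i : ℤ) :
    Continuous fun x => (F x).excess i := by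
  have : Nonempty (Fin m) := ⟨⟨0, hm⟩⟩
  have hc : ∀ j, Continuous fun x => (F x).coordinates j := fun j =>
    (EuclideanSpace.proj (𝕜 := ℝ) j).continuous.comp h
  have hd : ∀ i : Fin m, Continuous fun x => (F x).excess i - (F x).excess 0 := by
    intro i
    simp only [fun x => (F x).excess_sub_eq_coordinates i.2]
    by_cases hi : (i : ℕ) = 0
    · simp only [dif_pos hi]; exact continuous_const
    · simp only [dif_neg hi]; exact hc _
  have h0 : Continuous fun x => (F x).excess 0 := by
    refine continuous_of_negPartSum (ι := Fin m)
      (d := fun x i => (F x).excess i - (F x).excess 0) (continuous_pi hd) ?_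
    simp only [sub_add_cancel]
    simp only [fun x => (F x).negPartSum_excess hm]
    exact continuous_rayTotal hm h
  have hmod : 0 ≤ i % m ∧ i % m < m :=
    ⟨Int.emod_nonneg _ (by omega), Int.emod_lt_of_pos _ (by omega)⟩
  have e : (fun x => (F x).excess i) = fun x =>
      (F x).excess ((i % m).toNat : ℤ) - (F x).excess 0 + (F x).excess 0 := by
    funext x
    rw [sub_add_cancel, Int.toNat_of_nonneg hmod.1, excess_emod]
  rw [e]
  exact (hd ⟨(i % m).toNat, by omega⟩).add h0

theorem continuous_toReal_sideDepth (hm : 0 < m) (h : Continuous fun x => (F x).coordinates)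
    (i : ℤ) : Continuous fun x => ((F x).sideDepth i).toReal := by
  simp only [fun x => (F x).toReal_sideDepth hm i, toReal_depth]
  exact ((continuous_excess hm h _).max continuous_const).max
    ((continuous_excess hm h _).max continuous_const)

theorem continuous_twistAt_sub (hm : 0 < m) (h : Continuous fun x => (F x).coordinates)
    (i j : ℤ) : Continuous fun x => (F x).twistAt j - (F x).twistAt i := by
  have key : ∀ {i j : ℤ}, i ≤ j → Continuous fun x => (F x).twistAt j - (F x).twistAt i := by
    intro i j hij
    simp only [fun x => (F x).twistAt_sub hm hij, toReal_rayWeight]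
    exact continuous_finsetSum _ fun c _ => (continuous_excess hm h c).neg.max continuous_const
  rcases le_total i j with hij | hij
  · exact key hij
  · exact (key hij).neg.congr fun x => neg_sub _ _

theorem toReal_commonDepth (hm : 0 < m) {i j : ℤ} (hij : i < j) : (μ.commonDepth i j).toReal =
    (Finset.Ioc i j).inf' (Finset.nonempty_Ioc.2 hij) fun c => (μ.depth c).toReal := by
  apply le_antisymm
  · refine Finset.le_inf' _ _ fun c hc => ?_
    rw [Finset.mem_Ioc] at hc
    exact ENNReal.toReal_mono (μ.depth_ne_top hm c) (μ.commonDepth_le_depth hc.1 hc.2)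
  · obtain ⟨c, hc, e⟩ := μ.exists_depth_eq_commonDepth hm hij
    rw [← e]
    exact Finset.inf'_le (fun c => (μ.depth c).toReal) hc

theorem continuous_transverseMeasure_side_side (hm : 0 < m)
    (h : Continuous fun x => (F x).coordinates) (i j : ℤ) :
    Continuous fun x => (F x).transverseMeasure (C.side i) (C.side j) := by
  have key : ∀ {i j : ℤ}, i < j →
      Continuous fun x => (F x).transverseMeasure (C.side i) (C.side j) := by
    intro i j hij
    have e : (fun x => (F x).transverseMeasure (C.side i) (C.side j)) = fun x =>
        ENNReal.ofReal (((F x).sideDepth i).toReal + ((F x).sideDepth j).toReal -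
          2 * (Finset.Ioc i j).inf' (Finset.nonempty_Ioc.2 hij) (fun c => max ((F x).excess c) 0) +
          ((F x).twistAt j - (F x).twistAt i)) := by
      funext x
      obtain ⟨h1, h2⟩ := (F x).toReal_transverseMeasure_side_side hm hij
      rw [← ENNReal.ofReal_toReal h2, h1, toReal_commonDepth _ hm hij]
      simp only [toReal_depth]
    rw [e]
    refine ENNReal.continuous_ofReal.comp ((((continuous_toReal_sideDepth hm h i).add
      (continuous_toReal_sideDepth hm h j)).sub (continuous_const.mul ?_)).add
        (continuous_twistAt_sub hm h i j))
    exact Continuous.finset_inf'_apply _ fun c _ =>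
      (continuous_excess hm h c).max continuous_const
  rcases lt_trichotomy i j with hij | rfl | hij
  · exact key hij
  · simp only [transverseMeasure_side_self]
    exact continuous_const
  · simp only [fun x => (F x).transverseMeasure_side_comm i j]
    exact key hij

/-- The absolute value of the twist at a side plus the weight of the crown boundary depends
continuously on the coordinates, also where the two summands do not: at the laminations that have
the crown boundary as a leaf. -/
theorem continuous_abs_twistAt_add (hm : 0 < m) (h : Continuous fun x => (F x).coordinates)
    (i : ℤ) : Continuous fun x => |(F x).twistAt i| + ((F x).weight .boundary).toReal := by
  have hc : Continuous fun x => (F x).coordinates ⟨1, by omega⟩ :=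
    (EuclideanSpace.proj (𝕜 := ℝ) (⟨1, by omega⟩ : Fin (m + 1))).continuous.comp h
  have h1 : Continuous fun x => (F x).twistAt 0 * (F x).rayTotal := by
    have e : (fun x => (F x).twistAt 0 * (F x).rayTotal) = fun x =>
        (F x).coordinates ⟨1, by omega⟩ / 2 := by
      funext x
      rw [coordinates_one _ hm, boundaryParameterHomeomorph_one _ hm]
      ring
    rw [e]
    exact hc.div_const 2
  have h2 : Continuous fun x => (F x).twistAt 0 * ((F x).twistAt i - (F x).twistAt 0) :=
    continuous_mul_of_dominated |(i : ℝ)| (continuous_reach hm h)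
      (fun x => (F x).abs_twistAt_le_reach) (continuous_rayTotal hm h)
      (continuous_twistAt_sub hm h 0 i) (fun x => (F x).abs_twistAt_sub_le hm i) h1
  have e : (fun x => |(F x).twistAt i| + ((F x).weight .boundary).toReal) = fun x =>
      √((F x).reach ^ 2 + 2 * ((F x).twistAt 0 * ((F x).twistAt i - (F x).twistAt 0)) +
        ((F x).twistAt i - (F x).twistAt 0) ^ 2) := by
    funext x
    unfold reach
    rcases (F x).weight_boundary_eq_zero_or with h | h
    · rw [h, add_zero, add_zero, sq_abs, ← Real.sqrt_sq_eq_abs]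
      congr 1
      ring
    · rw [h, h, abs_zero, zero_add, sub_zero]
      rw [show (((F x).weight .boundary).toReal ^ 2 + 2 * (0 * 0) + 0 ^ 2 : ℝ) =
        ((F x).weight .boundary).toReal ^ 2 by ring, Real.sqrt_sq ENNReal.toReal_nonneg]
  rw [e]
  exact Real.continuous_sqrt.comp ((((continuous_reach hm h).pow 2).add
    (continuous_const.mul h2)).add ((continuous_twistAt_sub hm h 0 i).pow 2))

theorem continuous_transverseMeasure_side_basePoint (hm : 0 < m)
    (h : Continuous fun x => (F x).coordinates) (i : ℤ) :
    Continuous fun x => (F x).transverseMeasure (C.side i) {C.basePoint} := by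
  have e : (fun x => (F x).transverseMeasure (C.side i) {C.basePoint}) = fun x =>
      ENNReal.ofReal (((F x).sideDepth i).toReal +
        (|(F x).twistAt i| + ((F x).weight .boundary).toReal)) := by
    funext x
    obtain ⟨h1, h2⟩ := (F x).toReal_transverseMeasure_side_basePoint hm i
    rw [← ENNReal.ofReal_toReal h2, h1, add_assoc]
  rw [e]
  exact ENNReal.continuous_ofReal.comp ((continuous_toReal_sideDepth hm h i).add
    (continuous_abs_twistAt_add hm h i))

theorem isInducing_coordinates (hm : 0 < m) :
    Topology.IsInducing (coordinates : MeasuredLamination C → _) := by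
  have hind : Topology.IsInducing fun μ : MeasuredLamination C =>
      ((fun q : ℤ × ℤ => μ.transverseMeasure (C.side q.1) (C.side q.2)),
       (fun i : ℤ => μ.transverseMeasure (C.side i) {C.basePoint})) := ⟨rfl⟩
  refine ⟨le_antisymm ?_ ?_⟩
  · rw [← continuous_iff_le_induced]
    exact continuous_coordinates_of_transverseMeasure (F := id) hm
      (fun i j => (continuous_apply (i, j)).comp (continuous_fst.comp hind.continuous))
      (fun i => (continuous_apply i).comp (continuous_snd.comp hind.continuous))
  · rw [hind.eq_induced, ← continuous_iff_le_induced]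
    let _ : TopologicalSpace (MeasuredLamination C) :=
      TopologicalSpace.induced coordinates inferInstance
    have hc : Continuous fun μ : MeasuredLamination C => (id μ).coordinates :=
      continuous_induced_dom
    exact Continuous.prodMk
      (continuous_pi fun q => continuous_transverseMeasure_side_side hm hc q.1 q.2)
      (continuous_pi fun i => continuous_transverseMeasure_side_basePoint hm hc i)

/-! ### Bijectivity -/

variable {μ} {ν : MeasuredLamination C}

theorem coordinates_eq_of_classWeight_eq (hm : 0 < m) (h : μ.classWeight = ν.classWeight) :
    μ.coordinates = ν.coordinates := by
  have h1 : μ.excess = ν.excess := by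
    funext i
    rw [excess, excess, depth_eq_of_classWeight_eq h, rayWeight_eq_of_classWeight_eq h]
  unfold coordinates
  simp only [boundaryParameterHomeomorph_zero _ hm, boundaryParameterHomeomorph_one _ hm, rayTotal,
    reach, h1, twistAt_eq_of_classWeight_eq h, weight_boundary_eq_of_classWeight_eq h]

theorem excess_eq_of_coordinates_eq (hm : 0 < m) (h : μ.coordinates = ν.coordinates) :
    μ.excess = ν.excess := by
  have : Nonempty (Fin m) := ⟨⟨0, hm⟩⟩
  have hd : ∀ i : Fin m, μ.excess i - μ.excess 0 = ν.excess i - ν.excess 0 := fun i => by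
    rw [excess_sub_eq_coordinates _ i.2, excess_sub_eq_coordinates _ i.2, h]
  have h0 : μ.excess 0 = ν.excess 0 := by
    have h1 := abs_sub_le_abs_negPartSum_sub (fun i : Fin m => μ.excess i - μ.excess 0)
      (μ.excess 0) (ν.excess 0)
    have h2 : (fun i : Fin m => μ.excess i - μ.excess 0 + ν.excess 0) =
        fun i : Fin m => ν.excess i :=
      funext fun i => by rw [hd i, sub_add_cancel]
    simp only [sub_add_cancel] at h1
    rw [h2, negPartSum_excess _ hm, negPartSum_excess _ hm, rayTotal_eq_sqrt _ hm,
      rayTotal_eq_sqrt _ hm, h, sub_self, abs_zero, abs_nonpos_iff, sub_eq_zero] at h1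
    exact h1
  funext i
  have hmod : 0 ≤ i % m ∧ i % m < m :=
    ⟨Int.emod_nonneg _ (by omega), Int.emod_lt_of_pos _ (by omega)⟩
  have h1 := hd ⟨(i % m).toNat, by omega⟩
  simp only [Int.toNat_of_nonneg hmod.1, excess_emod] at h1
  linarith

theorem classWeight_eq_of_coordinates_eq (hm : 0 < m) (h : μ.coordinates = ν.coordinates) :
    μ.classWeight = ν.classWeight := by
  have hE := excess_eq_of_coordinates_eq hm h
  have hL : μ.rayTotal = ν.rayTotal := by
    rw [rayTotal_eq_sqrt _ hm, rayTotal_eq_sqrt _ hm, h]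
  have hA : μ.reach = ν.reach := by rw [reach_eq_sqrt _ hm, reach_eq_sqrt _ hm, h]
  have hD : μ.depth = ν.depth := funext fun i => by
    rw [← ENNReal.toReal_eq_toReal_iff' (μ.depth_ne_top hm i) (ν.depth_ne_top hm i),
      toReal_depth, toReal_depth, hE]
  have h0 : μ.twistAt 0 = ν.twistAt 0 := by
    by_cases hz : μ.rayTotal = 0
    · rw [μ.twistAt_eq_zero_of_rayTotal hm hz, ν.twistAt_eq_zero_of_rayTotal hm (hL ▸ hz)]
    · have h1 : μ.coordinates ⟨1, by omega⟩ = ν.coordinates ⟨1, by omega⟩ := by rw [h]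
      rw [coordinates_one _ hm, coordinates_one _ hm, boundaryParameterHomeomorph_one _ hm,
        boundaryParameterHomeomorph_one _ hm, ← hL] at h1
      have := mul_right_cancel₀ hz h1
      linarith
  have hT : μ.twistAt = ν.twistAt := by
    have key : ∀ {i j : ℤ}, i ≤ j → μ.twistAt j - μ.twistAt i = ν.twistAt j - ν.twistAt i := by
      intro i j hij
      rw [μ.twistAt_sub hm hij, ν.twistAt_sub hm hij]
      simp only [toReal_rayWeight, hE]
    funext i
    rcases le_total 0 i with hi | hi <;> linarith [key hi]
  refine classWeight_eq_of_invariants_eq hm hD hT ?_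
  rw [← ENNReal.toReal_eq_toReal_iff' (μ.weight_ne_top _ CrownArc.not_isSide_boundary)
    (ν.weight_ne_top _ CrownArc.not_isSide_boundary)]
  unfold reach at hA
  rw [h0] at hA
  linarith

theorem surjective_coordinates (hm : 0 < m) :
    Function.Surjective (coordinates : MeasuredLamination C → _) := by
  have : Nonempty (Fin m) := ⟨⟨0, hm⟩⟩
  intro w
  obtain ⟨⟨⟨x, L⟩, hL⟩, hu, hv⟩ := exists_halfPlaneSq_eq (w ⟨0, by omega⟩) (w ⟨1, by omega⟩)
  rw [halfPlaneSq_zero] at hu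
  rw [halfPlaneSq_one] at hv
  simp only at hL hu hv
  let d : ℕ → ℝ := fun i => if h : i ≠ 0 ∧ i < m then w ⟨i + 1, by omega⟩ else 0
  obtain ⟨s, hs⟩ := exists_negPartSum_eq (fun i : Fin m => d i) L
  let E : ℤ → ℝ := fun i => d (i % m).toNat + s
  have hEfin : ∀ i : Fin m, E (i : ℕ) = d i + s := fun i => by
    have : ((i : ℕ) : ℤ) % m = (i : ℕ) := Int.emod_eq_of_lt (by omega) (by omega)
    simp only [E, this, Int.toNat_natCast]
  have hEadd : ∀ i, E (i + m) = E i := fun i => by simp only [E, Int.add_emod_right]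
  have hEneg : negPartSum (fun i : Fin m => E (i : ℕ)) = L := by
    simp only [hEfin]; exact hs
  let r : ℤ → ℝ := fun i => max (-E i) 0
  have hr : ∀ i, r (i + m) = r i := fun i => by simp only [r, hEadd]
  obtain ⟨T, hT0, hT⟩ := exists_succ_eq_add r x
  obtain ⟨c, -, hc⟩ := Finset.exists_mem_eq_inf' Finset.univ_nonempty
    fun i : Fin m => E (i : ℕ)
  have hsum := sum_fin_eq_of_succ hT hr
  -- a positive minimum would make `negPartSum` negative
  have hcE : E (c : ℕ) ≤ 0 := by
    by_contra! hpos
    have h1 : ∑ i : Fin m, max (-E (i : ℕ)) 0 = 0 := Finset.sum_eq_zero fun i _ => by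
      have := Finset.inf'_le (fun i : Fin m => E (i : ℕ)) (Finset.mem_univ i)
      rw [hc] at this
      exact max_eq_right (by linarith)
    rw [negPartSum, h1, hc, max_eq_left hpos.le] at hEneg
    linarith
  have hTm : T m - T 0 = L := by
    rw [negPartSum, hc, max_eq_right hcE, sub_zero] at hEneg
    rw [← hsum, ← hEneg]
  let I : CrownInvariants m :=
    { depth := E
      twist := T
      length := L
      boundary := if L = 0 then |x| else 0
      depth_add := hEadd
      exists_depth_nonpos := ⟨_, hcE⟩
      twist_mono := monotone_int_of_le_succ fun i => by
        rw [hT]; exact le_add_of_nonneg_right (le_max_right _ _)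
      twist_add := fun i => by rw [add_period_of_succ hT hr, hTm]
      twist_eq := fun i hi => by
        have := hT (i - 1)
        rw [sub_add_cancel] at this
        rw [this]
        simp only [r, max_eq_right (neg_nonpos.2 hi.le), add_zero]
      length_eq := fun hb => by
        by_contra hne
        rw [if_neg hne] at hb
        exact lt_irrefl _ hb }
  let ρ := I.lamination C hm
  have hρE : ∀ i, ρ.excess i = E i := by
    intro i
    have h1 : ρ.depth i = ENNReal.ofReal (E i) := I.depth_lamination C hm i
    have h2 : ρ.rayWeight i = ENNReal.ofReal (T i - T (i - 1)) := I.rayWeight_lamination C hm i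
    have h3 := hT (i - 1)
    rw [sub_add_cancel] at h3
    rw [excess, h1, h2, h3, add_sub_cancel_left, ENNReal.toReal_ofReal (le_max_right _ _),
      ENNReal.toReal_ofReal']
    rcases le_total 0 (E i) with h | h
    · rw [max_eq_left h, max_eq_right (neg_nonpos.2 h), sub_zero]
    · rw [max_eq_right h, max_eq_left (neg_nonneg.2 h)]
      ring
  have hρL : ρ.rayTotal = L := by
    rw [← negPartSum_excess _ hm, ← hEneg]
    simp only [hρE]
  have hρβ : (ρ.weight .boundary).toReal = if L = 0 then |x| else 0 := by
    have h1 : ρ.weight .boundary = ENNReal.ofReal (if L = 0 then |x| else 0) :=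
      I.weight_boundary_lamination C hm
    rw [h1, ENNReal.toReal_ofReal]
    split_ifs
    · exact abs_nonneg x
    · exact le_rfl
  have hρA : ρ.reach ^ 2 = x ^ 2 ∧ ρ.twistAt 0 * L = x * L := by
    by_cases h : L = 0
    · have h1 : ρ.twistAt 0 = 0 := ρ.twistAt_eq_zero_of_rayTotal hm (hρL.trans h) 0
      rw [reach, hρβ, if_pos h, h1, abs_zero, zero_add, sq_abs, h]
      simp
    · have h1 : ρ.twistAt 0 = T 0 :=
        I.twistAt_lamination C hm (lt_of_le_of_ne hL (Ne.symm h))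
      rw [reach, hρβ, if_neg h, h1, hT0, add_zero, sq_abs]
      simp
  refine ⟨ρ, ?_⟩
  ext ⟨j, hj⟩
  match j, hj with
  | 0, _ => rw [coordinates_zero, boundaryParameterHomeomorph_zero _ hm, hρA.1, hρL, hu]
  | 1, _ =>
    rw [coordinates_one _ hm, boundaryParameterHomeomorph_one _ hm, hρL, mul_assoc, hρA.2,
      ← mul_assoc, hv]
  | i + 2, hj =>
    have h1 : E (i + 1 : ℕ) = d (i + 1) + s := hEfin ⟨i + 1, by omega⟩
    have h2 : E 0 = d 0 + s := hEfin ⟨0, hm⟩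
    have h3 : d (i + 1) = w ⟨i + 1 + 1, by omega⟩ := dif_pos ⟨by omega, by omega⟩
    have h4 : d 0 = 0 := dif_neg (by simp)
    rw [coordinates_add_two, hρE, hρE, h1, h2, h3, h4]
    ring

end MeasuredLamination

/-! ### The homeomorphism -/

namespace LaminationSpace

variable {m : ℕ} {C : MarkedCrown m}

/-- The coordinates of a point of the space of measured laminations. -/
noncomputable def coordinates (hm : 0 < m) (C : MarkedCrown m) :
    LaminationSpace C → EuclideanSpace ℝ (Fin (m + 1)) :=
  Quotient.lift MeasuredLamination.coordinates
    fun _ _ h => MeasuredLamination.coordinates_eq_of_classWeight_eq hm h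

theorem bijective_coordinates (hm : 0 < m) (C : MarkedCrown m) :
    Function.Bijective (coordinates hm C) := by
  constructor
  · rintro ⟨μ⟩ ⟨ν⟩ h
    exact Quotient.sound (MeasuredLamination.classWeight_eq_of_coordinates_eq hm h)
  · intro w
    obtain ⟨μ, hμ⟩ := MeasuredLamination.surjective_coordinates (C := C) hm w
    exact ⟨LaminationSpace.mk μ, hμ⟩

theorem isInducing_coordinates (hm : 0 < m) (C : MarkedCrown m) :
    Topology.IsInducing (coordinates hm C) := by
  have hind := MeasuredLamination.isInducing_coordinates (C := C) hm
  have hc : Continuous (coordinates hm C) := hind.continuous.quotient_lift _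
  refine ⟨le_antisymm hc.le_induced fun U hU => ?_⟩
  have hU' : IsOpen (Quotient.mk (MeasuredLamination.properHomotopySetoid C) ⁻¹' U) :=
    hU.preimage continuous_quotient_mk'
  obtain ⟨W, hW, hWU⟩ := hind.isOpen_iff.1 hU'
  refine ⟨W, hW, ?_⟩
  ext ⟨μ⟩
  exact Set.ext_iff.1 hWU μ

/-- The space of measured laminations on a crown with `m` cusps is homeomorphic to `ℝ ^ (m + 1)`. -/
noncomputable def homeomorph (hm : 0 < m) (C : MarkedCrown m) :
    LaminationSpace C ≃ₜ EuclideanSpace ℝ (Fin (m + 1)) :=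
  (Equiv.ofBijective _ (bijective_coordinates hm C)).toHomeomorphOfIsInducing
    (isInducing_coordinates hm C)

end LaminationSpace

theorem proposition3 (n : ℕ) (hn : 3 ≤ n) (C : MarkedCrown (n - 2)) :
    ∃ (Φ : LaminationSpace C ≃ₜ EuclideanSpace ℝ (Fin (n - 1)))
      (ψ : BoundaryParameterSpace ≃ₜ EuclideanSpace ℝ (Fin 2)),
      ∀ μ : MeasuredLamination C,
        Φ (LaminationSpace.mk μ) ⟨0, by omega⟩ = ψ μ.boundaryParameters 0 ∧
        Φ (LaminationSpace.mk μ) ⟨1, by omega⟩ = ψ μ.boundaryParameters 1 := by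
  obtain ⟨m, rfl⟩ : ∃ m, n = m + 2 := ⟨n - 2, by omega⟩
  have hm : 0 < m := by omega
  exact ⟨LaminationSpace.homeomorph hm C, boundaryParameterHomeomorph, fun μ =>
    ⟨μ.coordinates_zero, μ.coordinates_one hm⟩⟩
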